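/- Let $(X,\mu)$ be a $\sigma$-finite measure space and let $A$ be a non-negative self-adjoint operator on the real Hilbert space $L^2(X)=L^2(X,\mu;\mathbb R)$ with spectral resolution $\{E_A(\lambda)\}_{\lambda\in\mathbb R}$. For Borel $\phi:\mathbb R\to\mathbb R$ put $\phi(A)=\int_{\sigma(A)}\phi(\lambda)\,dE_A(\lambda)$ with domain $\{f\in L^2(X):\int_{\sigma(A)}|\phi(\lambda)|^2\,d\|E_A(\lambda)f\|_{L^2}^2<\infty\}$. Let $H^1(A)$ be the domain of $(I+A)^{1/2}$, with norm $\|f\|_{H^1(A)}=\|(I+A)^{1/2}f\|_{L^2}$. Let $\alpha>0$ and assume: (A) there is $C>0$ with $\|e^{-tA}f\|_{L^\infty}\le C t^{-\alpha}\|f\|_{L^2}$ for all $t>0$ and $f\in L^2(X)$; (B) if $\alpha>1/2$, then for every $q$ with $\frac{4\alpha}{4\alpha-1}<q<4\alpha$ there is $C>0$ with $\|e^{-tA}f\|_{L^q}\le C\|f\|_{L^q}$ and $\|e^{-tA}f\|_{L^\infty}\le C t^{-2\alpha/q}\|f\|_{L^q}$ for all $t>0$ and $f\in L^2(X)\cap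 L^q(X)$. Let $p\in(1,\infty)$, with $p\le \frac{2\alpha}{2\alpha-1}$ if $\alpha>1/2$. Let $F\in C^1(\mathbb R;\mathbb R)$ satisfy $F(0)=0$ and $|F(z_1)-F(z_2)|\le C(|z_1|+|z_2|)^{p-1}|z_1-z_2|$ for all $z_1,z_2\in\mathbb R$ and some constant $C$. For $t,\lambda\ge0$ let $$\mathcal D(t,\lambda)=\begin{cases} e^{-t/2}\,\dfrac{\sinh\big(t\sqrt{1/4-\lambda}\big)}{\sqrt{1/4-\lambda}}, & \lambda<\tfrac14,\\ t e^{-t/2}, & \lambda=\tfrac14,\\ e^{-t/2}\,\dfrac{\sin\big(t\sqrt{\lambda-1/4}\big)}{\sqrt{\lambda-1/4}}, & \lambda>\tfrac14,\end{cases}$$ and let $\mathcal D(t,A)$ and $\partial_t\mathcal D(t,A)$ be the operators with symbols $\mathcal D(t,\cdot)$ and $\partial_t\mathcal D(t,\cdot)$. For $T>0$ and $(u_0,u_1)\in H^1(A)\times L^2(X)$, a (mild) solution on $[0,T]$ of $$\partial_t^2u+Au+\partial_tu=F(u),\qquad u(0)=u_0,\quad \partial_tu(0)=u_1,$$ is a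 function $u\in C([0,T];H^1(A))\cap C^1([0,T];L^2(X))$ such that for all $t\in[0,T]$ $$u(t)=\mathcal D(t,A)(u_0+u_1)+\partial_t\mathcal D(t,A)u_0+\int_0^t\mathcal D(t-\tau,A)F(u(\tau))\,d\tau .$$ Then for every $(u_0,u_1)\in H^1(A)\times L^2(X)$ there is a time $T>0$, depending (for given $X,\mu,A,\alpha,p,F$) only on $\|u_0\|_{H^1(A)}$ and $\|u_1\|_{L^2}$, such that there is a unique solution on $[0,T]$ with data $(u_0,u_1)$. Moreover, let $$T_{\max}=T_{\max}(u_0,u_1):=\sup\{T>0:\text{ there is a unique solution on }[0,T]\text{ with data }(u_0,u_1)\}\in(0,\infty].$$ There is a function $u$ on $[0,T_{\max})$ whose restriction to $[0,T]$ is a solution for every $0<T<T_{\max}$, and if $T_{\max}<\infty$, then every such $u$ satisfies $$\lim_{t\to T_{\max}}\big(\|u(t)\|_{H^1(A)}+\|u_t(t)\|_{L^2}\big)=\infty .$$ -/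

import Mathlib

open MeasureTheory Set Filter Topology
open scoped ENNReal InnerProductSpace

noncomputable section

namespace DampedWave

section Spectral

variable {H : Type*} [NormedAddCommGroup H] [InnerProductSpace ℝ H] [CompleteSpace H]

/-- A resolution of the identity `{E(l)}` on a real Hilbert space: an increasing, strongly
right-continuous family of orthogonal projections running from `0` to the identity. -/
structure ResolutionOfIdentity (H : Type*) [NormedAddCommGroup H] [InnerProductSpace ℝ H]
    [CompleteSpace H] where
  proj : ℝ → H →L[ℝ] H
  isStarProjection : ∀ a, IsStarProjection (proj a)
  proj_mul_proj : ∀ a b, a ≤ b → proj a * proj b = proj a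
  right_continuous : ∀ (f : H) (a : ℝ), ContinuousWithinAt (fun l => proj l f) (Ici a) a
  tendsto_atBot : ∀ f : H, Tendsto (fun l => proj l f) atBot (𝓝 0)
  tendsto_atTop : ∀ f : H, Tendsto (fun l => proj l f) atTop (𝓝 f)

namespace ResolutionOfIdentity

theorem norm_proj_le (E : ResolutionOfIdentity H) (a : ℝ) (f : H) : ‖E.proj a f‖ ≤ ‖f‖ := by
  have h1 : ‖E.proj a‖ ≤ 1 := (E.isStarProjection a).norm_le
  calc ‖E.proj a f‖ ≤ ‖E.proj a‖ * ‖f‖ := (E.proj a).le_opNorm f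
    _ ≤ 1 * ‖f‖ := by gcongr
    _ = ‖f‖ := one_mul _

/-- The distribution function `l ↦ ‖E(l) f‖²`. -/
def distribution (E : ResolutionOfIdentity H) (f : H) : StieltjesFunction ℝ where
  toFun l := ‖E.proj l f‖ ^ 2
  mono' a b hab := by
    have h : E.proj a f = E.proj a (E.proj b f) := by
      conv_lhs => rw [← E.proj_mul_proj a b hab]
      rfl
    have h2 : ‖E.proj a f‖ ≤ ‖E.proj b f‖ := by
      rw [h]
      exact E.norm_proj_le a _
    exact pow_le_pow_left₀ (norm_nonneg _) h2 2
  right_continuous' a := (E.right_continuous f a).norm.pow 2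

/-- The spectral measure `d‖E(l) f‖²` of the vector `f`. -/
def measure (E : ResolutionOfIdentity H) (f : H) : Measure ℝ := (E.distribution f).measure

/-- `f` lies in the domain of `∫ φ(l) dE(l)`, that is, `∫ |φ(l)|² d‖E(l) f‖² < ∞`. -/
def MemDom (E : ResolutionOfIdentity H) (φ : ℝ → ℝ) (f : H) : Prop :=
  ∫⁻ l, ENNReal.ofReal (φ l ^ 2) ∂(E.measure f) < ∞

/-- The integral `∫ φ(l) d⟪E(l) f, h⟫`; the real polarization identity expresses
`d⟪E(l) f, h⟫` through the positive measures `d‖E(l)(f + h)‖²` and `d‖E(l)(f - h)‖²`. -/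
def weakIntegral (E : ResolutionOfIdentity H) (φ : ℝ → ℝ) (f h : H) : ℝ :=
  (1 / 4) * ((∫ l, φ l ∂(E.measure (f + h))) - ∫ l, φ l ∂(E.measure (f - h)))

/-- `f` is in the domain of `∫ φ(l) dE(l)` and `(∫ φ(l) dE(l)) f = g`, where the value is tested
against the (dense) domain of the operator. -/
def HasValue (E : ResolutionOfIdentity H) (φ : ℝ → ℝ) (f g : H) : Prop :=
  E.MemDom φ f ∧ ∀ h : H, E.MemDom φ h → ⟪g, h⟫_ℝ = E.weakIntegral φ f h

/-- `E` is the spectral resolution of the identity for the operator `A`: `A = ∫ l dE(l)`,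
including equality of the domains. -/
def IsResolutionOf (E : ResolutionOfIdentity H) (A : H →ₗ.[ℝ] H) : Prop :=
  ∀ f g : H, (f, g) ∈ A.graph ↔ E.HasValue (fun l => l) f g

/-- The resolution of the identity of the zero operator. -/
instance : Inhabited (ResolutionOfIdentity H) where
  default :=
    { proj := fun l => if 0 ≤ l then 1 else 0
      isStarProjection := fun a => by
        by_cases h : 0 ≤ a
        · simp [h]
        · simp [h]
      proj_mul_proj := fun a b hab => by
        by_cases h : 0 ≤ a
        · simp [h, h.trans hab]
        · simp [h]
      right_continuous := fun f a => by
        by_cases h : 0 ≤ a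
        · refine (continuousWithinAt_const (b := f)).congr (fun y hy => ?_) ?_
          · simp [h.trans hy]
          · simp [h]
        · have h' : ∀ᶠ y in 𝓝[Ici a] a, y < 0 :=
            nhdsWithin_le_nhds (Iio_mem_nhds (not_le.mp h))
          refine (continuousWithinAt_const (b := (0 : H))).congr_of_eventuallyEq ?_ ?_
          · filter_upwards [h'] with y hy
            simp [not_le.mpr hy]
          · simp [h]
      tendsto_atBot := fun f => by
        refine tendsto_const_nhds.congr' ?_
        filter_upwards [eventually_lt_atBot (0 : ℝ)] with y hy
        simp [not_le.mpr hy]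
      tendsto_atTop := fun f => by
        refine tendsto_const_nhds.congr' ?_
        filter_upwards [eventually_ge_atTop (0 : ℝ)] with y hy
        simp [hy] }

end ResolutionOfIdentity

open Classical in
/-- The spectral resolution `E_A` of the identity for `A` (a junk value if there is none,
which does not happen for self-adjoint `A`). -/
def spectralResolution (A : H →ₗ.[ℝ] H) : ResolutionOfIdentity H :=
  if h : ∃ E : ResolutionOfIdentity H, E.IsResolutionOf A then h.choose else default

/-- `f ∈ Dom(φ(A))`. -/
def MemDomFun (A : H →ₗ.[ℝ] H) (φ : ℝ → ℝ) (f : H) : Prop :=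
  (spectralResolution A).MemDom φ f

open Classical in
/-- `φ(A) f = (∫ φ(l) dE_A(l)) f`, for `f ∈ Dom(φ(A))` (and `0` otherwise). -/
def opFun (A : H →ₗ.[ℝ] H) (φ : ℝ → ℝ) (f : H) : H :=
  if h : ∃ g : H, (spectralResolution A).HasValue φ f g then h.choose else 0

/-- `A` is non-negative: `⟪A f, f⟫ ≥ 0` on the domain of `A`. -/
def IsNonneg (A : H →ₗ.[ℝ] H) : Prop := ∀ f : A.domain, 0 ≤ ⟪A f, (f : H)⟫_ℝ

/-- `f ∈ H^s(A)`, i.e. `f ∈ Dom((I + A)^{s/2})`. -/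
def MemSobolev (A : H →ₗ.[ℝ] H) (s : ℝ) (f : H) : Prop :=
  MemDomFun A (fun l => (1 + l) ^ (s / 2)) f

/-- `‖f‖_{H^s(A)} = ‖(I + A)^{s/2} f‖`, for `f ∈ H^s(A)`. -/
def sobolevNorm (A : H →ₗ.[ℝ] H) (s : ℝ) (f : H) : ℝ :=
  ‖opFun A (fun l => (1 + l) ^ (s / 2)) f‖

/-- `e^{-tA} f`. -/
def heat (A : H →ₗ.[ℝ] H) (t : ℝ) (f : H) : H := opFun A (fun l => Real.exp (-(t * l))) f

/-- The symbol `𝒟(t, l)` of the damped wave propagator (only `l ≥ 0` matters). -/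
def symbolD (t l : ℝ) : ℝ :=
  if l < 1 / 4 then
    Real.exp (-t / 2) * Real.sinh (t * √(1 / 4 - l)) / √(1 / 4 - l)
  else if l = 1 / 4 then
    t * Real.exp (-t / 2)
  else
    Real.exp (-t / 2) * Real.sin (t * √(l - 1 / 4)) / √(l - 1 / 4)

/-- `𝒟(t, A) f`. -/
def propD (A : H →ₗ.[ℝ] H) (t : ℝ) (f : H) : H := opFun A (symbolD t) f

/-- `∂ₜ𝒟(t, A) f`, the operator with symbol `∂ₜ𝒟(t, l)`. -/
def propDtD (A : H →ₗ.[ℝ] H) (t : ℝ) (f : H) : H :=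
  opFun A (fun l => deriv (fun s => symbolD s l) t) f

/-- The linear solution `u_L(t) = 𝒟(t, A)(u₀ + u₁) + ∂ₜ𝒟(t, A) u₀`. -/
def linearSolution (A : H →ₗ.[ℝ] H) (u₀ u₁ : H) (t : ℝ) : H :=
  propD A t (u₀ + u₁) + propDtD A t u₀

/-- `u ∈ C([0,T]; H^1(A)) ∩ C^1([0,T]; H)`. -/
def InSolutionSpace (A : H →ₗ.[ℝ] H) (T : ℝ) (u : ℝ → H) : Prop :=
  (∀ t ∈ Icc 0 T, MemSobolev A 1 (u t)) ∧
  (∀ t ∈ Icc 0 T,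
    Tendsto (fun s => sobolevNorm A 1 (u s - u t)) (𝓝[Icc 0 T] t) (𝓝 0)) ∧
  ContDiffOn ℝ 1 u (Icc 0 T)

end Spectral

section Equation

variable {X : Type*} [MeasurableSpace X] {μ : Measure X}

/-- The heat semigroup satisfies `‖e^{-tA}‖_{L² → L^∞} ≲ t^{-α}` for `t > 0`. -/
def HeatDecay (A : Lp ℝ 2 μ →ₗ.[ℝ] Lp ℝ 2 μ) (α : ℝ) : Prop :=
  ∃ C : ℝ, 0 < C ∧ ∀ t : ℝ, 0 < t → ∀ f : Lp ℝ 2 μ,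
    eLpNorm (heat A t f : Lp ℝ 2 μ) ∞ μ ≤ ENNReal.ofReal (C * t ^ (-α)) * eLpNorm f 2 μ

/-- If `α > 1/2`, then `‖e^{-tA}‖_{L^q → L^q} ≲ 1` and `‖e^{-tA}‖_{L^q → L^∞} ≲ t^{-2α/q}` for
`t > 0` and every `4α/(4α-1) < q < 4α`; the bounds are those of `e^{-tA}` on `L² ∩ L^q`. -/
def HeatLqBounds (A : Lp ℝ 2 μ →ₗ.[ℝ] Lp ℝ 2 μ) (α : ℝ) : Prop :=
  1 / 2 < α → ∀ q : ℝ, 4 * α / (4 * α - 1) < q → q < 4 * α →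
    ∃ C : ℝ, 0 < C ∧ ∀ t : ℝ, 0 < t → ∀ f : Lp ℝ 2 μ, MemLp f (ENNReal.ofReal q) μ →
      eLpNorm (heat A t f : Lp ℝ 2 μ) (ENNReal.ofReal q) μ
          ≤ ENNReal.ofReal C * eLpNorm f (ENNReal.ofReal q) μ ∧
      eLpNorm (heat A t f : Lp ℝ 2 μ) ∞ μ
          ≤ ENNReal.ofReal (C * t ^ (-(2 * α / q))) * eLpNorm f (ENNReal.ofReal q) μ

/-- The nonlinearity: `F(0) = 0`, `F ∈ C¹(ℝ)` and
`|F(z₁) - F(z₂)| ≤ C (|z₁| + |z₂|)^{p-1} |z₁ - z₂|`. -/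
def IsNonlinearity (F : ℝ → ℝ) (p : ℝ) : Prop :=
  F 0 = 0 ∧ ContDiff ℝ 1 F ∧
  ∃ C : ℝ, ∀ z₁ z₂ : ℝ, |F z₁ - F z₂| ≤ C * (|z₁| + |z₂|) ^ (p - 1) * |z₁ - z₂|

open Classical in
/-- `F(f) = F ∘ f` as an element of `L²` (and `0` if it is not in `L²`). -/
def superposition (F : ℝ → ℝ) (f : Lp ℝ 2 μ) : Lp ℝ 2 μ :=
  if h : MemLp (fun x => F (f x)) 2 μ then h.toLp _ else 0

/-- `u` is a mild solution on `[0,T]` with data `(u₀, u₁)`: it lies in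
`C([0,T]; H^1(A)) ∩ C^1([0,T]; L²)`, the Duhamel integral makes sense in `L²`, and
`u(t) = u_L(t) + ∫₀ᵗ 𝒟(t-τ, A) F(u(τ)) dτ`. -/
def IsMildSolution (A : Lp ℝ 2 μ →ₗ.[ℝ] Lp ℝ 2 μ) (F : ℝ → ℝ) (u₀ u₁ : Lp ℝ 2 μ) (T : ℝ)
    (u : ℝ → Lp ℝ 2 μ) : Prop :=
  InSolutionSpace A T u ∧
  (∀ τ ∈ Icc 0 T, MemLp (fun x => F (u τ x)) 2 μ) ∧
  ∀ t ∈ Icc 0 T,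
    IntervalIntegrable (fun τ => propD A (t - τ) (superposition F (u τ))) volume 0 t ∧
    u t = linearSolution A u₀ u₁ t + ∫ τ in (0)..t, propD A (t - τ) (superposition F (u τ))

/-- There is a unique mild solution on `[0,T]`. -/
def ExistsUniqueMildSolution (A : Lp ℝ 2 μ →ₗ.[ℝ] Lp ℝ 2 μ) (F : ℝ → ℝ) (u₀ u₁ : Lp ℝ 2 μ)
    (T : ℝ) : Prop :=
  ∃ u : ℝ → Lp ℝ 2 μ, IsMildSolution A F u₀ u₁ T u ∧
    ∀ v : ℝ → Lp ℝ 2 μ, IsMildSolution A F u₀ u₁ T v → EqOn v u (Icc 0 T)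

/-- The maximal existence time `T_max(u₀, u₁) ∈ [0, ∞]`. -/
def maximalTime (A : Lp ℝ 2 μ →ₗ.[ℝ] Lp ℝ 2 μ) (F : ℝ → ℝ) (u₀ u₁ : Lp ℝ 2 μ) : ℝ≥0∞ :=
  sSup {S | ∃ T : ℝ, 0 < T ∧ ExistsUniqueMildSolution A F u₀ u₁ T ∧ S = ENNReal.ofReal T}

/-- `u` is the solution on `[0, T_max)`. -/
def IsMaximalSolution (A : Lp ℝ 2 μ →ₗ.[ℝ] Lp ℝ 2 μ) (F : ℝ → ℝ) (u₀ u₁ : Lp ℝ 2 μ)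
    (u : ℝ → Lp ℝ 2 μ) : Prop :=
  ∀ T : ℝ, 0 < T → ENNReal.ofReal T < maximalTime A F u₀ u₁ → IsMildSolution A F u₀ u₁ T u

end Equation

end DampedWave

end

/-!
Polarising a resolution of the identity gives a calculus of bounded symbols, and `(I + A)^{-1/2}`
is the superposition `Γ(1/2)⁻¹ ∫ e^{-t} t^{-1/2} e^{-tA} dt` of heat operators. Inserting the heat
bounds yields the Sobolev embedding `H¹(A) ⊂ L^{2p}`. At the critical exponent
`p = 2α / (2α - 1)` the integral diverges logarithmically; there one cuts the time integral at a
point depending on the height `σ` of the level set `{|u| > σ}`, so that the late part is at most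
`σ / 2`, and sums over `σ` as in Marcinkiewicz interpolation.

Consequently `F` is Lipschitz from bounded sets of `H¹(A)` to `L²`. In the variables
`((I + A)^{1/2} u, ∂ₜu)` the linear equation generates a strongly continuous group on `L² × L²`,
whose symbol is the fundamental matrix of the damped oscillator `y'' + y' + l y = 0`. In the frame
moving with this group the mild equation becomes an ordinary differential equation with a locally
Lipschitz vector field, solved by Picard–Lindelöf on a time interval that depends only on the size
of the data. A solution bounded along a sequence of times approaching `T_max < ∞` could therefore
be continued beyond `T_max`, which gives the blow-up alternative.
-/

noncomputable section

namespace DampedWave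

/-! ### Bounds in `L^r` for functions in `L^p` -/

section Lp

variable {X E : Type*} [MeasurableSpace X] {μ : Measure X} [NormedAddCommGroup E]

section Coe

variable {p : ℝ≥0∞}

theorem eLpNorm_coeFn_add_le {r : ℝ≥0∞} (hr : 1 ≤ r) (f g : Lp E p μ) :
    eLpNorm (f + g : Lp E p μ) r μ ≤ eLpNorm f r μ + eLpNorm g r μ := by
  rw [eLpNorm_congr_ae (Lp.coeFn_add f g)]
  exact eLpNorm_add_le (Lp.aestronglyMeasurable _) (Lp.aestronglyMeasurable _) hr

theorem eLpNorm_coeFn_zero (r : ℝ≥0∞) : eLpNorm (0 : Lp E p μ) r μ = 0 := by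
  rw [eLpNorm_congr_ae (Lp.coeFn_zero E p μ), eLpNorm_zero]

theorem exists_eq_add_indicator (f : Lp E p μ) {S : Set X} (hS : MeasurableSet S) :
    ∃ f₁ f₂ : Lp E p μ, f = f₁ + f₂ ∧ f₁ =ᵐ[μ] S.indicator f ∧ f₂ =ᵐ[μ] Sᶜ.indicator f := by
  have hS_mem : MemLp (S.indicator f) p μ := (Lp.memLp f).indicator hS
  have hSc_mem : MemLp (Sᶜ.indicator f) p μ := (Lp.memLp f).indicator hS.compl
  refine ⟨hS_mem.toLp _, hSc_mem.toLp _, Lp.ext ?_, hS_mem.coeFn_toLp, hSc_mem.coeFn_toLp⟩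
  filter_upwards [Lp.coeFn_add (hS_mem.toLp _) (hSc_mem.toLp _), hS_mem.coeFn_toLp,
    hSc_mem.coeFn_toLp] with x hadd hS_eq hSc_eq
  rw [hadd, Pi.add_apply, hS_eq, hSc_eq, indicator_self_add_compl_apply]

theorem isClosed_setOf_eLpNorm_le [Fact (1 ≤ p)] (r M : ℝ≥0∞) :
    IsClosed {g : Lp E p μ | eLpNorm g r μ ≤ M} := by
  refine IsSeqClosed.isClosed fun u g hu hg => ?_
  exact eLpNorm_le_of_tendstoInMeasure (Eventually.of_forall hu) (tendstoInMeasure_of_tendsto_Lp hg)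
    fun n => Lp.aestronglyMeasurable _

variable [NormedSpace ℝ E]

theorem eLpNorm_coeFn_smul (r : ℝ≥0∞) (c : ℝ) (f : Lp E p μ) :
    eLpNorm (c • f : Lp E p μ) r μ = ‖c‖ₑ * eLpNorm f r μ := by
  rw [eLpNorm_congr_ae (Lp.coeFn_smul c f), eLpNorm_const_smul]

theorem convex_setOf_eLpNorm_le {r : ℝ≥0∞} (hr : 1 ≤ r) (M : ℝ≥0∞) :
    Convex ℝ {g : Lp E p μ | eLpNorm g r μ ≤ M} := by
  intro f hf g hg a b ha hb hab
  simp only [mem_ofPred_eq] at hf hg ⊢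
  calc eLpNorm (a • f + b • g : Lp E p μ) r μ
      ≤ eLpNorm (a • f : Lp E p μ) r μ + eLpNorm (b • g : Lp E p μ) r μ :=
        eLpNorm_coeFn_add_le hr _ _
    _ ≤ ‖a‖ₑ * M + ‖b‖ₑ * M := by
        rw [eLpNorm_coeFn_smul, eLpNorm_coeFn_smul]
        gcongr
    _ = M := by
        rw [← add_mul, Real.enorm_of_nonneg ha, Real.enorm_of_nonneg hb, ← ENNReal.ofReal_add ha hb,
          hab, ENNReal.ofReal_one, one_mul]

theorem eLpNorm_le_mul_enorm_of_norm_le_one {V : Type*} [NormedAddCommGroup V] [NormedSpace ℝ V]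
    {r M : ℝ≥0∞} (L : V →ₗ[ℝ] Lp E p μ) (hL : ∀ v, ‖v‖ ≤ 1 → eLpNorm (L v) r μ ≤ M) (v : V) :
    eLpNorm (L v) r μ ≤ M * ‖v‖ₑ := by
  rcases eq_or_ne v 0 with rfl | hv
  · rw [map_zero, eLpNorm_coeFn_zero]
    exact zero_le
  have hv_pos : 0 < ‖v‖ := norm_pos_iff.2 hv
  have hunit : ‖‖v‖⁻¹ • v‖ ≤ 1 := by
    rw [norm_smul, norm_inv, norm_norm, inv_mul_cancel₀ hv_pos.ne']
  calc eLpNorm (L v) r μ = eLpNorm (‖v‖ • L (‖v‖⁻¹ • v) : Lp E p μ) r μ := by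
        rw [← map_smul, smul_smul, mul_inv_cancel₀ hv_pos.ne', one_smul]
    _ = eLpNorm (L (‖v‖⁻¹ • v)) r μ * ‖v‖ₑ := by rw [eLpNorm_coeFn_smul, enorm_norm, mul_comm]
    _ ≤ M * ‖v‖ₑ := by gcongr; exact hL _ hunit

variable {S : Type*} [MeasurableSpace S] {ν : Measure S} [Fact (1 ≤ p)] [CompleteSpace E]
  {G : S → Lp E p μ} {r M : ℝ≥0∞}

theorem eLpNorm_integral_le_measure_mul [IsFiniteMeasure ν] (hr : 1 ≤ r) (hG : Integrable G ν)
    (hGM : ∀ᵐ t ∂ν, eLpNorm (G t) r μ ≤ M) :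
    eLpNorm (∫ t, G t ∂ν : Lp E p μ) r μ ≤ ν univ * M := by
  rcases eq_zero_or_neZero ν with rfl | _
  · rw [integral_zero_measure, eLpNorm_coeFn_zero]
    exact zero_le
  have havg : ⨍ t, G t ∂ν ∈ {g : Lp E p μ | eLpNorm g r μ ≤ M} :=
    Convex.average_mem (E := Lp E p μ) (convex_setOf_eLpNorm_le hr M)
      (isClosed_setOf_eLpNorm_le r M) hGM hG
  rw [← measure_smul_average, eLpNorm_coeFn_smul, Real.enorm_of_nonneg measureReal_nonneg,
    ofReal_measureReal]
  gcongr
  exact havg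

/-- Minkowski's integral inequality, from the convexity and closedness of the balls of `L^r`. -/
theorem eLpNorm_integral_le {b : S → ℝ} (hr : 1 ≤ r) (hG : Integrable G ν) (hb : Integrable b ν)
    (hb_pos : ∀ᵐ t ∂ν, 0 < b t) (hGb : ∀ᵐ t ∂ν, eLpNorm (G t) r μ ≤ ENNReal.ofReal (b t) * M) :
    eLpNorm (∫ t, G t ∂ν : Lp E p μ) r μ ≤ ENNReal.ofReal (∫ t, b t ∂ν) * M := by
  set m := ν.withDensity fun t => ENNReal.ofReal (b t) with hm
  have : IsFiniteMeasure m := isFiniteMeasure_withDensity_ofReal hb.2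
  have hb_meas := hb.aestronglyMeasurable.aemeasurable.ennreal_ofReal
  have hb_fin : ∀ᵐ t ∂ν, ENNReal.ofReal (b t) < ∞ := ae_of_all _ fun _ => ENNReal.ofReal_lt_top
  have hsmul : ∀ᵐ t ∂ν, (ENNReal.ofReal (b t)).toReal • (b t)⁻¹ • G t = G t := by
    filter_upwards [hb_pos] with t ht
    rw [ENNReal.toReal_ofReal ht.le, smul_inv_smul₀ ht.ne']
  have hm_univ : m univ = ENNReal.ofReal (∫ t, b t ∂ν) := by
    rw [hm, withDensity_apply _ MeasurableSet.univ, Measure.restrict_univ,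
      ofReal_integral_eq_lintegral_ofReal hb (hb_pos.mono fun _ => le_of_lt)]
  have hint : ∫ t, (b t)⁻¹ • G t ∂m = ∫ t, G t ∂ν := by
    rw [hm, integral_withDensity_eq_integral_toReal_smul₀ hb_meas hb_fin]
    exact integral_congr_ae hsmul
  have hintble : Integrable (fun t => (b t)⁻¹ • G t) m := by
    rw [hm, integrable_withDensity_iff_integrable_smul₀' hb_meas hb_fin]
    exact hG.congr (hsmul.mono fun _ h => h.symm)
  rw [← hint, ← hm_univ]
  refine eLpNorm_integral_le_measure_mul hr hintble
    ((withDensity_absolutelyContinuous _ _).ae_le ?_)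
  filter_upwards [hb_pos, hGb] with t ht hGt
  rw [eLpNorm_coeFn_smul, Real.enorm_of_nonneg (inv_nonneg.2 ht.le),
    ENNReal.ofReal_inv_of_pos ht]
  exact (ENNReal.inv_mul_le_iff (by simpa using ht) ENNReal.ofReal_ne_top).2 hGt

end Coe

theorem eLpNorm_ofReal_rpow_eq_lintegral (g : X → E) {r : ℝ} (hr : 0 < r) :
    eLpNorm g (ENNReal.ofReal r) μ ^ r = ∫⁻ x, ENNReal.ofReal (‖g x‖ ^ r) ∂μ := by
  rw [eLpNorm_eq_lintegral_rpow_enorm_toReal (by simpa using hr) ENNReal.ofReal_ne_top,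
    ENNReal.toReal_ofReal hr.le, ← ENNReal.rpow_mul, one_div, inv_mul_cancel₀ hr.ne',
    ENNReal.rpow_one]
  exact lintegral_congr fun x => by
    rw [← ENNReal.ofReal_rpow_of_nonneg (norm_nonneg _) hr.le, ofReal_norm]

theorem eLpNorm_le_eLpNorm_top_rpow_mul {g : X → E} (hg : AEStronglyMeasurable g μ) {p q : ℝ}
    (hp : 0 < p) (hpq : p ≤ q) :
    eLpNorm g (ENNReal.ofReal q) μ ≤
      eLpNorm g ∞ μ ^ (1 - p / q) * eLpNorm g (ENNReal.ofReal p) μ ^ (p / q) := by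
  have hq : 0 < q := hp.trans_le hpq
  rw [eLpNorm_eq_lintegral_rpow_enorm_toReal (by simpa using hq) ENNReal.ofReal_ne_top,
    eLpNorm_eq_lintegral_rpow_enorm_toReal (by simpa using hp) ENNReal.ofReal_ne_top,
    ENNReal.toReal_ofReal hq.le, ENNReal.toReal_ofReal hp.le]
  have hle : ∫⁻ x, ‖g x‖ₑ ^ q ∂μ ≤ eLpNorm g ∞ μ ^ (q - p) * ∫⁻ x, ‖g x‖ₑ ^ p ∂μ := by
    rw [← lintegral_const_mul'' _ (hg.enorm.pow_const _)]
    refine lintegral_mono_ae ?_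
    filter_upwards [enorm_ae_le_eLpNormEssSup g μ] with x hx
    calc ‖g x‖ₑ ^ q = ‖g x‖ₑ ^ (q - p) * ‖g x‖ₑ ^ p := by
          rw [← ENNReal.rpow_add_of_nonneg _ _ (by linarith) hp.le, sub_add_cancel]
      _ ≤ eLpNorm g ∞ μ ^ (q - p) * ‖g x‖ₑ ^ p := by
          rw [eLpNorm_exponent_top]
          gcongr
  calc (∫⁻ x, ‖g x‖ₑ ^ q ∂μ) ^ (1 / q)
      ≤ (eLpNorm g ∞ μ ^ (q - p) * ∫⁻ x, ‖g x‖ₑ ^ p ∂μ) ^ (1 / q) := by gcongr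
    _ = _ := by
        rw [ENNReal.mul_rpow_of_nonneg _ _ (by positivity), ← ENNReal.rpow_mul, ← ENNReal.rpow_mul]
        congr 2 <;> field_simp

theorem lintegral_norm_rpow_le_add {g : X → E} (hg : AEStronglyMeasurable g μ) {p q r : ℝ}
    (hp : 0 < p) (hpq : p ≤ q) (hqr : q ≤ r) :
    ∫⁻ x, ENNReal.ofReal (‖g x‖ ^ q) ∂μ ≤
      ∫⁻ x, ENNReal.ofReal (‖g x‖ ^ p) ∂μ + ∫⁻ x, ENNReal.ofReal (‖g x‖ ^ r) ∂μ := by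
  rw [← lintegral_add_left' (hg.norm.aemeasurable.pow_const p).ennreal_ofReal]
  refine lintegral_mono fun x => ?_
  rcases le_total ‖g x‖ 1 with hx | hx
  · exact le_add_right (ENNReal.ofReal_le_ofReal
      (Real.rpow_le_rpow_of_exponent_ge_of_imp (norm_nonneg _) hx hpq
        fun _ h => absurd h (hp.trans_le hpq).ne'))
  · exact le_add_left (ENNReal.ofReal_le_ofReal (Real.rpow_le_rpow_of_exponent_le hx hqr))

end Lp

/-! ### Marcinkiewicz interpolation -/

section Marcinkiewicz

variable {X Y : Type*} [MeasurableSpace X] [MeasurableSpace Y] {μ : Measure X} {ν : Measure Y}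

theorem measure_le_norm_le_of_eLpNorm_le {E E' : Type*} [NormedAddCommGroup E]
    [NormedAddCommGroup E'] {f : X → E} {g : Y → E'} (hg : AEStronglyMeasurable g ν) {r b ε : ℝ}
    (hr : 0 < r) (hε : 0 < ε) (hb : 0 ≤ b)
    (hgf : eLpNorm g (ENNReal.ofReal r) ν ≤ ENNReal.ofReal b * eLpNorm f (ENNReal.ofReal r) μ) :
    ν {y | ε ≤ ‖g y‖} ≤
      ENNReal.ofReal ((b / ε) ^ r) * ∫⁻ x, ENNReal.ofReal (‖f x‖ ^ r) ∂μ := by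
  have hset : {y | ε ≤ ‖g y‖} = {y | ENNReal.ofReal ε ≤ ‖g y‖ₑ} := by
    ext y
    rw [mem_ofPred_eq, mem_ofPred_eq, ← ofReal_norm, ENNReal.ofReal_le_ofReal_iff (norm_nonneg _)]
  have hcheb := meas_ge_le_mul_pow_eLpNorm_enorm ν (p := ENNReal.ofReal r) (by simpa using hr)
    ENNReal.ofReal_ne_top hg (ε := ENNReal.ofReal ε) (by simpa using hε)
    fun h => absurd h ENNReal.ofReal_ne_top
  rw [ENNReal.toReal_ofReal hr.le] at hcheb
  calc ν {y | ε ≤ ‖g y‖}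
      ≤ (ENNReal.ofReal ε)⁻¹ ^ r * eLpNorm g (ENNReal.ofReal r) ν ^ r := hset ▸ hcheb
    _ ≤ (ENNReal.ofReal ε)⁻¹ ^ r *
          (ENNReal.ofReal b * eLpNorm f (ENNReal.ofReal r) μ) ^ r := by gcongr
    _ = _ := by
        rw [ENNReal.mul_rpow_of_nonneg _ _ hr.le, eLpNorm_ofReal_rpow_eq_lintegral _ hr,
          ← mul_assoc, ← ENNReal.mul_rpow_of_nonneg _ _ hr.le, ← ENNReal.ofReal_inv_of_pos hε,
          ← ENNReal.ofReal_mul (by positivity),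
          ENNReal.ofReal_rpow_of_nonneg (by positivity) hr.le, mul_comm ε⁻¹ b, div_eq_mul_inv]

theorem measurable_setLIntegral_prodMk [SFinite ν] {S : Set (X × Y)} (hS : MeasurableSet S)
    (h : Y → ℝ≥0∞) : Measurable fun x => ∫⁻ y in Prod.mk x ⁻¹' S, h y ∂ν := by
  simpa only [withDensity_apply _ (measurable_prodMk_left hS)] using
    measurable_measure_prodMk_left (ν := ν.withDensity h) hS

theorem lintegral_mul_setLIntegral_prodMk [SFinite μ] [SFinite ν] {S : Set (X × Y)}
    (hS : MeasurableSet S) {w : X → ℝ≥0∞} {h : Y → ℝ≥0∞} (hw : Measurable w) (hh : Measurable h) :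
    ∫⁻ x, w x * ∫⁻ y in Prod.mk x ⁻¹' S, h y ∂ν ∂μ =
      ∫⁻ y, h y * ∫⁻ x in (fun x => (x, y)) ⁻¹' S, w x ∂μ ∂ν := by
  have hleft := Measure.prod_apply (μ := μ.withDensity w) (ν := ν.withDensity h) hS
  have hright := Measure.prod_apply_symm (μ := μ.withDensity w) (ν := ν.withDensity h) hS
  rw [lintegral_withDensity_eq_lintegral_mul _ hw (measurable_measure_prodMk_left hS)] at hleft
  rw [lintegral_withDensity_eq_lintegral_mul _ hh (measurable_measure_prodMk_right hS)] at hright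
  simpa only [Pi.mul_apply, withDensity_apply _ (measurable_prodMk_left hS),
    withDensity_apply _ (measurable_prodMk_right hS)] using hleft.symm.trans hright

theorem lintegral_Ioo_zero_rpow {a b : ℝ} (ha : 0 < a) (hb : 0 ≤ b) :
    ∫⁻ s in Ioo 0 b, ENNReal.ofReal (s ^ (a - 1)) = ENNReal.ofReal (b ^ a / a) := by
  have hint : IntegrableOn (fun s : ℝ => s ^ (a - 1)) (Ioc 0 b) :=
    (intervalIntegrable_iff_integrableOn_Ioc_of_le hb).1
      (intervalIntegral.intervalIntegrable_rpow' (by linarith))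
  rw [setLIntegral_congr Ioo_ae_eq_Ioc, ← ofReal_integral_eq_lintegral_ofReal hint
    ((ae_restrict_iff' measurableSet_Ioc).2 (ae_of_all _ fun s hs => Real.rpow_nonneg hs.1.le _)),
    ← intervalIntegral.integral_of_le hb, integral_rpow (Or.inl (by linarith)), sub_add_cancel,
    Real.zero_rpow ha.ne', sub_zero]

theorem lintegral_Ici_rpow {a b : ℝ} (ha : 0 < a) (hb : 0 < b) :
    ∫⁻ s in Ici b, ENNReal.ofReal (s ^ (-a - 1)) = ENNReal.ofReal (b ^ (-a) / a) := by
  have hint : IntegrableOn (fun s : ℝ => s ^ (-a - 1)) (Ioi b) :=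
    integrableOn_Ioi_rpow_of_lt (by linarith) hb
  rw [← setLIntegral_congr Ioi_ae_eq_Ici, ← ofReal_integral_eq_lintegral_ofReal hint
    ((ae_restrict_iff' measurableSet_Ioi).2
      (ae_of_all _ fun s hs => Real.rpow_nonneg (hb.trans hs).le _)),
    integral_Ioi_rpow_of_lt (by linarith) hb, sub_add_cancel, neg_div_neg_eq]

variable {f : X → ℝ}

theorem lintegral_rpow_mul_setLIntegral_lt [SFinite μ] (hf : Measurable f) (hf0 : ∀ x, 0 ≤ f x)
    {r m : ℝ} (hm : 0 < m) (hrm : r < m) :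
    ∫⁻ s in Ioi 0, ENNReal.ofReal (s ^ (m - r - 1)) *
        ∫⁻ x in {x | s < f x}, ENNReal.ofReal (f x ^ r) ∂μ =
      ENNReal.ofReal (m - r)⁻¹ * ∫⁻ x, ENNReal.ofReal (f x ^ m) ∂μ := by
  have hS : MeasurableSet {z : ℝ × X | z.1 < f z.2} :=
    measurableSet_lt measurable_fst (hf.comp measurable_snd)
  refine (lintegral_mul_setLIntegral_prodMk hS (by fun_prop)
    (hf.pow_const r).ennreal_ofReal).trans ?_
  rw [← lintegral_const_mul' _ _ ENNReal.ofReal_ne_top]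
  refine lintegral_congr fun x => ?_
  have hsec : (fun s => (s, x)) ⁻¹' {z : ℝ × X | z.1 < f z.2} ∩ Ioi 0 = Ioo 0 (f x) := by
    ext s
    exact and_comm
  have hr : 0 < m - r := sub_pos.2 hrm
  have hpow : f x ^ m = f x ^ r * f x ^ (m - r) := by
    rw [← Real.rpow_add' (hf0 x) (by linarith), add_sub_cancel]
  rw [Measure.restrict_restrict (measurable_prodMk_right hS), hsec,
    lintegral_Ioo_zero_rpow hr (hf0 x), ← ENNReal.ofReal_mul (Real.rpow_nonneg (hf0 x) _),
    ← ENNReal.ofReal_mul (by positivity), hpow]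
  congr 1
  ring

theorem lintegral_rpow_mul_setLIntegral_ge [SFinite μ] (hf : Measurable f) (hf0 : ∀ x, 0 ≤ f x)
    {q m : ℝ} (hm : 0 < m) (hmq : m < q) :
    ∫⁻ s in Ioi 0, ENNReal.ofReal (s ^ (m - q - 1)) *
        ∫⁻ x in {x | f x ≤ s}, ENNReal.ofReal (f x ^ q) ∂μ =
      ENNReal.ofReal (q - m)⁻¹ * ∫⁻ x, ENNReal.ofReal (f x ^ m) ∂μ := by
  have hS : MeasurableSet {z : ℝ × X | f z.2 ≤ z.1} :=
    measurableSet_le (hf.comp measurable_snd) measurable_fst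
  refine (lintegral_mul_setLIntegral_prodMk hS (by fun_prop)
    (hf.pow_const q).ennreal_ofReal).trans ?_
  rw [← lintegral_const_mul' _ _ ENNReal.ofReal_ne_top]
  refine lintegral_congr fun x => ?_
  rcases (hf0 x).eq_or_lt with hx | hx
  · simp [← hx, Real.zero_rpow hm.ne', Real.zero_rpow (hm.trans hmq).ne']
  have hsec : (fun s => (s, x)) ⁻¹' {z : ℝ × X | f z.2 ≤ z.1} ∩ Ioi 0 = Ici (f x) := by
    ext s
    exact ⟨And.left, fun hs => ⟨hs, hx.trans_le hs⟩⟩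
  have hq : 0 < q - m := sub_pos.2 hmq
  have hpow : f x ^ m = f x ^ q * f x ^ (-(q - m)) := by
    rw [← Real.rpow_add hx]
    congr 1
    ring
  rw [Measure.restrict_restrict (measurable_prodMk_right hS), hsec,
    show m - q - 1 = -(q - m) - 1 by ring, lintegral_Ici_rpow hq hx,
    ← ENNReal.ofReal_mul (Real.rpow_nonneg (hf0 x) _), ← ENNReal.ofReal_mul (by positivity), hpow]
  congr 1
  ring

theorem ofReal_rpow_sub_sub_one {s : ℝ} (hs : 0 < s) (m e : ℝ) :
    ENNReal.ofReal (s ^ (m - e - 1)) =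
      ENNReal.ofReal (s ^ (-e)) * ENNReal.ofReal (s ^ (m - 1)) := by
  rw [← ENNReal.ofReal_mul (by positivity), ← Real.rpow_add hs]
  ring_nf

theorem lintegral_rpow_le_of_measure_lt_le_of_sFinite [SFinite μ] (hf : Measurable f)
    (hf0 : ∀ x, 0 ≤ f x) {g : Y → ℝ} (hg : AEMeasurable g ν) (hg0 : ∀ y, 0 ≤ g y)
    {r m q : ℝ} {K L : ℝ≥0∞}
    (hm : 0 < m) (hrm : r < m) (hmq : m < q)
    (hlevel : ∀ s, 0 < s → ν {y | s < g y} ≤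
      K * (ENNReal.ofReal (s ^ (-r)) * ∫⁻ x in {x | s < f x}, ENNReal.ofReal (f x ^ r) ∂μ) +
      L * (ENNReal.ofReal (s ^ (-q)) * ∫⁻ x in {x | f x ≤ s}, ENNReal.ofReal (f x ^ q) ∂μ)) :
    ∫⁻ y, ENNReal.ofReal (g y ^ m) ∂ν ≤
      ENNReal.ofReal m * (K * ENNReal.ofReal (m - r)⁻¹ + L * ENNReal.ofReal (q - m)⁻¹) *
        ∫⁻ x, ENNReal.ofReal (f x ^ m) ∂μ := by
  have hlt : MeasurableSet {z : ℝ × X | z.1 < f z.2} :=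
    measurableSet_lt measurable_fst (hf.comp measurable_snd)
  have hge : MeasurableSet {z : ℝ × X | f z.2 ≤ z.1} :=
    measurableSet_le (hf.comp measurable_snd) measurable_fst
  have hmeas_lt : Measurable fun s => ENNReal.ofReal (s ^ (m - r - 1)) *
      ∫⁻ x in {x | s < f x}, ENNReal.ofReal (f x ^ r) ∂μ :=
    .mul (by fun_prop) (measurable_setLIntegral_prodMk hlt _)
  have hmeas_ge : Measurable fun s => ENNReal.ofReal (s ^ (m - q - 1)) *
      ∫⁻ x in {x | f x ≤ s}, ENNReal.ofReal (f x ^ q) ∂μ :=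
    .mul (by fun_prop) (measurable_setLIntegral_prodMk hge _)
  rw [lintegral_rpow_eq_lintegral_meas_lt_mul ν (ae_of_all _ hg0) hg hm, mul_assoc]
  gcongr
  calc ∫⁻ s in Ioi 0, ν {y | s < g y} * ENNReal.ofReal (s ^ (m - 1))
      ≤ ∫⁻ s in Ioi 0, (K * (ENNReal.ofReal (s ^ (m - r - 1)) *
            ∫⁻ x in {x | s < f x}, ENNReal.ofReal (f x ^ r) ∂μ) +
          L * (ENNReal.ofReal (s ^ (m - q - 1)) *
            ∫⁻ x in {x | f x ≤ s}, ENNReal.ofReal (f x ^ q) ∂μ)) := by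
        refine setLIntegral_mono' measurableSet_Ioi fun s hs => ?_
        refine (mul_le_mul_left (hlevel s hs) _).trans_eq ?_
        rw [ofReal_rpow_sub_sub_one hs, ofReal_rpow_sub_sub_one hs]
        ring
    _ = _ := by
        rw [lintegral_add_left (hmeas_lt.const_mul K), lintegral_const_mul K hmeas_lt,
          lintegral_const_mul L hmeas_ge, lintegral_rpow_mul_setLIntegral_lt hf hf0 hm hrm,
          lintegral_rpow_mul_setLIntegral_ge hf hf0 hm hmq]
        ring

/-- Marcinkiewicz interpolation. The hypothesis is what truncating `f` at height `s` gives for an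
operator `f ↦ g` of weak types `(r, r)` and `(q, q)`. -/
theorem lintegral_rpow_le_of_measure_lt_le (hf : FinStronglyMeasurable f μ) (hf0 : ∀ x, 0 ≤ f x)
    {g : Y → ℝ} (hg : AEMeasurable g ν) (hg0 : ∀ y, 0 ≤ g y) {r m q : ℝ} {K L : ℝ≥0∞}
    (hr : 0 < r) (hrm : r < m) (hmq : m < q)
    (hlevel : ∀ s, 0 < s → ν {y | s < g y} ≤
      K * (ENNReal.ofReal (s ^ (-r)) * ∫⁻ x in {x | s < f x}, ENNReal.ofReal (f x ^ r) ∂μ) +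
      L * (ENNReal.ofReal (s ^ (-q)) * ∫⁻ x in {x | f x ≤ s}, ENNReal.ofReal (f x ^ q) ∂μ)) :
    ∫⁻ y, ENNReal.ofReal (g y ^ m) ∂ν ≤
      ENNReal.ofReal m * (K * ENNReal.ofReal (m - r)⁻¹ + L * ENNReal.ofReal (q - m)⁻¹) *
        ∫⁻ x, ENNReal.ofReal (f x ^ m) ∂μ := by
  have hfm : Measurable f := hf.stronglyMeasurable.measurable
  obtain ⟨t, ht, hft, hσ⟩ := hf.exists_set_sigmaFinite
  have hrestrict : ∀ {e : ℝ}, 0 < e → ∀ {S : Set X}, MeasurableSet S →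
      ∫⁻ x in S, ENNReal.ofReal (f x ^ e) ∂μ =
        ∫⁻ x in S, ENNReal.ofReal (f x ^ e) ∂(μ.restrict t) := by
    intro e he S hS
    rw [Measure.restrict_restrict hS, inter_comm, ← Measure.restrict_restrict ht]
    refine (setLIntegral_eq_of_support_subset fun x hx => ?_).symm
    by_contra hxt
    have hfx : ENNReal.ofReal (f x ^ e) = 0 := by
      rw [hft x hxt, Real.zero_rpow he.ne', ENNReal.ofReal_zero]
    exact hx hfx
  refine (lintegral_rpow_le_of_measure_lt_le_of_sFinite (μ := μ.restrict t) hfm hf0 hg hg0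
    (hr.trans hrm) hrm hmq fun s hs => ?_).trans
    (mul_le_mul_right (lintegral_mono' Measure.restrict_le_self le_rfl) _)
  rw [← hrestrict hr (measurableSet_lt measurable_const hfm),
    ← hrestrict (hr.trans (hrm.trans hmq)) (measurableSet_le hfm measurable_const)]
  exact hlevel s hs

end Marcinkiewicz

/-! ### Semilinear equations driven by a strongly continuous group -/

/-- `Φ` is Lipschitz on every bounded set, with a constant depending on the set. -/
def LipschitzOnBalls {G G' : Type*} [NormedAddCommGroup G] [NormedAddCommGroup G']
    (Φ : G → G') : Prop :=
  ∀ R : ℝ, ∃ K : NNReal, LipschitzOnWith K Φ (Metric.closedBall 0 R)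

theorem LipschitzOnBalls.continuous {G G' : Type*} [NormedAddCommGroup G] [NormedAddCommGroup G']
    {Φ : G → G'} (hΦ : LipschitzOnBalls Φ) : Continuous Φ := by
  refine continuous_iff_continuousAt.2 fun x => ?_
  obtain ⟨K, hK⟩ := hΦ (‖x‖ + 1)
  refine hK.continuousOn.continuousAt (mem_of_superset (Metric.ball_mem_nhds x one_pos) ?_)
  intro y hy
  rw [mem_ball_iff_norm] at hy
  rw [mem_closedBall_zero_iff]
  linarith [norm_sub_norm_le y x]

/-- A strongly continuous one-parameter group of bounded operators. -/
structure StronglyContinuousGroup (G : Type*) [NormedAddCommGroup G] [NormedSpace ℝ G] where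
  op : ℝ → G →L[ℝ] G
  op_zero : ∀ x, op 0 x = x
  op_add : ∀ t s x, op (t + s) x = op t (op s x)
  continuous_op : ∀ x, Continuous fun t => op t x

namespace StronglyContinuousGroup

variable {G : Type*} [NormedAddCommGroup G] [NormedSpace ℝ G]
  (S : StronglyContinuousGroup G) {Φ : G → G}

theorem op_neg_op (t : ℝ) (x : G) : S.op (-t) (S.op t x) = x := by
  rw [← S.op_add, neg_add_cancel, S.op_zero]

theorem op_op_neg (t : ℝ) (x : G) : S.op t (S.op (-t) x) = x := by
  rw [← S.op_add, add_neg_cancel, S.op_zero]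

/-- The vector field of the semilinear equation `U' = 𝒜 U + Φ(U)` in the moving frame `U = S(t) W`
of the group `S(t) = e^{t𝒜}`, where the unbounded generator `𝒜` disappears. -/
def field (Φ : G → G) (t : ℝ) (x : G) : G := S.op (-t) (Φ (S.op t x))

/-- `W` solves `W' = S(-t) Φ(S(t) W)`, `W(0) = x₀` on `[0, T]`, so that `t ↦ S(t) W(t)` is the mild
solution of `U' = 𝒜 U + Φ(U)`. -/
def IsSolution (Φ : G → G) (x₀ : G) (T : ℝ) (W : ℝ → G) : Prop :=
  W 0 = x₀ ∧ ∀ t ∈ Icc 0 T, HasDerivWithinAt W (S.field Φ t (W t)) (Icc 0 T) t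

variable {S} {x₀ : G} {T T' : ℝ} {W W' : ℝ → G}

theorem IsSolution.continuousOn (hW : S.IsSolution Φ x₀ T W) : ContinuousOn W (Icc 0 T) :=
  fun t ht => (hW.2 t ht).continuousWithinAt

theorem IsSolution.mono (hW : S.IsSolution Φ x₀ T W) (hT : T' ≤ T) : S.IsSolution Φ x₀ T' W :=
  ⟨hW.1, fun t ht => (hW.2 t ⟨ht.1, ht.2.trans hT⟩).mono (Icc_subset_Icc_right hT)⟩

theorem IsSolution.exists_extension (hW : S.IsSolution Φ x₀ T W) (hT : 0 ≤ T) {δ : ℝ} (hδ : 0 < δ)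
    {V : ℝ → G} (hV0 : V T = W T)
    (hV : ∀ t ∈ Icc T (T + δ), HasDerivWithinAt V (S.field Φ t (V t)) (Icc T (T + δ)) t) :
    ∃ U, S.IsSolution Φ x₀ (T + δ) U := by
  let U : ℝ → G := fun t => if t ≤ T then W t else V t
  have hUW : ∀ t ≤ T, U t = W t := fun t ht => if_pos ht
  have hUV : ∀ t, T ≤ t → U t = V t := fun t ht => by
    rcases ht.eq_or_lt with rfl | h
    · rw [hUW T le_rfl, hV0]
    · exact if_neg (not_le.2 h)
  refine ⟨U, (hUW 0 hT).trans hW.1, fun t ht => ?_⟩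
  have hl : t ≤ T → HasDerivWithinAt U (S.field Φ t (U t)) (Icc 0 T) t := fun h => by
    rw [hUW t h]
    exact (hW.2 t ⟨ht.1, h⟩).congr (fun s hs => hUW s hs.2) (hUW t h)
  have hr : T ≤ t → HasDerivWithinAt U (S.field Φ t (U t)) (Icc T (T + δ)) t := fun h => by
    rw [hUV t h]
    exact (hV t ⟨h, ht.2⟩).congr (fun s hs => hUV s hs.1) (hUV t h)
  rcases lt_trichotomy t T with h | h | h
  · refine (hl h.le).mono_of_mem_nhdsWithin ?_
    filter_upwards [self_mem_nhdsWithin, mem_nhdsWithin_of_mem_nhds (Iio_mem_nhds h)] with s hs hs'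
    exact ⟨hs.1, (mem_Iio.1 hs').le⟩
  · have := (hl h.le).union (hr h.ge)
    rwa [Icc_union_Icc_eq_Icc hT (by linarith)] at this
  · refine (hr h.le).mono_of_mem_nhdsWithin ?_
    filter_upwards [self_mem_nhdsWithin, mem_nhdsWithin_of_mem_nhds (Ioi_mem_nhds h)] with s hs hs'
    exact ⟨(mem_Ioi.1 hs').le, hs.2⟩

variable [CompleteSpace G] (S)

theorem exists_norm_le (T : ℝ) : ∃ M : ℝ, 0 < M ∧ ∀ t, |t| ≤ T → ‖S.op t‖ ≤ M := by
  have hpointwise : ∀ x, ∃ C, ∀ t : Icc (-T) T, ‖S.op t x‖ ≤ C := fun x => by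
    obtain ⟨C, hC⟩ :=
      isCompact_Icc.exists_bound_of_continuousOn (s := Icc (-T) T) (S.continuous_op x).continuousOn
    exact ⟨C, fun t => hC t t.2⟩
  obtain ⟨M, hM⟩ := banach_steinhaus hpointwise
  exact ⟨max M 1, by positivity,
    fun t ht => (hM ⟨t, abs_le.1 ht⟩).trans (le_max_left _ _)⟩

theorem continuous_op_apply : Continuous fun z : ℝ × G => S.op z.1 z.2 := by
  refine continuous_iff_continuousAt.2 fun ⟨t, x⟩ => ?_
  obtain ⟨M, -, hSM⟩ := S.exists_norm_le (|t| + 1)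
  rw [ContinuousAt, tendsto_iff_norm_sub_tendsto_zero]
  have hbound : Tendsto (fun z : ℝ × G => M * ‖z.2 - x‖ + ‖S.op z.1 x - S.op t x‖) (𝓝 (t, x))
      (𝓝 0) := by
    have hx := (S.continuous_op x).comp (continuous_fst (X := ℝ) (Y := G))
    simp only [Function.comp_def] at hx
    have hcont : Continuous fun z : ℝ × G => M * ‖z.2 - x‖ + ‖S.op z.1 x - S.op t x‖ := by fun_prop
    simpa using hcont.tendsto (t, x)
  have hnear : ∀ᶠ z : ℝ × G in 𝓝 (t, x), |z.1| < |t| + 1 :=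
    (continuous_fst.abs.tendsto (t, x)).eventually_lt_const (lt_add_one _)
  refine squeeze_zero' (Eventually.of_forall fun z => norm_nonneg _) ?_ hbound
  filter_upwards [hnear] with z hz
  calc ‖S.op z.1 z.2 - S.op t x‖ = ‖S.op z.1 (z.2 - x) + (S.op z.1 x - S.op t x)‖ := by
        rw [map_sub, sub_add_sub_cancel]
    _ ≤ _ := norm_add_le_of_le ((S.op z.1).le_of_opNorm_le (hSM _ hz.le) _) le_rfl

theorem exists_lipschitzOnWith_field (hΦ : LipschitzOnBalls Φ) (T R : ℝ) :
    ∃ K : NNReal, ∀ t, |t| ≤ T → LipschitzOnWith K (S.field Φ t) (Metric.closedBall 0 R) := by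
  obtain ⟨M, hM, hSM⟩ := S.exists_norm_le T
  obtain ⟨K, hK⟩ := hΦ (M * R)
  lift M to NNReal using hM.le
  refine ⟨M * (K * M), fun t ht => ?_⟩
  have hlip : ∀ s, |s| ≤ T → LipschitzWith M (S.op s) := fun s hs =>
    (S.op s).lipschitz.weaken (hSM s hs)
  have hmaps : MapsTo (S.op t) (Metric.closedBall 0 R) (Metric.closedBall 0 (M * R)) := by
    intro x hx
    rw [mem_closedBall_zero_iff] at hx ⊢
    exact ((S.op t).le_of_opNorm_le (hSM t ht) x).trans (by gcongr)
  exact (hlip (-t) (by rwa [abs_neg])).comp_lipschitzOnWith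
    (hK.comp (hlip t ht).lipschitzOnWith hmaps)

theorem exists_norm_field_le (hΦ : LipschitzOnBalls Φ) (T R : ℝ) :
    ∃ L : NNReal, ∀ t, |t| ≤ T → ∀ x, ‖x‖ ≤ R → ‖S.field Φ t x‖ ≤ L := by
  obtain ⟨M, -, hSM⟩ := S.exists_norm_le T
  obtain ⟨K, hK⟩ := S.exists_lipschitzOnWith_field hΦ T R
  refine ⟨(K * R + M * ‖Φ 0‖).toNNReal, fun t ht x hx => ?_⟩
  have hR : 0 ≤ R := (norm_nonneg x).trans hx
  have hzero : ‖S.field Φ t 0‖ ≤ M * ‖Φ 0‖ := by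
    rw [field, map_zero]
    exact (S.op (-t)).le_of_opNorm_le (hSM _ (by rwa [abs_neg])) _
  have hdiff : ‖S.field Φ t x - S.field Φ t 0‖ ≤ K * ‖x‖ := by
    simpa only [dist_eq_norm, sub_zero] using (hK t ht).dist_le_mul x
      (mem_closedBall_zero_iff.2 hx) 0 (Metric.mem_closedBall_self hR)
  calc ‖S.field Φ t x‖ ≤ ‖S.field Φ t x - S.field Φ t 0‖ + ‖S.field Φ t 0‖ :=
        norm_le_norm_sub_add _ _
    _ ≤ K * R + M * ‖Φ 0‖ := add_le_add (hdiff.trans (by gcongr)) hzero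
    _ ≤ _ := Real.le_coe_toNNReal _

theorem continuousOn_op_comp {W : ℝ → G} {s : Set ℝ} (hW : ContinuousOn W s) :
    ContinuousOn (fun t => S.op t (W t)) s :=
  S.continuous_op_apply.comp_continuousOn (continuousOn_id.prodMk hW)

theorem continuousOn_field (hΦ : Continuous Φ) {W : ℝ → G} {s : Set ℝ} (hW : ContinuousOn W s) :
    ContinuousOn (fun t => S.field Φ t (W t)) s :=
  S.continuous_op_apply.comp_continuousOn (continuousOn_id.neg.prodMk
    (hΦ.comp_continuousOn (S.continuousOn_op_comp hW)))

theorem continuous_field (hΦ : Continuous Φ) (x : G) : Continuous fun t => S.field Φ t x :=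
  continuousOn_univ.1 (S.continuousOn_field hΦ continuousOn_const)

theorem exists_local_solution (hΦ : LipschitzOnBalls Φ) (T R : ℝ) :
    ∃ δ : ℝ, 0 < δ ∧ ∀ t₀ ∈ Icc 0 T, ∀ x₀ : G, ‖x₀‖ ≤ R → ∃ W : ℝ → G, W t₀ = x₀ ∧
      ∀ t ∈ Icc t₀ (t₀ + δ), HasDerivWithinAt W (S.field Φ t (W t)) (Icc t₀ (t₀ + δ)) t := by
  obtain ⟨K, hK⟩ := S.exists_lipschitzOnWith_field hΦ (T + 1) (R + 1)
  obtain ⟨L, hL⟩ := S.exists_norm_field_le hΦ (T + 1) (R + 1)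
  have hδ_pos : (0 : ℝ) < 1 / (L + 1) := by positivity
  have hδ_le : (1 : ℝ) / (L + 1) ≤ 1 := (div_le_one (by positivity)).2 (by simp)
  refine ⟨1 / (L + 1), hδ_pos, fun t₀ ht₀ x₀ hx₀ => ?_⟩
  have htime : ∀ t ∈ Icc t₀ (t₀ + 1 / (L + 1)), |t| ≤ T + 1 := fun t ht => by
    rw [abs_of_nonneg (ht₀.1.trans ht.1)]
    linarith [ht.2, ht₀.2]
  have hball : Metric.closedBall x₀ ((1 : NNReal) : ℝ) ⊆ Metric.closedBall 0 (R + 1) :=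
    Metric.closedBall_subset_closedBall' (by rw [dist_zero_right, NNReal.coe_one]; linarith)
  have hPL : IsPicardLindelof (S.field Φ) (tmin := t₀) (tmax := t₀ + 1 / (L + 1))
      ⟨t₀, left_mem_Icc.2 (by linarith)⟩ x₀ 1 0 L K :=
    { lipschitzOnWith := fun t ht => (hK t (htime t ht)).mono hball
      continuousOn := fun x _ => (S.continuous_field hΦ.continuous x).continuousOn
      norm_le := fun t ht x hx => hL t (htime t ht) x (mem_closedBall_zero_iff.1 (hball hx))
      mul_max_le := by
        simp only [add_sub_cancel_left, sub_self, NNReal.coe_one, NNReal.coe_zero, sub_zero]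
        rw [max_eq_left hδ_pos.le, mul_one_div, div_le_one (by positivity)]
        linarith }
  exact hPL.exists_eq_forall_mem_Icc_hasDerivWithinAt₀

variable {S}

theorem IsSolution.eqOn (hΦ : LipschitzOnBalls Φ)
    (hW : S.IsSolution Φ x₀ T W) (hW' : S.IsSolution Φ x₀ T W') : EqOn W W' (Icc 0 T) := by
  obtain ⟨R, hR⟩ := isCompact_Icc.exists_bound_of_continuousOn hW.continuousOn
  obtain ⟨R', hR'⟩ := isCompact_Icc.exists_bound_of_continuousOn hW'.continuousOn
  obtain ⟨K, hK⟩ := S.exists_lipschitzOnWith_field hΦ T (max R R')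
  have hderiv : ∀ {W : ℝ → G}, S.IsSolution Φ x₀ T W →
      ∀ t ∈ Ico 0 T, HasDerivWithinAt W (S.field Φ t (W t)) (Ici t) t := fun hW t ht =>
    (hW.2 t (Ico_subset_Icc_self ht)).mono_of_mem_nhdsWithin
      (mem_of_superset (Icc_mem_nhdsGE ht.2) (Icc_subset_Icc_left ht.1))
  refine ODE_solution_unique_of_mem_Icc_right (v := S.field Φ) (K := K)
    (s := fun _ => Metric.closedBall 0 (max R R'))
    (fun t ht => hK t ?_) hW.continuousOn (hderiv hW) (fun t ht => ?_) hW'.continuousOn (hderiv hW')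
    (fun t ht => ?_) (hW.1.trans hW'.1.symm)
  · rw [abs_of_nonneg ht.1]
    exact ht.2.le
  · rw [mem_closedBall_zero_iff]
    exact (hR t (Ico_subset_Icc_self ht)).trans (le_max_left _ _)
  · rw [mem_closedBall_zero_iff]
    exact (hR' t (Ico_subset_Icc_self ht)).trans (le_max_right _ _)

theorem IsSolution.duhamel (hΦ : Continuous Φ) (hW : S.IsSolution Φ x₀ T W)
    {t : ℝ} (ht : t ∈ Icc 0 T) :
    ContinuousOn (fun τ => S.op (t - τ) (Φ (S.op τ (W τ)))) (Icc 0 t) ∧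
    S.op t (W t) = S.op t x₀ + ∫ τ in (0)..t, S.op (t - τ) (Φ (S.op τ (W τ))) := by
  have hsub : Icc 0 t ⊆ Icc 0 T := Icc_subset_Icc_right ht.2
  have hcont : ContinuousOn (fun τ => S.field Φ τ (W τ)) (Icc 0 t) :=
    (S.continuousOn_field hΦ hW.continuousOn).mono hsub
  have e : ∀ τ, S.op (t - τ) (Φ (S.op τ (W τ))) = S.op t (S.field Φ τ (W τ)) := fun τ => by
    rw [field, ← S.op_add, sub_eq_add_neg]
  simp only [e]
  refine ⟨(S.op t).continuous.comp_continuousOn hcont, ?_⟩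
  have hi : IntervalIntegrable (fun τ => S.field Φ τ (W τ)) volume 0 t :=
    hcont.intervalIntegrable_of_Icc ht.1
  have h := intervalIntegral.integral_eq_sub_of_hasDerivAt_of_le ht.1 (hW.continuousOn.mono hsub)
    (fun τ hτ => (hW.2 τ (hsub (Ioo_subset_Icc_self hτ))).hasDerivAt
      (Icc_mem_nhds hτ.1 (hτ.2.trans_le ht.2))) hi
  rw [(S.op t).intervalIntegral_comp_comm hi, h, hW.1, map_sub]
  abel

variable (S) in
theorem exists_duhamel {Ψ : ℝ → G} (hΨ : Continuous Ψ) (x₀ : G) :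
    ∃ W : ℝ → G, W 0 = x₀ ∧ (∀ t, HasDerivAt W (S.op (-t) (Ψ t)) t) ∧
      ∀ t, Continuous (fun τ => S.op (t - τ) (Ψ τ)) ∧
        S.op t (W t) = S.op t x₀ + ∫ τ in (0)..t, S.op (t - τ) (Ψ τ) := by
  have hg : Continuous fun τ => S.op (-τ) (Ψ τ) :=
    S.continuous_op_apply.comp (continuous_neg.prodMk hΨ)
  refine ⟨fun t => x₀ + ∫ τ in (0)..t, S.op (-τ) (Ψ τ), by simp,
    fun t => (hg.integral_hasStrictDerivAt 0 t).hasDerivAt.const_add _, fun t => ⟨?_, ?_⟩⟩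
  · exact S.continuous_op_apply.comp ((continuous_const.sub continuous_id).prodMk hΨ)
  · have e : ∀ τ, S.op (t - τ) (Ψ τ) = S.op t (S.op (-τ) (Ψ τ)) := fun τ => by
      rw [← S.op_add, sub_eq_add_neg]
    simp only [e]
    rw [map_add, (S.op t).intervalIntegral_comp_comm (hg.intervalIntegrable _ _)]

variable (S) in
theorem hasDerivWithinAt_comp_op_apply {G' : Type*} [NormedAddCommGroup G'] [NormedSpace ℝ G']
    (L : G →L[ℝ] G') {s : Set ℝ} {t : ℝ} {w' : G} {d : G'} (hW : HasDerivWithinAt W w' s t)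
    (hL : HasDerivWithinAt (fun r => L (S.op r (W t))) d s t) :
    HasDerivWithinAt (fun r => L (S.op r (W r))) (d + L (S.op t w')) s t := by
  have hincrement : HasDerivWithinAt (fun r => L (S.op r (W r - W t))) (L (S.op t w')) s t := by
    rw [hasDerivWithinAt_iff_tendsto_slope] at hW ⊢
    have htime : Tendsto (fun r : ℝ => r) (𝓝[s \ {t}] t) (𝓝 t) :=
      tendsto_id.mono_left nhdsWithin_le_nhds
    refine (((L.continuous.comp S.continuous_op_apply).tendsto (t, w')).comp
      (htime.prodMk_nhds hW)).congr fun r => ?_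
    simp [slope_def_module]
  have hsplit : ∀ r, L (S.op r (W r)) = L (S.op r (W t)) + L (S.op r (W r - W t)) := fun r => by
    rw [← map_add, ← map_add, add_sub_cancel]
  exact (hL.add hincrement).congr (fun r _ => hsplit r) (hsplit t)

variable (S) in
theorem exists_extension_time (hΦ : LipschitzOnBalls Φ) (T R : ℝ) :
    ∃ δ : ℝ, 0 < δ ∧ ∀ t ∈ Icc 0 T, ∀ x₀ W, S.IsSolution Φ x₀ t W → ‖S.op t (W t)‖ ≤ R →
      ∃ U, S.IsSolution Φ x₀ (t + δ) U := by
  obtain ⟨M, hM, hSM⟩ := S.exists_norm_le T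
  obtain ⟨δ, hδ, hlocal⟩ := S.exists_local_solution hΦ T (M * R)
  refine ⟨δ, hδ, fun t ht x₀ W hW hWR => ?_⟩
  have hWt : ‖W t‖ ≤ M * R := by
    rw [← S.op_neg_op t (W t)]
    refine ((S.op (-t)).le_of_opNorm_le (hSM _ ?_) _).trans (by gcongr)
    rw [abs_neg, abs_of_nonneg ht.1]
    exact ht.2
  obtain ⟨V, hV₀, hV⟩ := hlocal t ht (W t) hWt
  exact hW.exists_extension ht.1 hδ hV₀ hV

end StronglyContinuousGroup

/-! ### Finite measures and bilinear forms -/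

theorem measure_eq_of_real_Iic {α : Type*} [TopologicalSpace α] [SecondCountableTopology α]
    [LinearOrder α] [OrderTopology α] [MeasurableSpace α] [BorelSpace α] {m₁ m₂ : Measure α}
    [IsFiniteMeasure m₁] [IsFiniteMeasure m₂] (h : ∀ a, m₁.real (Iic a) = m₂.real (Iic a)) :
    m₁ = m₂ :=
  Measure.ext_of_Iic _ _ fun a => (ENNReal.toReal_eq_toReal_iff' (measure_ne_top _ _)
    (measure_ne_top _ _)).1 (h a)

theorem measureReal_withDensity_ofReal {Ω : Type*} [MeasurableSpace Ω] {m : Measure Ω} {φ : Ω → ℝ}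
    (hφ : Measurable φ) (hφ_nonneg : 0 ≤ᵐ[m] φ) {s : Set Ω} (hs : MeasurableSet s) :
    (m.withDensity fun l => ENNReal.ofReal (φ l)).real s = ∫ l, s.indicator φ l ∂m := by
  rw [Measure.real, withDensity_apply _ hs, integral_indicator hs,
    integral_eq_lintegral_of_nonneg_ae (ae_restrict_of_ae hφ_nonneg) hφ.aestronglyMeasurable]

theorem integral_withDensity_ofReal {Ω : Type*} [MeasurableSpace Ω] {m : Measure Ω} {φ : Ω → ℝ}
    (hφ : Measurable φ) (hφ_nonneg : 0 ≤ᵐ[m] φ) (ψ : Ω → ℝ) :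
    ∫ l, ψ l ∂(m.withDensity fun l => ENNReal.ofReal (φ l)) = ∫ l, ψ l * φ l ∂m := by
  rw [integral_withDensity_eq_integral_toReal_smul hφ.ennreal_ofReal
    (Eventually.of_forall fun _ => ENNReal.ofReal_lt_top)]
  refine integral_congr_ae (hφ_nonneg.mono fun l hl => ?_)
  simp only [ENNReal.toReal_ofReal hl, smul_eq_mul, mul_comm]

theorem abs_bilin_le_of_abs_apply_self_le {V : Type*} [NormedAddCommGroup V]
    [InnerProductSpace ℝ V] {B : V →ₗ[ℝ] V →ₗ[ℝ] ℝ} (hB : ∀ f h, B f h = B h f) {C : ℝ}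
    (hC : ∀ f, |B f f| ≤ C * ‖f‖ ^ 2) (f h : V) : |B f h| ≤ C * ‖f‖ * ‖h‖ := by
  have hquad : ∀ f h : V, |B f h| ≤ C / 2 * (‖f‖ ^ 2 + ‖h‖ ^ 2) := by
    intro f h
    have hadd := abs_le.1 (hC (f + h))
    have hsub := abs_le.1 (hC (f - h))
    simp only [map_add, map_sub, LinearMap.add_apply, LinearMap.sub_apply, norm_add_sq_real,
      norm_sub_sq_real, hB h f] at hadd hsub
    exact abs_le.2 ⟨by linarith, by linarith⟩
  rcases eq_or_ne f 0 with rfl | hf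
  · simp
  rcases eq_or_ne h 0 with rfl | hh
  · simp
  have hf' := norm_pos_iff.2 hf
  have hh' := norm_pos_iff.2 hh
  have hunit := hquad (‖f‖⁻¹ • f) (‖h‖⁻¹ • h)
  simp only [map_smul, LinearMap.smul_apply, smul_eq_mul, norm_smul, norm_inv, norm_norm,
    inv_mul_cancel₀ hf'.ne', inv_mul_cancel₀ hh'.ne', abs_mul, abs_inv, abs_norm] at hunit
  calc |B f h| = ‖f‖ * ‖h‖ * (‖h‖⁻¹ * (‖f‖⁻¹ * |B f h|)) := by field_simp
    _ ≤ ‖f‖ * ‖h‖ * C := by gcongr; linarith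
    _ = C * ‖f‖ * ‖h‖ := by ring

/-! ### Functional calculus of a resolution of the identity -/

namespace ResolutionOfIdentity

variable {H : Type*} [NormedAddCommGroup H] [InnerProductSpace ℝ H] [CompleteSpace H]
  (E : ResolutionOfIdentity H)

theorem inner_proj_left (a : ℝ) (f h : H) : ⟪E.proj a f, h⟫_ℝ = ⟪f, E.proj a h⟫_ℝ := by
  rw [← ContinuousLinearMap.adjoint_inner_right, ← ContinuousLinearMap.star_eq_adjoint,
    (E.isStarProjection a).isSelfAdjoint.star_eq]

theorem proj_proj (a b : ℝ) (f : H) : E.proj a (E.proj b f) = E.proj (min a b) f := by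
  rcases le_total a b with h | h
  · rw [min_eq_left h]
    exact congrArg (fun T : H →L[ℝ] H => T f) (E.proj_mul_proj a b h)
  · rw [min_eq_right h]
    have hstar := congrArg star (E.proj_mul_proj b a h)
    rw [star_mul, (E.isStarProjection a).isSelfAdjoint.star_eq,
      (E.isStarProjection b).isSelfAdjoint.star_eq] at hstar
    exact congrArg (fun T : H →L[ℝ] H => T f) hstar

theorem tendsto_distribution_atBot (f : H) :
    Tendsto (E.distribution f) atBot (𝓝 0) := by
  have hpow := (E.tendsto_atBot f).norm.pow 2
  rwa [norm_zero, zero_pow two_ne_zero] at hpow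

theorem tendsto_distribution_atTop (f : H) :
    Tendsto (E.distribution f) atTop (𝓝 (‖f‖ ^ 2)) :=
  ((E.tendsto_atTop f).norm).pow 2

theorem measure_Iic (f : H) (a : ℝ) :
    E.measure f (Iic a) = ENNReal.ofReal (‖E.proj a f‖ ^ 2) := by
  rw [measure, StieltjesFunction.measure_Iic _ (E.tendsto_distribution_atBot f), sub_zero]
  rfl

theorem measure_univ (f : H) : E.measure f univ = ENNReal.ofReal (‖f‖ ^ 2) := by
  rw [measure, StieltjesFunction.measure_univ _ (E.tendsto_distribution_atBot f)
    (E.tendsto_distribution_atTop f), sub_zero]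

instance isFiniteMeasure_measure (f : H) : IsFiniteMeasure (E.measure f) :=
  ⟨by rw [measure_univ]; exact ENNReal.ofReal_lt_top⟩

theorem real_measure_univ (f : H) : (E.measure f).real univ = ‖f‖ ^ 2 := by
  rw [Measure.real, measure_univ, ENNReal.toReal_ofReal (by positivity)]

theorem real_measure_Iic (f : H) (a : ℝ) : (E.measure f).real (Iic a) = ‖E.proj a f‖ ^ 2 := by
  rw [Measure.real, measure_Iic, ENNReal.toReal_ofReal (by positivity)]

theorem measure_neg (f : H) : E.measure (-f) = E.measure f :=
  measure_eq_of_real_Iic fun a => by simp [real_measure_Iic]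

theorem measure_sub_comm (f h : H) : E.measure (f - h) = E.measure (h - f) := by
  rw [← neg_sub, measure_neg]

theorem measure_zero : E.measure (0 : H) = 0 :=
  measure_eq_of_real_Iic fun a => by simp [real_measure_Iic]

theorem measure_smul (c : ℝ) (f : H) :
    E.measure (c • f) = ENNReal.ofReal (c ^ 2) • E.measure f := by
  have : IsFiniteMeasure (ENNReal.ofReal (c ^ 2) • E.measure f) :=
    Measure.smul_finite _ ENNReal.ofReal_ne_top
  refine measure_eq_of_real_Iic fun a => ?_
  rw [measureReal_ennreal_smul_apply, ENNReal.toReal_ofReal (sq_nonneg c)]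
  simp [real_measure_Iic, norm_smul, mul_pow]

theorem measure_add_add_sub (f h : H) :
    E.measure (f + h) + E.measure (f - h) = (2 : ℝ≥0∞) • (E.measure f + E.measure h) := by
  have : IsFiniteMeasure ((2 : ℝ≥0∞) • (E.measure f + E.measure h)) :=
    Measure.smul_finite _ (by simp)
  refine measure_eq_of_real_Iic fun a => ?_
  rw [measureReal_ennreal_smul_apply, measureReal_add_apply, measureReal_add_apply]
  simp only [real_measure_Iic, map_add, map_sub, norm_add_sq_real, norm_sub_sq_real]
  simp
  ring

theorem measure_add_le (f h : H) :
    E.measure (f + h) ≤ (2 : ℝ≥0∞) • (E.measure f + E.measure h) := by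
  rw [← measure_add_add_sub]
  exact Measure.le_add_right le_rfl

theorem measure_sub_le (f h : H) :
    E.measure (f - h) ≤ (2 : ℝ≥0∞) • (E.measure f + E.measure h) := by
  rw [← measure_add_add_sub]
  exact Measure.le_add_left le_rfl

theorem measure_add_identity (f g h : H) :
    E.measure (f + g + h) + (E.measure (f - h) + E.measure (g - h)) =
      E.measure (f + g - h) + (E.measure (f + h) + E.measure (g + h)) := by
  refine measure_eq_of_real_Iic fun a => ?_
  rw [measureReal_add_apply, measureReal_add_apply, measureReal_add_apply, measureReal_add_apply]
  simp only [real_measure_Iic, map_add, map_sub, norm_add_sq_real, norm_sub_sq_real,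
    inner_add_left]
  ring

theorem measure_smul_identity {c : ℝ} (hc : 0 ≤ c) (f h : H) :
    E.measure (c • f + h) + ENNReal.ofReal c • E.measure (f - h) =
      E.measure (c • f - h) + ENNReal.ofReal c • E.measure (f + h) := by
  have hfin : ∀ k, IsFiniteMeasure (ENNReal.ofReal c • E.measure k) := fun k =>
    Measure.smul_finite _ ENNReal.ofReal_ne_top
  refine measure_eq_of_real_Iic fun a => ?_
  rw [measureReal_add_apply, measureReal_add_apply]
  simp only [measureReal_ennreal_smul_apply, ENNReal.toReal_ofReal hc,
    real_measure_Iic, map_add, map_sub, map_smul, norm_add_sq_real,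
    norm_sub_sq_real, real_inner_smul_left]
  ring

theorem measure_proj_identity (a : ℝ) (f h : H) :
    E.measure (E.proj a f + h) + (E.measure (f - h)).restrict (Iic a) =
      E.measure (E.proj a f - h) + (E.measure (f + h)).restrict (Iic a) := by
  refine measure_eq_of_real_Iic fun b => ?_
  rw [measureReal_add_apply, measureReal_add_apply]
  simp only [measureReal_restrict_apply measurableSet_Iic, Iic_inter_Iic,
    real_measure_Iic, map_add, map_sub, proj_proj, norm_add_sq_real, norm_sub_sq_real]
  have hinner : ⟪E.proj (min b a) f, E.proj b h⟫_ℝ =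
      ⟪E.proj (min b a) f, E.proj (min b a) h⟫_ℝ := by
    rw [← inner_proj_left, proj_proj, ← inner_proj_left, proj_proj, min_self,
      min_eq_right (min_le_left b a)]
  rw [hinner]
  ring

/-- The function `φ` is a bounded symbol: measurable, and almost everywhere bounded for all spectral
measures with a common bound. -/
def Bdd (φ : ℝ → ℝ) : Prop :=
  Measurable φ ∧ ∃ C, ∀ f, ∀ᵐ l ∂(E.measure f), |φ l| ≤ C

variable {E} {φ ψ : ℝ → ℝ}

theorem Bdd.of_forall (hφ : Measurable φ) {C : ℝ} (h : ∀ l, |φ l| ≤ C) : E.Bdd φ :=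
  ⟨hφ, C, fun _ => Eventually.of_forall h⟩

theorem Bdd.const (c : ℝ) : E.Bdd fun _ => c :=
  .of_forall measurable_const fun _ => le_rfl

theorem Bdd.indicator_Iic (a : ℝ) : E.Bdd ((Iic a).indicator 1) := by
  refine .of_forall (C := 1) (measurable_one.indicator measurableSet_Iic) fun l => ?_
  by_cases h : l ∈ Iic a <;> simp [h]

theorem Bdd.add (hφ : E.Bdd φ) (hψ : E.Bdd ψ) : E.Bdd fun l => φ l + ψ l := by
  obtain ⟨hφm, C, hC⟩ := hφ
  obtain ⟨hψm, D, hD⟩ := hψ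
  refine ⟨hφm.add hψm, C + D, fun f => ?_⟩
  filter_upwards [hC f, hD f] with l hφl hψl
  exact (abs_add_le _ _).trans (add_le_add hφl hψl)

theorem Bdd.mul (hφ : E.Bdd φ) (hψ : E.Bdd ψ) : E.Bdd fun l => φ l * ψ l := by
  obtain ⟨hφm, C, hC⟩ := hφ
  obtain ⟨hψm, D, hD⟩ := hψ
  refine ⟨hφm.mul hψm, C * D, fun f => ?_⟩
  filter_upwards [hC f, hD f] with l hφl hψl
  rw [abs_mul]
  exact mul_le_mul hφl hψl (abs_nonneg _) ((abs_nonneg _).trans hφl)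

theorem Bdd.neg (hφ : E.Bdd φ) : E.Bdd fun l => -φ l :=
  ⟨hφ.1.neg, by simpa using hφ.2⟩

theorem Bdd.sub (hφ : E.Bdd φ) (hψ : E.Bdd ψ) : E.Bdd fun l => φ l - ψ l := by
  simpa only [sub_eq_add_neg] using hφ.add hψ.neg

theorem Bdd.integrable (hφ : E.Bdd φ) (f : H) : Integrable φ (E.measure f) := by
  obtain ⟨hφm, C, hC⟩ := hφ
  exact Integrable.of_bound hφm.aestronglyMeasurable C (hC f)

theorem Bdd.memDom (hφ : E.Bdd φ) (f : H) : E.MemDom φ f := by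
  simpa only [MemDom, sq] using ((hφ.mul hφ).integrable f).lintegral_lt_top

theorem weakIntegral_comm (φ : ℝ → ℝ) (f h : H) :
    E.weakIntegral φ f h = E.weakIntegral φ h f := by
  rw [weakIntegral, weakIntegral, add_comm f h, measure_sub_comm]

theorem weakIntegral_add_left {f g h : H}
    (hφ : ∀ k ∈ ({f + g + h, f - h, g - h, f + g - h, f + h, g + h} : Set H),
      Integrable φ (E.measure k)) :
    E.weakIntegral φ (f + g) h = E.weakIntegral φ f h + E.weakIntegral φ g h := by
  simp only [mem_insert_iff, mem_singleton_iff, forall_eq_or_imp, forall_eq] at hφ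
  obtain ⟨hfgh_add, hfh_sub, hgh_sub, hfgh_sub, hfh_add, hgh_add⟩ := hφ
  have hintegral := congrArg (fun m => ∫ l, φ l ∂m) (E.measure_add_identity f g h)
  rw [integral_add_measure hfgh_add (hfh_sub.add_measure hgh_sub),
    integral_add_measure hfh_sub hgh_sub,
    integral_add_measure hfgh_sub (hfh_add.add_measure hgh_add),
    integral_add_measure hfh_add hgh_add] at hintegral
  simp only [weakIntegral]
  linarith

theorem weakIntegral_neg_left (f h : H) :
    E.weakIntegral φ (-f) h = -E.weakIntegral φ f h := by
  rw [weakIntegral, weakIntegral, neg_add_eq_sub, E.measure_sub_comm h f, ← neg_add', measure_neg]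
  ring

theorem Bdd.weakIntegral_smul_left (hφ : E.Bdd φ) (c : ℝ) (f h : H) :
    E.weakIntegral φ (c • f) h = c * E.weakIntegral φ f h := by
  have hpos : ∀ c : ℝ, 0 ≤ c → E.weakIntegral φ (c • f) h = c * E.weakIntegral φ f h := by
    intro c hc
    have hintegral := congrArg (fun m => ∫ l, φ l ∂m) (E.measure_smul_identity hc f h)
    rw [integral_add_measure (hφ.integrable _)
        ((hφ.integrable _).smul_measure ENNReal.ofReal_ne_top),
      integral_add_measure (hφ.integrable _)
        ((hφ.integrable _).smul_measure ENNReal.ofReal_ne_top), integral_smul_measure,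
      integral_smul_measure, ENNReal.toReal_ofReal hc, smul_eq_mul, smul_eq_mul] at hintegral
    simp only [weakIntegral]
    linarith
  rcases le_total 0 c with hc | hc
  · exact hpos c hc
  · have := hpos (-c) (by linarith)
    rw [neg_smul, weakIntegral_neg_left] at this
    linarith

theorem weakIntegral_self (φ : ℝ → ℝ) (f : H) :
    E.weakIntegral φ f f = ∫ l, φ l ∂(E.measure f) := by
  rw [weakIntegral, sub_self, measure_zero, ← two_smul ℝ f, measure_smul, integral_smul_measure]
  norm_num
  ring

theorem Bdd.weakIntegral_add (hφ : E.Bdd φ) (f g h : H) :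
    E.weakIntegral φ (f + g) h = E.weakIntegral φ f h + E.weakIntegral φ g h :=
  weakIntegral_add_left fun k _ => hφ.integrable k

theorem abs_integral_le {C : ℝ} (hC : ∀ f, ∀ᵐ l ∂(E.measure f), |φ l| ≤ C) (f : H) :
    |∫ l, φ l ∂(E.measure f)| ≤ C * ‖f‖ ^ 2 := by
  rw [← real_measure_univ, ← Real.norm_eq_abs]
  exact norm_integral_le_of_norm_le_const (hC f)

theorem Bdd.exists_op (hφ : E.Bdd φ) :
    ∃ T : H →L[ℝ] H, ∀ f h, ⟪T f, h⟫_ℝ = E.weakIntegral φ f h := by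
  let B : H →ₗ[ℝ] H →ₗ[ℝ] ℝ := LinearMap.mk₂ ℝ (E.weakIntegral φ) hφ.weakIntegral_add
    hφ.weakIntegral_smul_left
    (fun f g h => by
      rw [weakIntegral_comm, hφ.weakIntegral_add, weakIntegral_comm φ g, weakIntegral_comm φ h])
    (fun c f g => by
      rw [weakIntegral_comm, hφ.weakIntegral_smul_left, weakIntegral_comm, smul_eq_mul])
  obtain ⟨C, hC⟩ := hφ.2
  have hB : ∀ f h, |B f h| ≤ C * ‖f‖ * ‖h‖ :=
    abs_bilin_le_of_abs_apply_self_le (weakIntegral_comm φ) fun f =>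
      (congrArg abs (weakIntegral_self φ f)).trans_le (abs_integral_le hC f)
  exact ⟨InnerProductSpace.continuousLinearMapOfBilin (𝕜 := ℝ) (B.mkContinuous₂ C hB), fun f h =>
    InnerProductSpace.continuousLinearMapOfBilin_apply _ f h⟩

open Classical in
variable (E) in
/-- The bounded operator `∫ φ(l) dE(l)` (and `0` for a function without a common bound). -/
def op (φ : ℝ → ℝ) : H →L[ℝ] H :=
  if h : ∃ T : H →L[ℝ] H, ∀ f h, ⟪T f, h⟫_ℝ = E.weakIntegral φ f h then h.choose else 0

theorem Bdd.inner_op (hφ : E.Bdd φ) (f h : H) : ⟪E.op φ f, h⟫_ℝ = E.weakIntegral φ f h := by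
  rw [op, dif_pos hφ.exists_op]
  exact hφ.exists_op.choose_spec f h

theorem Bdd.op_eq (hφ : E.Bdd φ) {T : H →L[ℝ] H}
    (hT : ∀ f h, ⟪T f, h⟫_ℝ = E.weakIntegral φ f h) : E.op φ = T := by
  ext1 f
  refine ext_inner_right ℝ fun h => ?_
  rw [hφ.inner_op, hT]

theorem weakIntegral_congr (h : ∀ f, φ =ᵐ[E.measure f] ψ) (f g : H) :
    E.weakIntegral φ f g = E.weakIntegral ψ f g := by
  rw [weakIntegral, weakIntegral, integral_congr_ae (h _), integral_congr_ae (h _)]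

theorem op_congr (h : ∀ f, φ =ᵐ[E.measure f] ψ) : E.op φ = E.op ψ := by
  have hweak : E.weakIntegral φ = E.weakIntegral ψ :=
    funext fun f => funext fun g => weakIntegral_congr h f g
  unfold op
  rw [hweak]

theorem Bdd.inner_op_left (hφ : E.Bdd φ) (f h : H) : ⟪E.op φ f, h⟫_ℝ = ⟪f, E.op φ h⟫_ℝ := by
  rw [hφ.inner_op, weakIntegral_comm, ← hφ.inner_op, real_inner_comm]

theorem Bdd.op_add (hφ : E.Bdd φ) (hψ : E.Bdd ψ) :
    E.op (fun l => φ l + ψ l) = E.op φ + E.op ψ := by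
  refine (hφ.add hψ).op_eq fun f h => ?_
  rw [add_apply, inner_add_left, hφ.inner_op, hψ.inner_op, weakIntegral,
    weakIntegral, weakIntegral, integral_add (hφ.integrable _) (hψ.integrable _),
    integral_add (hφ.integrable _) (hψ.integrable _)]
  ring

theorem Bdd.op_const_mul (hφ : E.Bdd φ) (c : ℝ) : E.op (fun l => c * φ l) = c • E.op φ := by
  refine ((Bdd.const c).mul hφ).op_eq fun f h => ?_
  rw [smul_apply, real_inner_smul_left, hφ.inner_op, weakIntegral, weakIntegral,
    integral_const_mul, integral_const_mul]
  ring

theorem Bdd.op_neg (hφ : E.Bdd φ) : E.op (fun l => -φ l) = -E.op φ := by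
  refine hφ.neg.op_eq fun f h => ?_
  rw [neg_apply, inner_neg_left, hφ.inner_op, weakIntegral,
    weakIntegral, integral_neg, integral_neg]
  ring

theorem Bdd.op_sub (hφ : E.Bdd φ) (hψ : E.Bdd ψ) :
    E.op (fun l => φ l - ψ l) = E.op φ - E.op ψ := by
  simp only [sub_eq_add_neg]
  rw [hφ.op_add hψ.neg, hψ.op_neg]

theorem op_indicator_Iic (a : ℝ) : E.op ((Iic a).indicator 1) = E.proj a := by
  refine (Bdd.indicator_Iic a).op_eq fun f h => ?_
  have hinner : ⟪E.proj a f, h⟫_ℝ = ⟪E.proj a f, E.proj a h⟫_ℝ := by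
    rw [← inner_proj_left, proj_proj, min_self]
  rw [weakIntegral, integral_indicator_one measurableSet_Iic,
    integral_indicator_one measurableSet_Iic,
    real_measure_Iic, real_measure_Iic, map_add, map_sub,
    norm_add_sq_real, norm_sub_sq_real, hinner]
  ring

theorem Bdd.indicator (hφ : E.Bdd φ) {s : Set ℝ} (hs : MeasurableSet s) :
    E.Bdd (s.indicator φ) := by
  obtain ⟨hφm, C, hC⟩ := hφ
  refine ⟨hφm.indicator hs, C, fun f => ?_⟩
  filter_upwards [hC f] with l hl
  by_cases h : l ∈ s <;> simp only [h, indicator_of_mem, not_false_eq_true, indicator_of_notMem]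
  · exact hl
  · simpa using (abs_nonneg _).trans hl

theorem Bdd.op_proj (hφ : E.Bdd φ) (a : ℝ) (f : H) :
    E.op φ (E.proj a f) = E.op ((Iic a).indicator φ) f := by
  refine ext_inner_right ℝ fun h => ?_
  have hintegral := congrArg (fun m => ∫ l, φ l ∂m) (E.measure_proj_identity a f h)
  rw [integral_add_measure (hφ.integrable _) (hφ.integrable _).restrict,
    integral_add_measure (hφ.integrable _) (hφ.integrable _).restrict] at hintegral
  rw [hφ.inner_op, (hφ.indicator measurableSet_Iic).inner_op]
  simp only [weakIntegral, integral_indicator measurableSet_Iic]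
  linarith

theorem Bdd.proj_op (hφ : E.Bdd φ) (a : ℝ) (f : H) :
    E.proj a (E.op φ f) = E.op ((Iic a).indicator φ) f := by
  refine ext_inner_right ℝ fun h => ?_
  rw [inner_proj_left, hφ.inner_op_left, hφ.op_proj,
    (hφ.indicator measurableSet_Iic).inner_op_left]

/-- The polarized form of `d⟪E(l) φ(A) f, h⟫ = φ(l) d⟪E(l) f, h⟫`, rearranged so that no
difference of measures occurs. -/
theorem Bdd.measure_op_identity (hφ : E.Bdd φ) (hφ_nonneg : ∀ f, 0 ≤ᵐ[E.measure f] φ)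
    (f h : H) :
    E.measure (E.op φ f + h) + (E.measure (f - h)).withDensity (fun l => ENNReal.ofReal (φ l)) =
      E.measure (E.op φ f - h) +
        (E.measure (f + h)).withDensity (fun l => ENNReal.ofReal (φ l)) := by
  have hfin : ∀ k, IsFiniteMeasure
      ((E.measure k).withDensity fun l => ENNReal.ofReal (φ l)) := fun k =>
    isFiniteMeasure_withDensity_ofReal (hφ.integrable k).2
  refine measure_eq_of_real_Iic fun a => ?_
  have hinner : ⟪E.proj a (E.op φ f), E.proj a h⟫_ℝ =
      E.weakIntegral ((Iic a).indicator φ) f h := by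
    rw [← inner_proj_left, proj_proj, min_self, hφ.proj_op,
      (hφ.indicator measurableSet_Iic).inner_op]
  rw [measureReal_add_apply, measureReal_add_apply,
    measureReal_withDensity_ofReal hφ.1 (hφ_nonneg _) measurableSet_Iic,
    measureReal_withDensity_ofReal hφ.1 (hφ_nonneg _) measurableSet_Iic,
    real_measure_Iic, real_measure_Iic, map_add, map_sub,
    norm_add_sq_real, norm_sub_sq_real, hinner, weakIntegral]
  ring

theorem Bdd.weakIntegral_op_left (hφ : E.Bdd φ) (hφ_nonneg : ∀ f, 0 ≤ᵐ[E.measure f] φ)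
    {f h : H} (hψφ : ∀ k, Integrable (fun l => ψ l * φ l) (E.measure k))
    (hadd : Integrable ψ (E.measure (E.op φ f + h)))
    (hsub : Integrable ψ (E.measure (E.op φ f - h))) :
    E.weakIntegral ψ (E.op φ f) h = E.weakIntegral (fun l => ψ l * φ l) f h := by
  have hdensity : ∀ k, Integrable ψ
      ((E.measure k).withDensity fun l => ENNReal.ofReal (φ l)) := fun k => by
    rw [integrable_withDensity_iff_integrable_smul' hφ.1.ennreal_ofReal
      (Eventually.of_forall fun _ => ENNReal.ofReal_lt_top)]
    refine (hψφ k).congr ((hφ_nonneg k).mono fun l hl => ?_)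
    simp only [ENNReal.toReal_ofReal hl, smul_eq_mul, mul_comm]
  have hintegral := congrArg (fun m => ∫ l, ψ l ∂m) (hφ.measure_op_identity hφ_nonneg f h)
  rw [integral_add_measure hadd (hdensity _), integral_add_measure hsub (hdensity _),
    integral_withDensity_ofReal hφ.1 (hφ_nonneg _),
    integral_withDensity_ofReal hφ.1 (hφ_nonneg _)] at hintegral
  rw [weakIntegral, weakIntegral]
  linarith

theorem Bdd.op_mul_of_nonneg (hφ : E.Bdd φ) (hψ : E.Bdd ψ) (hφ_nonneg : ∀ l, 0 ≤ φ l) (f : H) :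
    E.op ψ (E.op φ f) = E.op (fun l => ψ l * φ l) f := by
  refine ext_inner_right ℝ fun h => ?_
  rw [hψ.inner_op, (hψ.mul hφ).inner_op]
  exact hφ.weakIntegral_op_left (fun _ => Eventually.of_forall hφ_nonneg)
    (hψ.mul hφ).integrable (hψ.integrable _) (hψ.integrable _)

theorem Bdd.max_zero (hφ : E.Bdd φ) : E.Bdd fun l => max (φ l) 0 := by
  obtain ⟨hφm, C, hC⟩ := hφ
  refine ⟨hφm.max measurable_const, C, fun f => ?_⟩
  filter_upwards [hC f] with l hl
  rw [abs_of_nonneg (le_max_right _ _)]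
  exact max_le ((le_abs_self _).trans hl) ((abs_nonneg _).trans hl)

theorem Bdd.op_mul (hψ : E.Bdd ψ) (hφ : E.Bdd φ) (f : H) :
    E.op ψ (E.op φ f) = E.op (fun l => ψ l * φ l) f := by
  have hpos := hφ.max_zero
  have hneg := hφ.neg.max_zero
  have hsplit : ∀ l, φ l = max (φ l) 0 - max (-φ l) 0 := fun l =>
    (max_zero_sub_eq_self (φ l)).symm
  have hop : E.op φ = E.op (fun l => max (φ l) 0) - E.op (fun l => max (-φ l) 0) := by
    rw [← hpos.op_sub hneg]
    exact congrArg E.op (funext hsplit)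
  have hop_mul : E.op (fun l => ψ l * φ l) =
      E.op (fun l => ψ l * max (φ l) 0) - E.op (fun l => ψ l * max (-φ l) 0) := by
    rw [← (hψ.mul hpos).op_sub (hψ.mul hneg)]
    simp only [← mul_sub, ← hsplit]
  rw [hop, hop_mul, sub_apply, sub_apply, map_sub,
    hpos.op_mul_of_nonneg hψ fun l => le_max_right _ _,
    hneg.op_mul_of_nonneg hψ fun l => le_max_right _ _]

theorem op_one : E.op (fun _ => 1) = 1 := by
  refine (Bdd.const 1).op_eq fun f h => ?_
  rw [weakIntegral, integral_const, integral_const, real_measure_univ, real_measure_univ,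
    norm_add_sq_real, norm_sub_sq_real]
  simp
  ring

theorem Bdd.norm_op_sq (hφ : E.Bdd φ) (f : H) :
    ‖E.op φ f‖ ^ 2 = ∫ l, φ l ^ 2 ∂(E.measure f) := by
  rw [← real_inner_self_eq_norm_sq, hφ.inner_op_left, hφ.op_mul hφ, real_inner_comm,
    (hφ.mul hφ).inner_op, weakIntegral_self]
  simp only [sq]

theorem Bdd.norm_op_le (hφ : E.Bdd φ) {C : ℝ} (hC_nonneg : 0 ≤ C)
    (hC : ∀ f, ∀ᵐ l ∂(E.measure f), |φ l| ≤ C) : ‖E.op φ‖ ≤ C := by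
  refine ContinuousLinearMap.opNorm_le_bound _ hC_nonneg fun f => ?_
  refine abs_le_of_sq_le_sq' ?_ (by positivity) |>.2
  rw [hφ.norm_op_sq, mul_pow, ← real_measure_univ E]
  refine (Real.le_norm_self _).trans (norm_integral_le_of_norm_le_const ?_)
  filter_upwards [hC f] with l hl
  rw [norm_pow, Real.norm_eq_abs]
  exact pow_le_pow_left₀ (abs_nonneg _) hl 2

theorem Bdd.measure_op (hφ : E.Bdd φ) (f : H) :
    E.measure (E.op φ f) = (E.measure f).withDensity fun l => ENNReal.ofReal (φ l ^ 2) := by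
  have hφ2 : E.Bdd fun l => φ l ^ 2 := by simpa only [sq] using hφ.mul hφ
  have : IsFiniteMeasure ((E.measure f).withDensity fun l => ENNReal.ofReal (φ l ^ 2)) :=
    isFiniteMeasure_withDensity_ofReal (hφ2.integrable f).2
  refine measure_eq_of_real_Iic fun a => ?_
  rw [real_measure_Iic, hφ.proj_op, (hφ.indicator measurableSet_Iic).norm_op_sq,
    measureReal_withDensity_ofReal hφ2.1 (Eventually.of_forall fun l => sq_nonneg _)
      measurableSet_Iic]
  congr 1 with l
  by_cases h : l ∈ Iic a <;> simp [h]

theorem MemDom.memLp (hφ : Measurable φ) {f : H} (hf : E.MemDom φ f) :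
    MemLp φ 2 (E.measure f) := by
  refine ⟨hφ.aestronglyMeasurable, ?_⟩
  rw [eLpNorm_lt_top_iff_lintegral_rpow_enorm_lt_top two_ne_zero ENNReal.ofNat_ne_top]
  refine lt_of_le_of_lt (le_of_eq (lintegral_congr fun l => ?_)) hf
  rw [← sq_abs, ENNReal.ofReal_pow (abs_nonneg _), ← Real.norm_eq_abs, ofReal_norm]
  simp

theorem MemDom.integrable (hφ : Measurable φ) {f : H} (hf : E.MemDom φ f) :
    Integrable φ (E.measure f) :=
  (hf.memLp hφ).integrable one_le_two

theorem MemDom.of_measure_le {f g h : H} (hf : E.MemDom φ f) (hg : E.MemDom φ g)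
    (hle : E.measure h ≤ (2 : ℝ≥0∞) • (E.measure f + E.measure g)) : E.MemDom φ h := by
  refine lt_of_le_of_lt (lintegral_mono' hle le_rfl) ?_
  rw [lintegral_smul_measure, lintegral_add_measure]
  exact ENNReal.mul_lt_top (by simp) (ENNReal.add_lt_top.2 ⟨hf, hg⟩)

theorem MemDom.add {f g : H} (hf : E.MemDom φ f) (hg : E.MemDom φ g) : E.MemDom φ (f + g) :=
  hf.of_measure_le hg (E.measure_add_le f g)

theorem MemDom.sub {f g : H} (hf : E.MemDom φ f) (hg : E.MemDom φ g) : E.MemDom φ (f - g) :=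
  hf.of_measure_le hg (E.measure_sub_le f g)

theorem Bdd.hasValue_iff (hφ : E.Bdd φ) {f g : H} : E.HasValue φ f g ↔ g = E.op φ f := by
  constructor
  · intro hfg
    refine ext_inner_right ℝ fun h => ?_
    rw [hfg.2 h (hφ.memDom h), hφ.inner_op]
  · rintro rfl
    exact ⟨hφ.memDom f, fun h _ => hφ.inner_op f h⟩

theorem Bdd.hasValue_op (hφ : E.Bdd φ) (hφ_nonneg : ∀ f, 0 ≤ᵐ[E.measure f] φ) (hψ : Measurable ψ)
    (hψφ : E.Bdd fun l => ψ l * φ l) (f : H) :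
    E.HasValue ψ (E.op φ f) (E.op (fun l => ψ l * φ l) f) := by
  have hdom : E.MemDom ψ (E.op φ f) := by
    have hφm := hφ.1
    rw [MemDom, hφ.measure_op, lintegral_withDensity_eq_lintegral_mul _ (by fun_prop) (by fun_prop)]
    refine lt_of_le_of_lt (lintegral_mono fun l => ?_) (hψφ.memDom f)
    rw [Pi.mul_apply, ← ENNReal.ofReal_mul (sq_nonneg _), ← mul_pow, mul_comm]
  refine ⟨hdom, fun h hh => ?_⟩
  rw [hψφ.inner_op, hφ.weakIntegral_op_left hφ_nonneg hψφ.integrable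
    ((hdom.add hh).integrable hψ) ((hdom.sub hh).integrable hψ)]

theorem tendsto_op {ι : Type*} {L : Filter ι} [L.IsCountablyGenerated] {φ : ι → ℝ → ℝ} {C : ℝ}
    {f : H} (hφ : ∀ i, E.Bdd (φ i)) (hψ : E.Bdd ψ)
    (hC : ∀ᶠ i in L, ∀ᵐ l ∂(E.measure f), |φ i l| ≤ C)
    (hlim : ∀ᵐ l ∂(E.measure f), Tendsto (fun i => φ i l) L (𝓝 (ψ l))) :
    Tendsto (fun i => E.op (φ i) f) L (𝓝 (E.op ψ f)) := by
  obtain ⟨D, hD⟩ := hψ.2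
  have hint : Tendsto (fun i => ∫ l, (φ i l - ψ l) ^ 2 ∂(E.measure f)) L
      (𝓝 (∫ _, 0 ∂(E.measure f))) := by
    refine tendsto_integral_filter_of_dominated_convergence (fun _ => (C + D) ^ 2)
      (Eventually.of_forall fun i => (((hφ i).1.sub hψ.1).pow_const 2).aestronglyMeasurable)
      ?_ (integrable_const _) ?_
    · filter_upwards [hC] with i hi
      filter_upwards [hi, hD f] with l hCl hDl
      rw [norm_pow, Real.norm_eq_abs]
      exact pow_le_pow_left₀ (abs_nonneg _) ((abs_sub _ _).trans (add_le_add hCl hDl)) 2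
    · filter_upwards [hlim] with l hl
      simpa using (hl.sub_const (ψ l)).pow 2
  have hsqrt := (Real.continuous_sqrt.tendsto _).comp hint
  rw [integral_zero, Real.sqrt_zero] at hsqrt
  rw [tendsto_iff_norm_sub_tendsto_zero]
  refine hsqrt.congr fun i => ?_
  rw [Function.comp_apply, ← ((hφ i).sub hψ).norm_op_sq, (hφ i).op_sub hψ, sub_apply,
    Real.sqrt_sq (norm_nonneg _)]

theorem MemDom.tendsto_setIntegral_Ioi_sq (hφ : Measurable φ) {f : H} (hf : E.MemDom φ f) :
    Tendsto (fun n : ℕ => ∫ l in Ioi (n : ℝ), φ l ^ 2 ∂(E.measure f)) atTop (𝓝 0) := by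
  have hanti : Antitone fun n : ℕ => Ioi (n : ℝ) := fun m n hmn =>
    Ioi_subset_Ioi (Nat.cast_le.2 hmn)
  have hinter : ⋂ n : ℕ, Ioi (n : ℝ) = ∅ := by
    refine eq_empty_of_forall_notMem fun l hl => ?_
    obtain ⟨n, hn⟩ := exists_nat_ge l
    exact hn.not_gt (mem_iInter.1 hl n)
  simpa only [hinter, setIntegral_empty] using
    tendsto_setIntegral_of_antitone (fun _ => measurableSet_Ioi) hanti
      ⟨0, (hf.memLp hφ).integrable_sq.integrableOn⟩

theorem MemDom.cauchySeq_op_indicator_Iic (hφ : Measurable φ)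
    (hbdd : ∀ a, E.Bdd ((Iic a).indicator φ)) {f : H} (hf : E.MemDom φ f) :
    CauchySeq fun n : ℕ => E.op ((Iic (n : ℝ)).indicator φ) f := by
  refine cauchySeq_of_le_tendsto_0 (fun n : ℕ => √(∫ l in Ioi (n : ℝ), φ l ^ 2 ∂(E.measure f)))
    (fun n m N hn hm => ?_) (by
      simpa only [Real.sqrt_zero] using!
        (Real.continuous_sqrt.tendsto 0).comp (hf.tendsto_setIntegral_Ioi_sq hφ))
  have hn' : (N : ℝ) ≤ n := Nat.cast_le.2 hn
  have hm' : (N : ℝ) ≤ m := Nat.cast_le.2 hm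
  rw [dist_eq_norm, ← sub_apply, ← (hbdd n).op_sub (hbdd m)]
  refine Real.le_sqrt_of_sq_le ?_
  rw [((hbdd n).sub (hbdd m)).norm_op_sq, ← integral_indicator measurableSet_Ioi]
  refine integral_mono_of_nonneg (Eventually.of_forall fun l => sq_nonneg _)
    ((hf.memLp hφ).integrable_sq.indicator measurableSet_Ioi) (Eventually.of_forall fun l => ?_)
  simp only [indicator, mem_Iic, mem_Ioi]
  split_ifs <;> nlinarith [sq_nonneg (φ l)]

end ResolutionOfIdentity

/-! ### Non-negative resolutions of the identity and Bessel potentials -/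

theorem abs_inv_mul_sub_le_of_hasDerivAt {ψ ψ' : ℝ → ℝ} {r s t C : ℝ}
    (hψ : ∀ x ∈ Metric.ball t r, HasDerivAt ψ (ψ' x) x) (hC : ∀ x ∈ Metric.ball t r, |ψ' x| ≤ C)
    (hs : s ∈ Metric.ball t r) (hst : s ≠ t) : |(s - t)⁻¹ * (ψ s - ψ t)| ≤ C := by
  have hmv : ‖ψ s - ψ t‖ ≤ C * ‖s - t‖ :=
    (convex_ball t r).norm_image_sub_le_of_norm_hasDerivWithin_le
      (fun x hx => (hψ x hx).hasDerivWithinAt) hC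
      (Metric.mem_ball_self (Metric.pos_of_mem_ball hs)) hs
  rw [abs_mul, abs_inv, inv_mul_le_iff₀ (abs_pos.2 (sub_ne_zero.2 hst)), mul_comm]
  exact hmv

namespace ResolutionOfIdentity

variable {H : Type*} [NormedAddCommGroup H] [InnerProductSpace ℝ H] [CompleteSpace H]
  {E : ResolutionOfIdentity H}

variable (E) in
/-- The resolution of the identity is supported in `[0, ∞)`. -/
def Nonneg : Prop := ∀ a < 0, E.proj a = 0

theorem Nonneg.ae_nonneg (hE : E.Nonneg) (f : H) : ∀ᵐ l ∂(E.measure f), 0 ≤ l := by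
  rw [ae_iff]
  refine measure_mono_null (t := ⋃ n : ℕ, Iic (-(1 / ((n : ℝ) + 1)))) ?_ ?_
  · intro l hl
    simp only [not_le, mem_ofPred_eq] at hl
    obtain ⟨n, hn⟩ := exists_nat_one_div_lt (neg_pos.2 hl)
    exact mem_iUnion.2 ⟨n, by simp only [mem_Iic]; linarith⟩
  · refine measure_iUnion_null fun n => ?_
    rw [measure_Iic, hE _ (neg_neg_of_pos (by positivity))]
    simp

theorem Bdd.indicator_Ioc (a b : ℝ) : E.Bdd ((Ioc a b).indicator 1) := by
  refine .of_forall (C := 1) (measurable_one.indicator measurableSet_Ioc) fun l => ?_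
  by_cases hl : l ∈ Ioc a b <;> simp [hl]

theorem proj_sub_proj_eq_op {a b : ℝ} (hab : a ≤ b) (g : H) :
    E.proj b g - E.proj a g = E.op ((Ioc a b).indicator 1) g := by
  rw [← op_indicator_Iic, ← op_indicator_Iic, ← sub_apply,
    ← (Bdd.indicator_Iic b).op_sub (Bdd.indicator_Iic a)]
  congr 2
  funext l
  simp only [indicator, mem_Ioc, mem_Iic, Pi.one_apply]
  grind

theorem ae_mem_Ioc_measure_op (a b : ℝ) (g : H) :
    ∀ᵐ l ∂(E.measure (E.op ((Ioc a b).indicator 1) g)), l ∈ Ioc a b := by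
  have hmeas := (Bdd.indicator_Ioc (E := E) a b).1
  rw [(Bdd.indicator_Ioc a b).measure_op, ae_withDensity_iff (by fun_prop)]
  refine Eventually.of_forall fun l hl => ?_
  by_contra hl'
  simp [hl'] at hl

theorem hasValue_id_op_indicator_Ioc (a b : ℝ) (g : H) :
    E.HasValue (fun l => l) (E.op ((Ioc a b).indicator 1) g)
      (E.op (fun l => l * (Ioc a b).indicator 1 l) g) := by
  refine (Bdd.indicator_Ioc a b).hasValue_op (fun f => Eventually.of_forall fun l => ?_)
    measurable_id' (.of_forall (C := max |a| |b|) ?_ fun l => ?_) g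
  · exact indicator_nonneg (fun _ _ => zero_le_one) l
  · exact measurable_id.mul (measurable_one.indicator measurableSet_Ioc)
  · by_cases hl : l ∈ Ioc a b
    · simpa [hl] using abs_le_max_abs_abs hl.1.le hl.2
    · simp [hl]

theorem IsResolutionOf.integral_id_nonneg {A : H →ₗ.[ℝ] H} (hE : E.IsResolutionOf A)
    (hA : IsNonneg A) {f k : H} (hf : E.HasValue (fun l => l) f k) :
    0 ≤ ∫ l, l ∂(E.measure f) := by
  obtain ⟨y, hyf, hyk⟩ := (LinearPMap.mem_graph_iff A).1 ((hE f k).2 hf)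
  have hy := hA y
  rwa [hyk, hyf, hf.2 f hf.1, weakIntegral_self] at hy

theorem IsResolutionOf.proj_eq_proj {A : H →ₗ.[ℝ] H} (hE : E.IsResolutionOf A)
    (hA : IsNonneg A) {a b : ℝ} (hab : a ≤ b) (hb : b < 0) (g : H) : E.proj b g = E.proj a g := by
  have hvalue := hasValue_id_op_indicator_Ioc (E := E) a b g
  rw [← sub_eq_zero, proj_sub_proj_eq_op hab]
  set f := E.op ((Ioc a b).indicator 1) g
  have hle : ∫ l, l ∂(E.measure f) ≤ ∫ _, b ∂(E.measure f) := by
    refine integral_mono_ae (hvalue.1.integrable measurable_id') (integrable_const b) ?_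
    filter_upwards [ae_mem_Ioc_measure_op a b g] with l hl using hl.2
  rw [integral_const, real_measure_univ, smul_eq_mul] at hle
  have hnonneg := hE.integral_id_nonneg hA hvalue
  exact norm_eq_zero.1 (pow_eq_zero_iff two_ne_zero |>.1
    (le_antisymm (by nlinarith [sq_nonneg ‖f‖]) (sq_nonneg ‖f‖)))

theorem IsResolutionOf.nonneg {A : H →ₗ.[ℝ] H} (hE : E.IsResolutionOf A) (hA : IsNonneg A) :
    E.Nonneg := by
  intro b hb
  ext1 g
  refine tendsto_nhds_unique (tendsto_const_nhds.congr' ?_) (E.tendsto_atBot g)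
  filter_upwards [eventually_le_atBot b] with a ha
  exact hE.proj_eq_proj hA ha hb g

section BoundedSymbols

variable {φ ψ : ℝ → ℝ}

theorem Nonneg.bdd (hE : E.Nonneg) (hφ : Measurable φ) {C : ℝ} (hC : ∀ l, 0 ≤ l → |φ l| ≤ C) :
    E.Bdd φ :=
  ⟨hφ, C, fun f => (hE.ae_nonneg f).mono hC⟩

theorem Nonneg.norm_op_le (hE : E.Nonneg) (hφ : Measurable φ) {C : ℝ}
    (hC : ∀ l, 0 ≤ l → |φ l| ≤ C) : ‖E.op φ‖ ≤ C :=
  (hE.bdd hφ hC).norm_op_le ((abs_nonneg _).trans (hC 0 le_rfl))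
    fun f => (hE.ae_nonneg f).mono hC

theorem Nonneg.op_congr (hE : E.Nonneg) (hφψ : ∀ l, 0 ≤ l → φ l = ψ l) : E.op φ = E.op ψ :=
  ResolutionOfIdentity.op_congr fun f => (hE.ae_nonneg f).mono hφψ

end BoundedSymbols

section SymbolFamilies

variable {φ φ' : ℝ → ℝ → ℝ} {b : ℝ → ℝ}

theorem Nonneg.continuous_op (hE : E.Nonneg) (hφ : ∀ t, Measurable (φ t)) (hb : Continuous b)
    (hφb : ∀ t l, 0 ≤ l → |φ t l| ≤ b t) (hc : ∀ l, 0 ≤ l → Continuous fun t => φ t l) (f : H) :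
    Continuous fun t => E.op (φ t) f := by
  have hbdd : ∀ t, E.Bdd (φ t) := fun t => hE.bdd (hφ t) (hφb t)
  refine continuous_iff_continuousAt.2 fun t => tendsto_op (C := b t + 1) hbdd (hbdd t) ?_
    ((hE.ae_nonneg f).mono fun l hl => (hc l hl).continuousAt)
  filter_upwards [hb.continuousAt.eventually_lt_const (lt_add_one (b t))] with s hs
  exact (hE.ae_nonneg f).mono fun l hl => (hφb s l hl).trans hs.le

theorem Nonneg.hasDerivAt_op (hE : E.Nonneg) (hφ : ∀ t, E.Bdd (φ t))
    (hφ' : ∀ t, Measurable (φ' t)) (hb : Continuous b) (hφb : ∀ t l, 0 ≤ l → |φ' t l| ≤ b t)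
    (hd : ∀ t l, HasDerivAt (fun t => φ t l) (φ' t l) t) (f : H) (t : ℝ) :
    HasDerivAt (fun t => E.op (φ t) f) (E.op (φ' t) f) t := by
  have hslope : Tendsto (fun s => E.op (fun l => (s - t)⁻¹ * (φ s l - φ t l)) f) (𝓝[≠] t)
      (𝓝 (E.op (φ' t) f)) := by
    obtain ⟨r, hr, hball⟩ := Metric.eventually_nhds_iff_ball.1
      (hb.continuousAt.eventually_lt_const (lt_add_one (b t)))
    refine tendsto_op (C := b t + 1) (fun s => (Bdd.const _).mul ((hφ s).sub (hφ t)))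
      (hE.bdd (hφ' t) (hφb t)) ?_ (Eventually.of_forall fun l => by
        simpa [slope_fun_def] using hasDerivAt_iff_tendsto_slope.1 (hd t l))
    filter_upwards [self_mem_nhdsWithin, mem_nhdsWithin_of_mem_nhds (Metric.ball_mem_nhds t hr)]
      with s hst hs
    exact (hE.ae_nonneg f).mono fun l hl =>
      abs_inv_mul_sub_le_of_hasDerivAt (fun x _ => hd x l)
        (fun x hx => (hφb x l hl).trans (hball x hx).le) hs hst
  refine hasDerivAt_iff_tendsto_slope.2 (hslope.congr fun s => ?_)
  rw [((hφ s).sub (hφ t)).op_const_mul, (hφ s).op_sub (hφ t), slope_def_module, smul_apply,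
    sub_apply]

end SymbolFamilies

/-- The symbol of `(I + A)^{1/2}`. -/
def sobolevSymbol (l : ℝ) : ℝ := (1 + l) ^ ((1 : ℝ) / 2)

/-- The symbol of `(I + A)^{-1/2}`. -/
def besselSymbol (l : ℝ) : ℝ := (1 + l) ^ (-(1 / 2) : ℝ)

theorem measurable_sobolevSymbol : Measurable sobolevSymbol := by
  unfold sobolevSymbol
  fun_prop

theorem measurable_besselSymbol : Measurable besselSymbol := by
  unfold besselSymbol
  fun_prop

theorem sobolevSymbol_pos {l : ℝ} (hl : 0 ≤ l) : 0 < sobolevSymbol l :=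
  Real.rpow_pos_of_pos (by linarith) _

theorem sobolevSymbol_sq {l : ℝ} (hl : 0 ≤ l) : sobolevSymbol l ^ 2 = 1 + l := by
  rw [sobolevSymbol, ← Real.rpow_natCast, ← Real.rpow_mul (by linarith)]
  norm_num

theorem besselSymbol_eq {l : ℝ} (hl : 0 ≤ l) : besselSymbol l = (sobolevSymbol l)⁻¹ := by
  rw [besselSymbol, sobolevSymbol, Real.rpow_neg (by linarith)]

theorem besselSymbol_nonneg {l : ℝ} (hl : 0 ≤ l) : 0 ≤ besselSymbol l :=
  Real.rpow_nonneg (by linarith) _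

theorem sobolevSymbol_mul_besselSymbol {l : ℝ} (hl : 0 ≤ l) :
    sobolevSymbol l * besselSymbol l = 1 := by
  rw [besselSymbol_eq hl, mul_inv_cancel₀ (sobolevSymbol_pos hl).ne']

theorem one_le_sobolevSymbol {l : ℝ} (hl : 0 ≤ l) : 1 ≤ sobolevSymbol l :=
  Real.one_le_rpow (by linarith) (by norm_num)

theorem abs_besselSymbol_le {l : ℝ} (hl : 0 ≤ l) : |besselSymbol l| ≤ 1 := by
  rw [abs_of_nonneg (besselSymbol_nonneg hl), besselSymbol_eq hl]
  exact inv_le_one_of_one_le₀ (one_le_sobolevSymbol hl)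

theorem Nonneg.bdd_besselSymbol (hE : E.Nonneg) : E.Bdd besselSymbol :=
  hE.bdd measurable_besselSymbol fun _ => abs_besselSymbol_le

variable (E) in
/-- The bounded operator `(I + A)^{-1/2}`. -/
def bessel : H →L[ℝ] H := E.op besselSymbol

theorem Nonneg.bdd_indicator_Iic_sobolevSymbol (hE : E.Nonneg) (a : ℝ) :
    E.Bdd ((Iic a).indicator sobolevSymbol) := by
  refine hE.bdd (C := |sobolevSymbol a|) (measurable_sobolevSymbol.indicator measurableSet_Iic)
    fun l hl => ?_
  by_cases hla : l ≤ a
  · rw [indicator_of_mem (mem_Iic.2 hla), abs_of_pos (sobolevSymbol_pos hl),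
      abs_of_pos (sobolevSymbol_pos (hl.trans hla))]
    exact Real.rpow_le_rpow (by linarith) (by linarith) (by norm_num)
  · simp [hla]

theorem Nonneg.bessel_op_indicator_Iic (hE : E.Nonneg) (a : ℝ) (f : H) :
    E.bessel (E.op ((Iic a).indicator sobolevSymbol) f) = E.proj a f := by
  rw [bessel, hE.bdd_besselSymbol.op_mul (hE.bdd_indicator_Iic_sobolevSymbol a),
    ← op_indicator_Iic]
  congr 1
  refine hE.op_congr fun l hl => ?_
  by_cases hla : l ≤ a
  · simp [hla, mul_comm (besselSymbol l), sobolevSymbol_mul_besselSymbol hl]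
  · simp [hla]

theorem Nonneg.op_indicator_Iic_bessel (hE : E.Nonneg) (a : ℝ) (f : H) :
    E.op ((Iic a).indicator sobolevSymbol) (E.bessel f) = E.proj a f := by
  have hbdd := hE.bdd_indicator_Iic_sobolevSymbol a
  rw [← hE.bessel_op_indicator_Iic, bessel, hE.bdd_besselSymbol.op_mul hbdd,
    hbdd.op_mul hE.bdd_besselSymbol]
  simp only [mul_comm]

theorem Nonneg.bessel_injective (hE : E.Nonneg) : Function.Injective E.bessel := by
  refine (injective_iff_map_eq_zero _).2 fun f hf => ?_
  refine tendsto_nhds_unique (E.tendsto_atTop f) (tendsto_const_nhds.congr fun a => ?_)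
  rw [← hE.op_indicator_Iic_bessel, hf, map_zero]

theorem Nonneg.hasValue_bessel (hE : E.Nonneg) (g : H) :
    E.HasValue sobolevSymbol (E.bessel g) g := by
  have hone : ∀ f : H, (fun l => sobolevSymbol l * besselSymbol l) =ᵐ[E.measure f] fun _ => 1 :=
    fun f => (hE.ae_nonneg f).mono fun l hl => sobolevSymbol_mul_besselSymbol hl
  have hbdd : E.Bdd fun l => sobolevSymbol l * besselSymbol l :=
    ⟨measurable_sobolevSymbol.mul measurable_besselSymbol, 1, fun f =>
      (hone f).mono fun l hl => by rw [hl, abs_one]⟩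
  have hvalue := hE.bdd_besselSymbol.hasValue_op
    (fun f => (hE.ae_nonneg f).mono fun l hl => besselSymbol_nonneg hl)
    measurable_sobolevSymbol hbdd g
  rwa [ResolutionOfIdentity.op_congr hone, op_one, one_apply_eq_self] at hvalue

theorem Nonneg.exists_bessel_eq (hE : E.Nonneg) {f : H} (hf : E.MemDom sobolevSymbol f) :
    ∃ g, E.bessel g = f := by
  obtain ⟨g, hg⟩ := cauchySeq_tendsto_of_complete (hf.cauchySeq_op_indicator_Iic
    measurable_sobolevSymbol hE.bdd_indicator_Iic_sobolevSymbol)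
  refine ⟨g, tendsto_nhds_unique ((E.bessel.continuous.tendsto g).comp hg) ?_⟩
  refine ((E.tendsto_atTop f).comp tendsto_natCast_atTop_atTop).congr fun n => ?_
  simp only [Function.comp, hE.bessel_op_indicator_Iic]

theorem Nonneg.hasValue_bessel_iff (hE : E.Nonneg) {g g' : H} :
    E.HasValue sobolevSymbol (E.bessel g) g' ↔ g' = g := by
  refine ⟨fun hg' => ?_, fun h => h ▸ hE.hasValue_bessel g'⟩
  refine hE.bessel_injective (ext_inner_right ℝ fun k => ?_)
  have hk := (hE.hasValue_bessel k).1
  rw [bessel, hE.bdd_besselSymbol.inner_op_left, hE.bdd_besselSymbol.inner_op_left, ← bessel,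
    hg'.2 _ hk, (hE.hasValue_bessel g).2 _ hk]

end ResolutionOfIdentity

section Operators

open ResolutionOfIdentity

variable {H : Type*} [NormedAddCommGroup H] [InnerProductSpace ℝ H] [CompleteSpace H]
  {A : H →ₗ.[ℝ] H}

theorem spectralResolution_nonneg (hA : IsNonneg A) : (spectralResolution A).Nonneg := by
  unfold spectralResolution
  split_ifs with hres
  · exact hres.choose_spec.nonneg hA
  · exact fun a ha => if_neg (not_le.2 ha)

theorem opFun_eq_op {φ : ℝ → ℝ} (hφ : (spectralResolution A).Bdd φ) (f : H) :
    opFun A φ f = (spectralResolution A).op φ f := by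
  have hvalue : ∃ g, (spectralResolution A).HasValue φ f g := ⟨_, hφ.hasValue_iff.2 rfl⟩
  rw [opFun, dif_pos hvalue]
  exact hφ.hasValue_iff.1 hvalue.choose_spec

theorem memSobolev_one_iff (hE : (spectralResolution A).Nonneg) {f : H} :
    MemSobolev A 1 f ↔ ∃ g, (spectralResolution A).bessel g = f := by
  refine ⟨hE.exists_bessel_eq, ?_⟩
  rintro ⟨g, rfl⟩
  exact (hE.hasValue_bessel g).1

theorem sobolevNorm_one_bessel (hE : (spectralResolution A).Nonneg) (g : H) :
    sobolevNorm A 1 ((spectralResolution A).bessel g) = ‖g‖ := by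
  have hvalue : ∃ k, (spectralResolution A).HasValue sobolevSymbol
      ((spectralResolution A).bessel g) k := ⟨g, hE.hasValue_bessel g⟩
  have heq : opFun A sobolevSymbol ((spectralResolution A).bessel g) = g := by
    rw [opFun, dif_pos hvalue]
    exact hE.hasValue_bessel_iff.1 hvalue.choose_spec
  exact congrArg norm heq

end Operators

/-! ### Subordination to the heat semigroup -/

namespace ResolutionOfIdentity

variable {H : Type*} [NormedAddCommGroup H] [InnerProductSpace ℝ H] [CompleteSpace H]
  {E : ResolutionOfIdentity H}

variable (E) in
/-- The heat semigroup `e^{-tA}`, for `t ≥ 0`, of the operator `A` resolved by `E`. -/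
def heatOp (t : ℝ) : H →L[ℝ] H := E.op fun l => Real.exp (-(t * l))

theorem abs_exp_neg_mul_le {t l : ℝ} (ht : 0 ≤ t) (hl : 0 ≤ l) :
    |Real.exp (-(t * l))| ≤ 1 := by
  rw [Real.abs_exp]
  exact Real.exp_le_one_iff.2 (by nlinarith)

theorem Nonneg.bdd_heat (hE : E.Nonneg) {t : ℝ} (ht : 0 ≤ t) :
    E.Bdd fun l => Real.exp (-(t * l)) :=
  hE.bdd (by fun_prop) fun _ hl => abs_exp_neg_mul_le ht hl

theorem Nonneg.norm_heatOp_apply_le (hE : E.Nonneg) {t : ℝ} (ht : 0 ≤ t) (f : H) :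
    ‖E.heatOp t f‖ ≤ ‖f‖ := by
  have h : ‖E.heatOp t‖ ≤ 1 :=
    hE.norm_op_le (by fun_prop) fun _ hl => abs_exp_neg_mul_le ht hl
  simpa using (E.heatOp t).le_of_opNorm_le h f

theorem Nonneg.continuous_heatOp_max (hE : E.Nonneg) (f : H) :
    Continuous fun t => E.heatOp (max t 0) f := by
  exact hE.continuous_op (φ := fun t l => Real.exp (-(max t 0 * l))) (fun t => by fun_prop)
    continuous_const (fun t l hl => abs_exp_neg_mul_le (le_max_right t 0) hl)
    (fun _ _ => by fun_prop) f

theorem Nonneg.integrableOn_smul_heatOp (hE : E.Nonneg) {w : ℝ → ℝ} {s : Set ℝ} (hs : s ⊆ Ioi 0)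
    (hsm : MeasurableSet s) (hw : IntegrableOn w s) (f : H) :
    IntegrableOn (fun t => w t • E.heatOp t f) s := by
  have hheat : AEStronglyMeasurable (fun t => E.heatOp t f) (volume.restrict s) := by
    refine (hE.continuous_heatOp_max f).aestronglyMeasurable.congr ?_
    filter_upwards [ae_restrict_mem hsm] with t ht
    rw [max_eq_left (mem_Ioi.1 (hs ht)).le]
  refine Integrable.mono' (hw.norm.mul_const ‖f‖) (hw.aestronglyMeasurable.smul hheat) ?_
  filter_upwards [ae_restrict_mem hsm] with t ht
  rw [norm_smul]
  exact mul_le_mul_of_nonneg_left (hE.norm_heatOp_apply_le (mem_Ioi.1 (hs ht)).le f)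
    (norm_nonneg _)

/-- The weight of the subordination formula `(I + A)^{-1/2} = ∫₀^∞ w(t) e^{-tA} dt`. -/
def besselWeight (t : ℝ) : ℝ := (Real.Gamma (1 / 2))⁻¹ * (Real.exp (-t) * t ^ ((1 / 2 : ℝ) - 1))

theorem gamma_half_pos : 0 < Real.Gamma (1 / 2) := Real.Gamma_pos_of_pos (by norm_num)

theorem besselWeight_pos {t : ℝ} (ht : 0 < t) : 0 < besselWeight t := by
  have := gamma_half_pos
  unfold besselWeight
  positivity

theorem integrableOn_besselWeight : IntegrableOn besselWeight (Ioi 0) :=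
  (Real.GammaIntegral_convergent (by norm_num)).const_mul _

theorem integral_besselWeight_mul_exp {l : ℝ} (hl : 0 ≤ l) :
    ∫ t in Ioi 0, besselWeight t * Real.exp (-(t * l)) = besselSymbol l := by
  have hgamma := Real.integral_rpow_mul_exp_neg_mul_Ioi (a := 1 / 2) (r := 1 + l) (by norm_num)
    (by linarith)
  have hintegrand : ∀ t : ℝ, besselWeight t * Real.exp (-(t * l)) =
      (Real.Gamma (1 / 2))⁻¹ * (t ^ ((1 / 2 : ℝ) - 1) * Real.exp (-((1 + l) * t))) := by
    intro t
    rw [besselWeight, show -((1 + l) * t) = -t + -(t * l) by ring, Real.exp_add]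
    ring
  simp only [hintegrand]
  rw [integral_const_mul, hgamma, mul_comm, mul_assoc, mul_inv_cancel₀ gamma_half_pos.ne', mul_one,
    besselSymbol, one_div, Real.inv_rpow (by linarith), Real.rpow_neg (by linarith)]

theorem integral_besselWeight_mul_integral_exp {m : Measure ℝ} [IsFiniteMeasure m]
    (hm : ∀ᵐ l ∂m, 0 ≤ l) :
    Integrable (fun t => besselWeight t * ∫ l, Real.exp (-(t * l)) ∂m) (volume.restrict (Ioi 0)) ∧
    ∫ t in Ioi 0, besselWeight t * ∫ l, Real.exp (-(t * l)) ∂m = ∫ l, besselSymbol l ∂m := by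
  have hint : Integrable (fun z : ℝ × ℝ => besselWeight z.1 * Real.exp (-(z.1 * z.2)))
      ((volume.restrict (Ioi 0)).prod m) := by
    refine (integrableOn_besselWeight.integrable.mul_prod
      (integrable_const (μ := m) (1 : ℝ))).mono ?_ ?_
    · refine AEStronglyMeasurable.mul ?_ ?_
      · exact integrableOn_besselWeight.aestronglyMeasurable.comp_fst
      · exact (by fun_prop : Continuous fun z : ℝ × ℝ =>
          Real.exp (-(z.1 * z.2))).aestronglyMeasurable
    · have hfst : ∀ᵐ z ∂((volume.restrict (Ioi (0 : ℝ))).prod m), z.1 ∈ Ioi (0 : ℝ) :=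
        Measure.quasiMeasurePreserving_fst.ae (ae_restrict_mem measurableSet_Ioi)
      have hsnd : ∀ᵐ z ∂((volume.restrict (Ioi (0 : ℝ))).prod m), 0 ≤ z.2 :=
        Measure.quasiMeasurePreserving_snd.ae hm
      filter_upwards [hfst, hsnd] with z hz1 hz2
      rw [norm_mul, norm_mul, norm_one, Real.norm_eq_abs (Real.exp _)]
      gcongr
      exact abs_exp_neg_mul_le (mem_Ioi.1 hz1).le hz2
  refine ⟨?_, ?_⟩
  · simpa only [integral_const_mul] using hint.integral_prod_left
  · calc ∫ t in Ioi 0, besselWeight t * ∫ l, Real.exp (-(t * l)) ∂m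
        = ∫ t in Ioi 0, ∫ l, besselWeight t * Real.exp (-(t * l)) ∂m := by
          simp only [integral_const_mul]
      _ = ∫ l, (∫ t in Ioi 0, besselWeight t * Real.exp (-(t * l))) ∂m :=
          integral_integral_swap hint
      _ = ∫ l, besselSymbol l ∂m := by
          refine integral_congr_ae ?_
          filter_upwards [hm] with l hl using integral_besselWeight_mul_exp hl

theorem Nonneg.bessel_eq_integral (hE : E.Nonneg) (f : H) :
    E.bessel f = ∫ t in Ioi 0, besselWeight t • E.heatOp t f := by
  have hint := hE.integrableOn_smul_heatOp Subset.rfl measurableSet_Ioi integrableOn_besselWeight f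
  refine ext_inner_left ℝ fun h => ?_
  rw [← integral_inner hint, real_inner_comm, bessel, hE.bdd_besselSymbol.inner_op, weakIntegral]
  obtain ⟨hint_add, hadd⟩ := integral_besselWeight_mul_integral_exp (hE.ae_nonneg (f + h))
  obtain ⟨hint_sub, hsub⟩ := integral_besselWeight_mul_integral_exp (hE.ae_nonneg (f - h))
  rw [← hadd, ← hsub, ← integral_sub hint_add hint_sub, ← integral_const_mul]
  refine setIntegral_congr_fun measurableSet_Ioi fun t ht => ?_
  simp only [real_inner_smul_right]
  rw [heatOp, real_inner_comm, (hE.bdd_heat (mem_Ioi.1 ht).le).inner_op, weakIntegral]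
  ring

theorem integrableOn_besselWeight_mul_rpow {κ : ℝ} (hκ : κ < 1 / 2) :
    IntegrableOn (fun t => besselWeight t * t ^ (-κ)) (Ioi 0) := by
  have hgamma := (Real.GammaIntegral_convergent (s := 1 / 2 - κ) (by linarith)).const_mul
    (Real.Gamma (1 / 2))⁻¹
  refine IntegrableOn.congr_fun hgamma (fun t ht => ?_) measurableSet_Ioi
  simp only [besselWeight]
  rw [mul_assoc, mul_assoc, ← Real.rpow_add (mem_Ioi.1 ht)]
  congr 3
  ring

theorem besselWeight_le {t : ℝ} (ht : 0 < t) :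
    besselWeight t ≤ (Real.Gamma (1 / 2))⁻¹ * t ^ (-(1 / 2) : ℝ) := by
  have := gamma_half_pos
  have hexp : Real.exp (-t) ≤ 1 := Real.exp_le_one_iff.2 (by linarith)
  rw [besselWeight, show (1 / 2 : ℝ) - 1 = -(1 / 2) by norm_num]
  gcongr
  exact mul_le_of_le_one_left (by positivity) hexp

theorem setIntegral_besselWeight_Ioc_le {T : ℝ} (hT : 0 < T) :
    ∫ t in Ioc 0 T, besselWeight t ≤ 2 * (Real.Gamma (1 / 2))⁻¹ * T ^ (1 / 2 : ℝ) := by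
  have hrpow : IntervalIntegrable (fun t : ℝ => t ^ (-(1 / 2) : ℝ)) volume 0 T :=
    intervalIntegral.intervalIntegrable_rpow' (by norm_num)
  calc ∫ t in Ioc 0 T, besselWeight t
      ≤ ∫ t in Ioc 0 T, (Real.Gamma (1 / 2))⁻¹ * t ^ (-(1 / 2) : ℝ) := by
        refine setIntegral_mono_on (integrableOn_besselWeight.mono_set Ioc_subset_Ioi_self)
          ((intervalIntegrable_iff_integrableOn_Ioc_of_le hT.le).1 (hrpow.const_mul _))
          measurableSet_Ioc fun t ht => besselWeight_le ht.1
    _ = _ := by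
        rw [integral_const_mul, ← intervalIntegral.integral_of_le hT.le,
          integral_rpow (Or.inl (by norm_num)), Real.zero_rpow (by norm_num)]
        norm_num
        ring

theorem setIntegral_besselWeight_Ioi_le {T α : ℝ} (hT : 0 < T) (hα : 1 / 2 < α) :
    IntegrableOn (fun t => besselWeight t * t ^ (-α)) (Ioi T) ∧
    ∫ t in Ioi T, besselWeight t * t ^ (-α) ≤
      (Real.Gamma (1 / 2))⁻¹ * (α - 1 / 2)⁻¹ * T ^ (1 / 2 - α) := by
  have hrpow : IntegrableOn (fun t : ℝ => (Real.Gamma (1 / 2))⁻¹ * t ^ (-(1 / 2) - α)) (Ioi T) :=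
    (integrableOn_Ioi_rpow_of_lt (by linarith) hT).const_mul _
  have hle : ∀ t ∈ Ioi T, besselWeight t * t ^ (-α) ≤
      (Real.Gamma (1 / 2))⁻¹ * t ^ (-(1 / 2) - α) := by
    intro t ht
    have ht0 : 0 < t := hT.trans ht
    rw [sub_eq_add_neg, Real.rpow_add ht0, ← mul_assoc]
    exact mul_le_mul_of_nonneg_right (besselWeight_le ht0) (by positivity)
  have hint : IntegrableOn (fun t => besselWeight t * t ^ (-α)) (Ioi T) := by
    refine Integrable.mono' hrpow ?_ ?_
    · refine ((integrableOn_besselWeight.mono_set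
        (Ioi_subset_Ioi hT.le)).aestronglyMeasurable).mul ?_
      exact (by fun_prop : Measurable fun t : ℝ => t ^ (-α)).aestronglyMeasurable
    · filter_upwards [ae_restrict_mem measurableSet_Ioi] with t ht
      rw [Real.norm_of_nonneg (mul_nonneg (besselWeight_pos (hT.trans ht)).le
        (Real.rpow_nonneg (hT.trans ht).le _))]
      exact hle t ht
  refine ⟨hint, (setIntegral_mono_on hint hrpow measurableSet_Ioi hle).trans (le_of_eq ?_)⟩
  rw [integral_const_mul, integral_Ioi_rpow_of_lt (by linarith) hT, mul_assoc]
  congr 1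
  rw [show -(1 / 2) - α + 1 = -(α - 1 / 2) by ring, show 1 / 2 - α = -(α - 1 / 2) by ring,
    neg_div_neg_eq, div_eq_inv_mul]

variable (E) in
/-- The contribution of the times in `s` to the subordination formula for `(I + A)^{-1/2}`. -/
def besselOn (s : Set ℝ) (f : H) : H := ∫ t in s, besselWeight t • E.heatOp t f

theorem Nonneg.besselOn_Ioc_add_besselOn_Ioi (hE : E.Nonneg) {T : ℝ} (hT : 0 ≤ T) (f : H) :
    E.besselOn (Ioc 0 T) f + E.besselOn (Ioi T) f = E.bessel f := by
  have hint := hE.integrableOn_smul_heatOp Subset.rfl measurableSet_Ioi integrableOn_besselWeight f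
  rw [hE.bessel_eq_integral, besselOn, besselOn, ← Ioc_union_Ioi_eq_Ioi hT,
    setIntegral_union Ioc_disjoint_Ioi_same measurableSet_Ioi
      (hint.mono_set Ioc_subset_Ioi_self) (hint.mono_set (Ioi_subset_Ioi hT))]

theorem Nonneg.besselOn_add (hE : E.Nonneg) {s : Set ℝ} (hs0 : s ⊆ Ioi 0) (hs : MeasurableSet s)
    (f g : H) : E.besselOn s (f + g) = E.besselOn s f + E.besselOn s g := by
  have hint := hE.integrableOn_smul_heatOp hs0 hs (integrableOn_besselWeight.mono_set hs0)
  simp only [besselOn, map_add, smul_add]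
  exact integral_add (hint f) (hint g)

end ResolutionOfIdentity

section Sobolev

open ResolutionOfIdentity

variable {X : Type*} [MeasurableSpace X] {μ : Measure X} {A : Lp ℝ 2 μ →ₗ.[ℝ] Lp ℝ 2 μ}
  {E : ResolutionOfIdentity (Lp ℝ 2 μ)}

/-! ### The embedding of `H¹(A)` into `L^q` below the critical exponent -/

theorem heat_eq_heatOp (hE : (spectralResolution A).Nonneg) {t : ℝ} (ht : 0 ≤ t)
    (f : Lp ℝ 2 μ) : heat A t f = (spectralResolution A).heatOp t f :=
  opFun_eq_op (hE.bdd_heat ht) f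

theorem eLpNorm_two_eq (f : Lp ℝ 2 μ) : eLpNorm f 2 μ = ENNReal.ofReal ‖f‖ := by
  rw [← Lp.enorm_def, ofReal_norm]

theorem eLpNorm_besselOn_le (hE : E.Nonneg) {r M : ℝ≥0∞} (hr : 1 ≤ r) {s : Set ℝ}
    (hs0 : s ⊆ Ioi 0) (hs : MeasurableSet s) {w : ℝ → ℝ} (hw : ∀ t ∈ s, 0 < w t)
    (hint : IntegrableOn (fun t => besselWeight t * w t) s) {f : Lp ℝ 2 μ}
    (hf : ∀ t ∈ s, eLpNorm (E.heatOp t f) r μ ≤ ENNReal.ofReal (w t) * M) :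
    eLpNorm (E.besselOn s f) r μ ≤ ENNReal.ofReal (∫ t in s, besselWeight t * w t) * M := by
  refine eLpNorm_integral_le hr
    (hE.integrableOn_smul_heatOp hs0 hs (integrableOn_besselWeight.mono_set hs0) f) hint ?_ ?_
  · filter_upwards [ae_restrict_mem hs] with t ht
    exact mul_pos (besselWeight_pos (hs0 ht)) (hw t ht)
  · filter_upwards [ae_restrict_mem hs] with t ht
    have hpos := besselWeight_pos (hs0 ht)
    rw [eLpNorm_coeFn_smul, Real.enorm_of_nonneg hpos.le, ENNReal.ofReal_mul hpos.le, mul_assoc]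
    gcongr
    exact hf t ht

theorem eLpNorm_heatOp_le_rpow (hE : (spectralResolution A).Nonneg) {α C q t : ℝ} (hq : 2 ≤ q)
    (hC : 0 < C) (ht : 0 < t) {f : Lp ℝ 2 μ}
    (hf : eLpNorm (heat A t f : Lp ℝ 2 μ) ∞ μ ≤ ENNReal.ofReal (C * t ^ (-α)) * eLpNorm f 2 μ) :
    eLpNorm ((spectralResolution A).heatOp t f) (ENNReal.ofReal q) μ ≤
      ENNReal.ofReal (t ^ (-(α * (1 - 2 / q)))) *
        (ENNReal.ofReal (C ^ (1 - 2 / q)) * eLpNorm f 2 μ) := by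
  have hθ : 0 ≤ 1 - 2 / q := by
    rw [sub_nonneg, div_le_one (by linarith)]
    exact hq
  have hcontr : eLpNorm ((spectralResolution A).heatOp t f) 2 μ ≤ eLpNorm f 2 μ := by
    rw [eLpNorm_two_eq, eLpNorm_two_eq]
    exact ENNReal.ofReal_le_ofReal (hE.norm_heatOp_apply_le ht.le f)
  rw [heat_eq_heatOp hE ht.le] at hf
  calc eLpNorm ((spectralResolution A).heatOp t f) (ENNReal.ofReal q) μ
      ≤ eLpNorm ((spectralResolution A).heatOp t f) ∞ μ ^ (1 - 2 / q) *
          eLpNorm ((spectralResolution A).heatOp t f) (ENNReal.ofReal 2) μ ^ (2 / q) :=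
        eLpNorm_le_eLpNorm_top_rpow_mul (Lp.aestronglyMeasurable _) two_pos hq
    _ ≤ (ENNReal.ofReal (C * t ^ (-α)) * eLpNorm f 2 μ) ^ (1 - 2 / q) *
          eLpNorm f 2 μ ^ (2 / q) := by
        rw [ENNReal.ofReal_ofNat]
        gcongr
    _ = _ := by
        rw [ENNReal.mul_rpow_of_nonneg _ _ hθ, mul_assoc,
          ← ENNReal.rpow_add_of_nonneg _ _ hθ (by positivity), sub_add_cancel, ENNReal.rpow_one,
          ENNReal.ofReal_rpow_of_nonneg (by positivity) hθ,
          Real.mul_rpow hC.le (by positivity), ← Real.rpow_mul ht.le,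
          mul_comm (C ^ (1 - 2 / q)), ENNReal.ofReal_mul (by positivity), mul_assoc, neg_mul]

theorem exists_eLpNorm_bessel_le_of_lt (hE : (spectralResolution A).Nonneg) {α q : ℝ}
    (hdecay : HeatDecay A α) (hq : 2 ≤ q) (hαq : α * (1 - 2 / q) < 1 / 2) :
    ∃ C : ℝ, 0 ≤ C ∧ ∀ f : Lp ℝ 2 μ,
      eLpNorm ((spectralResolution A).bessel f) (ENNReal.ofReal q) μ ≤
        ENNReal.ofReal (C * ‖f‖) := by
  obtain ⟨C, hC, hheat⟩ := hdecay
  refine ⟨(∫ t in Ioi 0, besselWeight t * t ^ (-(α * (1 - 2 / q)))) * C ^ (1 - 2 / q), ?_,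
    fun f => ?_⟩
  · refine mul_nonneg (setIntegral_nonneg measurableSet_Ioi fun t ht => ?_) (by positivity)
    exact mul_nonneg (besselWeight_pos ht).le (Real.rpow_nonneg (mem_Ioi.1 ht).le _)
  · have hr : 1 ≤ ENNReal.ofReal q := by
      rw [ENNReal.one_le_ofReal]
      linarith
    rw [hE.bessel_eq_integral]
    refine (eLpNorm_besselOn_le hE hr Subset.rfl measurableSet_Ioi
      (fun t ht => Real.rpow_pos_of_pos ht _) (integrableOn_besselWeight_mul_rpow hαq)
      fun t ht => eLpNorm_heatOp_le_rpow hE hq hC ht (hheat t ht f)).trans_eq ?_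
    rw [eLpNorm_two_eq, ← ENNReal.ofReal_mul (by positivity), ← ENNReal.ofReal_mul' (by positivity),
      mul_assoc]

/-! ### The critical embedding -/

theorem exists_eLpNorm_besselOn_Ioi_le (hE : (spectralResolution A).Nonneg) {α : ℝ}
    (hα : 1 / 2 < α) (hdecay : HeatDecay A α) :
    ∃ C : ℝ, 0 < C ∧ ∀ T, 0 < T → ∀ f : Lp ℝ 2 μ,
      eLpNorm ((spectralResolution A).besselOn (Ioi T) f) ∞ μ ≤
        ENNReal.ofReal (C * T ^ (1 / 2 - α)) * eLpNorm f 2 μ := by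
  obtain ⟨C, hC, hheat⟩ := hdecay
  have := gamma_half_pos
  have : 0 < α - 1 / 2 := by linarith
  refine ⟨(Real.Gamma (1 / 2))⁻¹ * (α - 1 / 2)⁻¹ * C, by positivity, fun T hT f => ?_⟩
  obtain ⟨hint, hweight⟩ := setIntegral_besselWeight_Ioi_le hT hα
  refine (eLpNorm_besselOn_le hE (M := ENNReal.ofReal C * eLpNorm f 2 μ) le_top
    (Ioi_subset_Ioi hT.le) measurableSet_Ioi (fun t ht => Real.rpow_pos_of_pos (hT.trans ht) _)
    hint fun t ht => ?_).trans ?_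
  · have ht0 : 0 < t := hT.trans ht
    rw [← heat_eq_heatOp hE ht0.le, ← mul_assoc, ← ENNReal.ofReal_mul (by positivity), mul_comm _ C]
    exact hheat t ht0 f
  · rw [← mul_assoc, ← ENNReal.ofReal_mul' hC.le, mul_right_comm]
    gcongr

theorem exists_eLpNorm_besselOn_Ioc_le (hE : (spectralResolution A).Nonneg) {α r : ℝ}
    (hα : 1 / 2 < α) (hLq : HeatLqBounds A α) (hr : 4 * α / (4 * α - 1) < r) (hr' : r < 4 * α) :
    ∃ B : ℝ, 0 < B ∧ ∀ T, 0 < T → ∀ f : Lp ℝ 2 μ,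
      eLpNorm ((spectralResolution A).besselOn (Ioc 0 T) f) (ENNReal.ofReal r) μ ≤
        ENNReal.ofReal (B * T ^ (1 / 2 : ℝ)) * eLpNorm f (ENNReal.ofReal r) μ := by
  obtain ⟨C, hC, hheat⟩ := hLq hα r hr hr'
  have := gamma_half_pos
  have hr1 : 1 ≤ r := by
    refine le_trans ?_ hr.le
    rw [le_div_iff₀ (by linarith)]
    linarith
  refine ⟨2 * (Real.Gamma (1 / 2))⁻¹ * C, by positivity, fun T hT f => ?_⟩
  rcases eq_or_ne (eLpNorm f (ENNReal.ofReal r) μ) ∞ with hf | hf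
  · rw [hf, ENNReal.mul_top (ENNReal.ofReal_pos.2 (by positivity)).ne']
    exact le_top
  refine (eLpNorm_besselOn_le hE (w := fun _ => 1)
    (M := ENNReal.ofReal C * eLpNorm f (ENNReal.ofReal r) μ) (ENNReal.one_le_ofReal.2 hr1)
    Ioc_subset_Ioi_self measurableSet_Ioc (fun _ _ => one_pos) ?_ fun t ht => ?_).trans ?_
  · simpa only [mul_one] using integrableOn_besselWeight.mono_set Ioc_subset_Ioi_self
  · rw [← heat_eq_heatOp hE ht.1.le, ENNReal.ofReal_one, one_mul]
    exact (hheat t ht.1 f ⟨Lp.aestronglyMeasurable _, hf.lt_top⟩).1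
  · simp only [mul_one]
    rw [← mul_assoc, ← ENNReal.ofReal_mul' hC.le, mul_right_comm]
    gcongr
    exact setIntegral_besselWeight_Ioc_le hT

/-- The time at which to split the subordination formula when estimating the set `{σ < |u|}`: the
large times then contribute at most `σ / 2`. -/
theorem exists_splitting_time {α C σ : ℝ} (hα : 1 / 2 < α) (hC : 0 < C) (hσ : 0 < σ) :
    ∃ T : ℝ, 0 < T ∧ C * T ^ (1 / 2 - α) = σ / 2 ∧
      T ^ (1 / 2 : ℝ) / σ =
        (2 * C) ^ (1 / (2 * α - 1)) * (σ ^ (2 * α / (2 * α - 1)))⁻¹ := by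
  have hα' : 2 * α - 1 ≠ 0 := by linarith
  refine ⟨(σ / (2 * C)) ^ (-2 / (2 * α - 1)), by positivity, ?_, ?_⟩
  · rw [← Real.rpow_mul (by positivity),
      show -2 / (2 * α - 1) * (1 / 2 - α) = 1 by field_simp; ring, Real.rpow_one]
    field_simp
  · rw [← Real.rpow_mul (by positivity),
      show -2 / (2 * α - 1) * (1 / 2) = -(1 / (2 * α - 1)) by field_simp,
      show 2 * α / (2 * α - 1) = 1 / (2 * α - 1) + 1 by field_simp; ring,
      Real.rpow_neg (by positivity), Real.div_rpow hσ.le (by positivity), Real.rpow_add hσ,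
      Real.rpow_one]
    field_simp

theorem measure_lt_norm_bessel_le (hE : E.Nonneg) {T σ : ℝ} (hT : 0 ≤ T) (hσ : 0 ≤ σ)
    {f f₁ f₂ : Lp ℝ 2 μ} (hf : f = f₁ + f₂)
    (htail : eLpNorm (E.besselOn (Ioi T) f) ∞ μ ≤ ENNReal.ofReal (σ / 2)) :
    μ {x | σ < ‖E.bessel f x‖} ≤
      μ {x | σ / 4 ≤ ‖E.besselOn (Ioc 0 T) f₁ x‖} +
        μ {x | σ / 4 ≤ ‖E.besselOn (Ioc 0 T) f₂ x‖} := by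
  refine le_trans (measure_mono_ae ?_) (measure_union_le _ _)
  have hsplit : E.bessel f =
      E.besselOn (Ioc 0 T) f₁ + E.besselOn (Ioc 0 T) f₂ + E.besselOn (Ioi T) f := by
    rw [← hE.besselOn_Ioc_add_besselOn_Ioi hT,
      ← hE.besselOn_add Ioc_subset_Ioi_self measurableSet_Ioc, ← hf]
  rw [hsplit]
  rw [eLpNorm_exponent_top] at htail
  filter_upwards [enorm_ae_le_eLpNormEssSup (E.besselOn (Ioi T) f) μ,
    Lp.coeFn_add (E.besselOn (Ioc 0 T) f₁ + E.besselOn (Ioc 0 T) f₂) (E.besselOn (Ioi T) f),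
    Lp.coeFn_add (E.besselOn (Ioc 0 T) f₁) (E.besselOn (Ioc 0 T) f₂)]
    with x htail_x hsum hhead (hlarge : σ < ‖_‖)
  have hsmall : ‖E.besselOn (Ioi T) f x‖ ≤ σ / 2 := by
    have hle := htail_x.trans htail
    rwa [← ofReal_norm, ENNReal.ofReal_le_ofReal_iff (by positivity)] at hle
  rw [hsum, Pi.add_apply, hhead, Pi.add_apply] at hlarge
  by_contra hcontra
  obtain ⟨hlt₁, hlt₂⟩ : ¬ σ / 4 ≤ ‖_‖ ∧ ¬ σ / 4 ≤ ‖_‖ := not_or.1 hcontra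
  have htriangle := norm_add₃_le (a := E.besselOn (Ioc 0 T) f₁ x)
    (b := E.besselOn (Ioc 0 T) f₂ x) (c := E.besselOn (Ioi T) f x)
  linarith [not_le.1 hlt₁, not_le.1 hlt₂]

theorem lintegral_norm_rpow_of_ae_eq_indicator {f g : X → ℝ} {S : Set X} (hS : MeasurableSet S)
    (hg : g =ᵐ[μ] S.indicator f) {r : ℝ} (hr : 0 < r) :
    ∫⁻ x, ENNReal.ofReal (‖g x‖ ^ r) ∂μ = ∫⁻ x in S, ENNReal.ofReal (‖f x‖ ^ r) ∂μ := by
  rw [← lintegral_indicator hS]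
  refine lintegral_congr_ae ?_
  filter_upwards [hg] with x hx
  rw [hx]
  by_cases hxS : x ∈ S
  · rw [indicator_of_mem hxS, indicator_of_mem hxS]
  · rw [indicator_of_notMem hxS, indicator_of_notMem hxS, norm_zero, Real.zero_rpow hr.ne',
      ENNReal.ofReal_zero]

theorem measure_le_norm_besselOn_Ioc_le {B T r c s σ : ℝ} (hB : 0 < B) (hT : 0 < T) (hr : 0 < r)
    (hs : 0 < s) (hσ : 0 < σ) (hc : 0 < c) (hTσ : T ^ (1 / 2 : ℝ) / σ = c * s⁻¹) {S : Set X}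
    (hS : MeasurableSet S) {f g : Lp ℝ 2 μ} (hg : g =ᵐ[μ] S.indicator f)
    (hhead : eLpNorm (E.besselOn (Ioc 0 T) g) (ENNReal.ofReal r) μ ≤
      ENNReal.ofReal (B * T ^ (1 / 2 : ℝ)) * eLpNorm g (ENNReal.ofReal r) μ) :
    μ {x | σ / 4 ≤ ‖E.besselOn (Ioc 0 T) g x‖} ≤ ENNReal.ofReal ((4 * B * c) ^ r) *
      (ENNReal.ofReal (s ^ (-r)) * ∫⁻ x in S, ENNReal.ofReal (‖f x‖ ^ r) ∂μ) := by
  have hconst : B * T ^ (1 / 2 : ℝ) / (σ / 4) = 4 * B * c * s⁻¹ := by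
    rw [mul_assoc (4 * B), ← hTσ]
    field_simp
  refine (measure_le_norm_le_of_eLpNorm_le (Lp.aestronglyMeasurable _) hr (by positivity)
    (by positivity) hhead).trans_eq ?_
  rw [hconst, lintegral_norm_rpow_of_ae_eq_indicator hS hg hr,
    Real.mul_rpow (by positivity) (by positivity), Real.inv_rpow hs.le, ← Real.rpow_neg hs.le,
    ENNReal.ofReal_mul (by positivity), mul_assoc]

/-- The bound on the level sets to which Marcinkiewicz interpolation applies: `f` is truncated at
height `s`, and the subordination formula is split at the time provided by
`exists_splitting_time` for `σ = s ^ (1 / γ)`, where `γ = 2 * α / (2 * α - 1)`. -/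
theorem exists_measure_lt_norm_bessel_rpow_le (hE : (spectralResolution A).Nonneg) {α r q : ℝ}
    (hα : 1 / 2 < α) (hdecay : HeatDecay A α) (hLq : HeatLqBounds A α)
    (hr : 4 * α / (4 * α - 1) < r) (hrq : r < q) (hq : q < 4 * α) :
    ∃ K L : ℝ, ∀ f : Lp ℝ 2 μ, ‖f‖ ≤ 1 → ∀ s, 0 < s →
      μ {x | s < ‖(spectralResolution A).bessel f x‖ ^ (2 * α / (2 * α - 1))} ≤
        ENNReal.ofReal K * (ENNReal.ofReal (s ^ (-r)) *
          ∫⁻ x in {x | s < ‖f x‖}, ENNReal.ofReal (‖f x‖ ^ r) ∂μ) +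
        ENNReal.ofReal L * (ENNReal.ofReal (s ^ (-q)) *
          ∫⁻ x in {x | ‖f x‖ ≤ s}, ENNReal.ofReal (‖f x‖ ^ q) ∂μ) := by
  set E := spectralResolution A
  set γ := 2 * α / (2 * α - 1)
  have hγ : 0 < γ := div_pos (by linarith) (by linarith)
  have hr0 : 0 < r := lt_trans (div_pos (by linarith) (by linarith)) hr
  obtain ⟨C, hC, htail⟩ := exists_eLpNorm_besselOn_Ioi_le hE hα hdecay
  obtain ⟨B, hB, hhead_r⟩ := exists_eLpNorm_besselOn_Ioc_le hE hα hLq hr (hrq.trans hq)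
  obtain ⟨D, hD, hhead_q⟩ := exists_eLpNorm_besselOn_Ioc_le hE hα hLq (hr.trans hrq) hq
  set c := (2 * C) ^ (1 / (2 * α - 1))
  refine ⟨(4 * B * c) ^ r, (4 * D * c) ^ q, fun f hf s hs => ?_⟩
  obtain ⟨σ, hσ, rfl⟩ : ∃ σ, 0 < σ ∧ σ ^ γ = s :=
    ⟨s ^ γ⁻¹, by positivity, Real.rpow_inv_rpow hs.le hγ.ne'⟩
  obtain ⟨T, hT, hCT, hTσ⟩ := exists_splitting_time hα hC hσ
  have hfm : Measurable fun x => ‖f x‖ := (Lp.stronglyMeasurable f).measurable.norm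
  have hS : MeasurableSet {x | σ ^ γ < ‖f x‖} := measurableSet_lt measurable_const hfm
  have hcompl : {x | ‖f x‖ ≤ σ ^ γ} = {x | σ ^ γ < ‖f x‖}ᶜ := by
    ext x
    exact not_lt (a := σ ^ γ).symm
  obtain ⟨f₁, f₂, hsum, hf₁, hf₂⟩ := exists_eq_add_indicator f hS
  have htail_f : eLpNorm (E.besselOn (Ioi T) f) ∞ μ ≤ ENNReal.ofReal (σ / 2) := by
    refine (htail T hT f).trans (mul_le_of_le_one_right' ?_ |>.trans_eq (by rw [hCT]))
    rwa [eLpNorm_two_eq, ENNReal.ofReal_le_one]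
  simp only [Real.rpow_lt_rpow_iff hσ.le (norm_nonneg _) hγ]
  rw [hcompl]
  exact (measure_lt_norm_bessel_le hE hT.le hσ.le hsum htail_f).trans (add_le_add
    (measure_le_norm_besselOn_Ioc_le hB hT hr0 hs hσ (by positivity) hTσ hS hf₁ (hhead_r T hT f₁))
    (measure_le_norm_besselOn_Ioc_le hD hT (hr0.trans hrq) hs hσ (by positivity) hTσ hS.compl hf₂
      (hhead_q T hT f₂)))

theorem lintegral_norm_sq_le_one {f : Lp ℝ 2 μ} (hf : ‖f‖ ≤ 1) :
    ∫⁻ x, ENNReal.ofReal (‖f x‖ ^ (2 : ℝ)) ∂μ ≤ 1 := by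
  rw [← eLpNorm_ofReal_rpow_eq_lintegral _ two_pos, ENNReal.ofReal_ofNat, eLpNorm_two_eq]
  exact ENNReal.rpow_le_one (ENNReal.ofReal_le_one.2 hf) two_pos.le

theorem exists_lintegral_bessel_critical_le (hE : (spectralResolution A).Nonneg) {α : ℝ}
    (hα : 1 / 2 < α) (hdecay : HeatDecay A α) (hLq : HeatLqBounds A α) :
    ∃ K : ℝ≥0∞, K ≠ ∞ ∧ ∀ f : Lp ℝ 2 μ, ‖f‖ ≤ 1 →
      ∫⁻ x, ENNReal.ofReal
        (‖(spectralResolution A).bessel f x‖ ^ (2 * (2 * α / (2 * α - 1)))) ∂μ ≤ K := by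
  obtain ⟨r, hr, hr2⟩ : ∃ r, 4 * α / (4 * α - 1) < r ∧ r < 2 := by
    refine exists_between ?_
    rw [div_lt_iff₀ (by linarith)]
    linarith
  obtain ⟨q, hq2, hq⟩ : ∃ q, 2 < q ∧ q < 4 * α := exists_between (by linarith)
  have hr0 : 0 < r := lt_trans (div_pos (by linarith) (by linarith)) hr
  obtain ⟨K, L, hlevel⟩ :=
    exists_measure_lt_norm_bessel_rpow_le hE hα hdecay hLq hr (hr2.trans hq2) hq
  refine ⟨ENNReal.ofReal 2 * (ENNReal.ofReal K * ENNReal.ofReal (2 - r)⁻¹ +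
    ENNReal.ofReal L * ENNReal.ofReal (q - 2)⁻¹), by finiteness, fun f hf => ?_⟩
  have hfsm : FinStronglyMeasurable (fun x => ‖f x‖) μ :=
    (Lp.memLp f).norm.finStronglyMeasurable_of_stronglyMeasurable (Lp.stronglyMeasurable f).norm
      two_ne_zero ENNReal.ofNat_ne_top
  have hmeas : Measurable fun x => ‖(spectralResolution A).bessel f x‖ :=
    (Lp.stronglyMeasurable _).measurable.norm
  simp only [mul_comm (2 : ℝ) (2 * α / _), Real.rpow_mul (norm_nonneg _)]
  refine (lintegral_rpow_le_of_measure_lt_le hfsm (fun _ => norm_nonneg _)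
    (hmeas.pow_const _).aemeasurable (fun _ => by positivity) hr0 hr2 hq2 (hlevel f hf)).trans ?_
  exact mul_le_of_le_one_right' (lintegral_norm_sq_le_one hf)

theorem exists_eLpNorm_bessel_le (hE : (spectralResolution A).Nonneg) {α p : ℝ} (hα : 0 < α)
    (hdecay : HeatDecay A α) (hLq : HeatLqBounds A α) (hp : 1 < p)
    (hpα : 1 / 2 < α → p ≤ 2 * α / (2 * α - 1)) :
    ∃ C : ℝ, 0 ≤ C ∧ ∀ f : Lp ℝ 2 μ,
      eLpNorm ((spectralResolution A).bessel f) (ENNReal.ofReal (2 * p)) μ ≤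
        ENNReal.ofReal (C * ‖f‖) := by
  rcases le_or_gt α (1 / 2) with hα' | hα'
  · refine exists_eLpNorm_bessel_le_of_lt hE hdecay (by linarith) ?_
    have hp' : 0 < 2 / (2 * p) := by positivity
    nlinarith
  obtain ⟨K, hK, hcritical⟩ := exists_lintegral_bessel_critical_le hE hα' hdecay hLq
  have hp0 : 0 < 2 * p := by linarith
  have hunit : ∀ f : Lp ℝ 2 μ, ‖f‖ ≤ 1 →
      eLpNorm ((spectralResolution A).bessel f) (ENNReal.ofReal (2 * p)) μ ≤
        (1 + K) ^ (2 * p)⁻¹ := by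
    intro f hf
    have hbessel : ‖(spectralResolution A).bessel f‖ ≤ 1 :=
      (ContinuousLinearMap.le_of_opNorm_le _ (hE.norm_op_le measurable_besselSymbol
        fun _ => abs_besselSymbol_le) f).trans (by linarith)
    rw [ENNReal.le_rpow_inv_iff hp0, eLpNorm_ofReal_rpow_eq_lintegral _ hp0]
    exact (lintegral_norm_rpow_le_add (Lp.aestronglyMeasurable _) two_pos (by linarith)
      (by linarith [hpα hα'])).trans
      (add_le_add (lintegral_norm_sq_le_one hbessel) (hcritical f hf))
  have hfin : (1 + K) ^ (2 * p)⁻¹ ≠ ∞ := by finiteness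
  refine ⟨((1 + K) ^ (2 * p)⁻¹).toReal, ENNReal.toReal_nonneg, fun f => ?_⟩
  rw [ENNReal.ofReal_mul ENNReal.toReal_nonneg, ENNReal.ofReal_toReal hfin, ofReal_norm]
  exact eLpNorm_le_mul_enorm_of_norm_le_one (spectralResolution A).bessel.toLinearMap hunit f

end Sobolev

/-! ### The nonlinearity on `H¹(A)` -/

section Nonlinearity

variable {X : Type*} [MeasurableSpace X] {μ : Measure X} {p r : ℝ}

theorem eLpNorm_norm_rpow_sub_one_smul_le {V W : Type*} [NormedAddCommGroup V]
    [NormedAddCommGroup W] [NormedSpace ℝ W] (hr : 0 < r) (hp : 1 < p) {h : X → V} {f : X → W}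
    (hh : AEStronglyMeasurable h μ) (hf : AEStronglyMeasurable f μ) :
    eLpNorm (fun x => ‖h x‖ ^ (p - 1) • f x) (ENNReal.ofReal r) μ ≤
      eLpNorm h (ENNReal.ofReal (r * p)) μ ^ (p - 1) * eLpNorm f (ENNReal.ofReal (r * p)) μ := by
  have hp₁ : 0 < p - 1 := sub_pos.2 hp
  have : 0 < p := zero_lt_one.trans hp
  have htriple : ENNReal.HolderTriple (ENNReal.ofReal (r * p / (p - 1)))
      (ENNReal.ofReal (r * p)) (ENNReal.ofReal r) := ⟨by
    rw [← ENNReal.ofReal_inv_of_pos (by positivity), ← ENNReal.ofReal_inv_of_pos (by positivity),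
      ← ENNReal.ofReal_add (by positivity) (by positivity), ← ENNReal.ofReal_inv_of_pos hr]
    congr 1
    field_simp
    ring⟩
  have hpow : AEStronglyMeasurable (fun x => ‖h x‖ ^ (p - 1)) μ :=
    (hh.norm.aemeasurable.pow_const _).aestronglyMeasurable
  refine (eLpNorm_smul_le_mul_eLpNorm (p := ENNReal.ofReal (r * p / (p - 1)))
    (q := ENNReal.ofReal (r * p)) hf hpow).trans_eq ?_
  rw [eLpNorm_norm_rpow _ hp₁, ← ENNReal.ofReal_mul (by positivity), div_mul_cancel₀ _ hp₁.ne']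

theorem eLpNorm_comp_sub_comp_le {V W : Type*} [NormedAddCommGroup V] [NormedSpace ℝ V]
    [NormedAddCommGroup W] {F : V → W} {C : ℝ} (hr : 1 ≤ r) (hp : 1 < p)
    (hF : ∀ z₁ z₂, ‖F z₁ - F z₂‖ ≤ C * (‖z₁‖ + ‖z₂‖) ^ (p - 1) * ‖z₁ - z₂‖)
    {f g : X → V} (hf : AEStronglyMeasurable f μ) (hg : AEStronglyMeasurable g μ) :
    eLpNorm (fun x => F (f x) - F (g x)) (ENNReal.ofReal r) μ ≤ ENNReal.ofReal C *
      ((eLpNorm f (ENNReal.ofReal (r * p)) μ + eLpNorm g (ENNReal.ofReal (r * p)) μ) ^ (p - 1) *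
        eLpNorm (f - g) (ENNReal.ofReal (r * p)) μ) := by
  have : 0 ≤ p - 1 := by linarith
  set h : X → ℝ := fun x => ‖f x‖ + ‖g x‖
  have hh : AEStronglyMeasurable h μ := hf.norm.add hg.norm
  have hpointwise : ∀ x, ‖F (f x) - F (g x)‖ ≤ C * ‖‖h x‖ ^ (p - 1) • (f - g) x‖ := fun x => by
    rw [Pi.sub_apply, norm_smul, Real.norm_of_nonneg (by positivity), Real.norm_of_nonneg
      (show 0 ≤ h x by positivity), ← mul_assoc]
    exact hF _ _
  have hnorm : eLpNorm h (ENNReal.ofReal (r * p)) μ ≤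
      eLpNorm f (ENNReal.ofReal (r * p)) μ + eLpNorm g (ENNReal.ofReal (r * p)) μ := by
    refine (eLpNorm_add_le hf.norm hg.norm
      (ENNReal.one_le_ofReal.2 (one_le_mul_of_one_le_of_one_le hr hp.le))).trans_eq ?_
    rw [eLpNorm_norm, eLpNorm_norm]
  refine (eLpNorm_le_mul_eLpNorm_of_ae_le_mul (.of_forall hpointwise) _).trans ?_
  gcongr
  refine (eLpNorm_norm_rpow_sub_one_smul_le (zero_lt_one.trans_le hr) hp hh (hf.sub hg)).trans ?_
  gcongr

variable {F : ℝ → ℝ}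

theorem memLp_comp_of_eLpNorm_lt_top (hp : 1 < p) (hF : IsNonlinearity F p) (f : Lp ℝ 2 μ)
    (hf : eLpNorm f (ENNReal.ofReal (2 * p)) μ < ∞) : MemLp (fun x => F (f x)) 2 μ := by
  obtain ⟨hF₀, hFcont, C, hC⟩ := hF
  refine ⟨hFcont.continuous.comp_aestronglyMeasurable (Lp.aestronglyMeasurable _), ?_⟩
  have hle := eLpNorm_comp_sub_comp_le (μ := μ) (F := F) one_le_two hp hC
    (Lp.aestronglyMeasurable f) aestronglyMeasurable_zero
  simp only [Pi.zero_apply, hF₀, sub_zero, eLpNorm_zero, add_zero, ENNReal.ofReal_ofNat] at hle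
  exact hle.trans_lt (ENNReal.mul_lt_top ENNReal.ofReal_lt_top
    (ENNReal.mul_lt_top (ENNReal.rpow_lt_top_of_nonneg (by linarith) hf.ne) hf))

theorem norm_superposition_sub_le {C M D : ℝ} (hp : 1 < p) (hC : 0 ≤ C) (hM : 0 ≤ M) (hD : 0 ≤ D)
    (hF : ∀ z₁ z₂ : ℝ, |F z₁ - F z₂| ≤ C * (|z₁| + |z₂|) ^ (p - 1) * |z₁ - z₂|) {f g : Lp ℝ 2 μ}
    (hFf : MemLp (fun x => F (f x)) 2 μ) (hFg : MemLp (fun x => F (g x)) 2 μ)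
    (hf : eLpNorm f (ENNReal.ofReal (2 * p)) μ ≤ ENNReal.ofReal M)
    (hg : eLpNorm g (ENNReal.ofReal (2 * p)) μ ≤ ENNReal.ofReal M)
    (hfg : eLpNorm (f - g : Lp ℝ 2 μ) (ENNReal.ofReal (2 * p)) μ ≤ ENNReal.ofReal D) :
    ‖superposition F f - superposition F g‖ ≤ C * (M + M) ^ (p - 1) * D := by
  have hp₁ : 0 ≤ p - 1 := by linarith
  rw [superposition, superposition, dif_pos hFf, dif_pos hFg, ← MemLp.toLp_sub, Lp.norm_toLp]
  refine ENNReal.toReal_le_of_le_ofReal (by positivity) ?_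
  have hle := eLpNorm_comp_sub_comp_le (μ := μ) (F := F) one_le_two hp hF
    (Lp.aestronglyMeasurable f) (Lp.aestronglyMeasurable g)
  rw [ENNReal.ofReal_ofNat, ← eLpNorm_congr_ae (Lp.coeFn_sub f g)] at hle
  refine hle.trans ?_
  rw [mul_assoc, ENNReal.ofReal_mul hC, ENNReal.ofReal_mul (p := (M + M) ^ (p - 1)) (by positivity),
    ← ENNReal.ofReal_rpow_of_nonneg (by positivity) hp₁, ENNReal.ofReal_add hM hM]
  gcongr

variable {G : Type*} [NormedAddCommGroup G] [NormedSpace ℝ G]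

theorem lipschitzOnBalls_superposition_comp (hp : 1 < p) (hF : IsNonlinearity F p) {B : ℝ}
    (hB₀ : 0 ≤ B) {T : G →L[ℝ] Lp ℝ 2 μ}
    (hB : ∀ x, eLpNorm (T x) (ENNReal.ofReal (2 * p)) μ ≤ ENNReal.ofReal (B * ‖x‖)) :
    LipschitzOnBalls fun x => superposition F (T x) := fun R => by
  have hmem : ∀ x, MemLp (fun a => F (T x a)) 2 μ := fun x =>
    memLp_comp_of_eLpNorm_lt_top hp hF _ ((hB x).trans_lt ENNReal.ofReal_lt_top)
  obtain ⟨-, -, C, hC⟩ := hF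
  rcases lt_or_ge R 0 with hR | hR
  · exact ⟨0, by simp [Metric.closedBall_eq_empty.2 hR]⟩
  have hC' : ∀ z₁ z₂ : ℝ, |F z₁ - F z₂| ≤ |C| * (|z₁| + |z₂|) ^ (p - 1) * |z₁ - z₂| :=
    fun z₁ z₂ => (hC z₁ z₂).trans (by gcongr; exact le_abs_self C)
  have hball : ∀ x ∈ Metric.closedBall (0 : G) R,
      eLpNorm (T x) (ENNReal.ofReal (2 * p)) μ ≤ ENNReal.ofReal (B * R) := fun x hx => by
    refine (hB x).trans (ENNReal.ofReal_le_ofReal ?_)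
    gcongr
    exact mem_closedBall_zero_iff.1 hx
  refine ⟨(|C| * (B * R + B * R) ^ (p - 1) * B).toNNReal,
    LipschitzOnWith.of_dist_le_mul fun x hx y hy => ?_⟩
  rw [Real.coe_toNNReal _ (by positivity), dist_eq_norm, dist_eq_norm, mul_assoc _ B]
  refine norm_superposition_sub_le hp (abs_nonneg C) (by positivity) (by positivity) hC'
    (hmem x) (hmem y) (hball x hx) (hball y hy) ?_
  rw [← map_sub]
  exact hB _

end Nonlinearity

/-! ### The damped wave propagator -/

section Symbols

open ResolutionOfIdentity

theorem norm_le_exp_mul_norm_of_norm_deriv_le {V : Type*} [NormedAddCommGroup V] [NormedSpace ℝ V]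
    {f f' : ℝ → V} {K : ℝ} (hf : ∀ t, HasDerivAt f (f' t) t) (hK : ∀ t, ‖f' t‖ ≤ K * ‖f t‖)
    (t : ℝ) : ‖f t‖ ≤ Real.exp (K * |t|) * ‖f 0‖ := by
  have hforward : ∀ {g g' : ℝ → V}, (∀ t, HasDerivAt g (g' t) t) → (∀ t, ‖g' t‖ ≤ K * ‖g t‖) →
      ∀ t, 0 ≤ t → ‖g t‖ ≤ Real.exp (K * t) * ‖g 0‖ := fun {g g'} hg hg' t ht => by
    have hgronwall := norm_le_gronwallBound_of_norm_deriv_right_le (ε := 0)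
      (fun s _ => (hg s).continuousAt.continuousWithinAt) (fun s _ => (hg s).hasDerivWithinAt)
      le_rfl (fun s _ => by simpa using hg' s) t ⟨ht, le_rfl⟩
    rwa [gronwallBound_ε0, sub_zero, mul_comm] at hgronwall
  rcases le_total 0 t with ht | ht
  · rw [abs_of_nonneg ht]
    exact hforward hf hK t ht
  · have hreflected : ∀ s, HasDerivAt (fun s => f (-s)) (-f' (-s)) s := fun s => by
      simpa [Function.comp_def] using (hf (-s)).scomp s (hasDerivAt_neg s)
    rw [abs_of_nonpos ht]
    simpa using hforward hreflected (fun s => by simpa using hK (-s)) (-t) (neg_nonneg.2 ht)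

/-- The function `e^{-t/2} cosh(t √(1/4 - l))`, continued analytically to `l ≥ 1/4`. Together with
`symbolD` it spans the solutions of `y'' + y' + l y = 0`. -/
def symbolC (t l : ℝ) : ℝ :=
  Real.exp (-t / 2) *
    if l < 1 / 4 then Real.cosh (t * √(1 / 4 - l)) else Real.cos (t * √(l - 1 / 4))

/-- The time derivative of `symbolD`. -/
def symbolDt (t l : ℝ) : ℝ := symbolC t l - symbolD t l / 2

theorem measurable_symbolD (t : ℝ) : Measurable (symbolD t) := by
  unfold symbolD
  exact .ite measurableSet_Iio (by fun_prop)
    (.ite (measurableSet_singleton (1 / 4 : ℝ)) (by fun_prop) (by fun_prop))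

theorem measurable_symbolC (t : ℝ) : Measurable (symbolC t) := by
  unfold symbolC
  exact measurable_const.mul (.ite measurableSet_Iio (by fun_prop) (by fun_prop))

theorem measurable_symbolDt (t : ℝ) : Measurable (symbolDt t) :=
  (measurable_symbolC t).sub ((measurable_symbolD t).div_const 2)

theorem hasDerivAt_exp_neg_half (t : ℝ) :
    HasDerivAt (fun t : ℝ => Real.exp (-t / 2)) (Real.exp (-t / 2) * (-1 / 2)) t :=
  (((hasDerivAt_id t).neg).div_const 2).exp

theorem hasDerivAt_symbolD (t l : ℝ) :
    HasDerivAt (fun t => symbolD t l) (symbolDt t l) t := by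
  unfold symbolDt symbolD symbolC
  have hexp := hasDerivAt_exp_neg_half t
  rcases lt_trichotomy l (1 / 4) with hl | hl | hl
  · simp only [hl, if_true]
    have hk : √(1 / 4 - l) ≠ 0 := (Real.sqrt_pos.2 (by linarith)).ne'
    have hsinh := ((hasDerivAt_id t).mul_const √(1 / 4 - l)).sinh
    refine ((hexp.mul hsinh).div_const √(1 / 4 - l)).congr_deriv ?_
    generalize √(1 / 4 - l) = k at *
    simp only [id]
    field_simp
    ring
  · simp only [hl, lt_self_iff_false, if_false, if_true]
    refine ((hasDerivAt_id t).mul hexp).congr_deriv ?_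
    simp
    ring
  · simp only [hl.not_gt, hl.ne', if_false]
    have hk : √(l - 1 / 4) ≠ 0 := (Real.sqrt_pos.2 (by linarith)).ne'
    have hsin := ((hasDerivAt_id t).mul_const √(l - 1 / 4)).sin
    refine ((hexp.mul hsin).div_const √(l - 1 / 4)).congr_deriv ?_
    generalize √(l - 1 / 4) = k at *
    simp only [id]
    field_simp
    ring

theorem hasDerivAt_symbolC (t l : ℝ) :
    HasDerivAt (fun t => symbolC t l) (-symbolC t l / 2 + (1 / 4 - l) * symbolD t l) t := by
  unfold symbolD symbolC
  have hexp := hasDerivAt_exp_neg_half t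
  rcases lt_trichotomy l (1 / 4) with hl | hl | hl
  · simp only [hl, if_true]
    have hk : √(1 / 4 - l) ≠ 0 := (Real.sqrt_pos.2 (by linarith)).ne'
    have hk_sq : 1 / 4 - l = √(1 / 4 - l) ^ 2 := (Real.sq_sqrt (by linarith)).symm
    refine (hexp.mul ((hasDerivAt_id t).mul_const √(1 / 4 - l)).cosh).congr_deriv ?_
    generalize √(1 / 4 - l) = k at *
    rw [hk_sq]
    simp only [id]
    field_simp
  · simp only [hl, lt_self_iff_false, if_false, if_true, sub_self, Real.sqrt_zero, mul_zero,
      Real.cos_zero, mul_one, zero_mul, add_zero]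
    refine hexp.congr_deriv ?_
    ring
  · simp only [hl.not_gt, hl.ne', if_false]
    have hk : √(l - 1 / 4) ≠ 0 := (Real.sqrt_pos.2 (by linarith)).ne'
    have hk_sq : 1 / 4 - l = -√(l - 1 / 4) ^ 2 := by rw [Real.sq_sqrt (by linarith)]; ring
    refine (hexp.mul ((hasDerivAt_id t).mul_const √(l - 1 / 4)).cos).congr_deriv ?_
    generalize √(l - 1 / 4) = k at *
    rw [hk_sq]
    simp only [id]
    field_simp

theorem hasDerivAt_symbolDt (t l : ℝ) :
    HasDerivAt (fun t => symbolDt t l) (-symbolDt t l - l * symbolD t l) t := by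
  refine ((hasDerivAt_symbolC t l).sub ((hasDerivAt_symbolD t l).div_const 2)).congr_deriv ?_
  unfold symbolDt
  ring

theorem continuous_symbolD (l : ℝ) : Continuous fun t => symbolD t l :=
  continuous_iff_continuousAt.2 fun t => (hasDerivAt_symbolD t l).continuousAt

theorem continuous_symbolDt (l : ℝ) : Continuous fun t => symbolDt t l :=
  continuous_iff_continuousAt.2 fun t => (hasDerivAt_symbolDt t l).continuousAt

theorem symbolD_zero (l : ℝ) : symbolD 0 l = 0 := by
  unfold symbolD
  split_ifs <;> simp

theorem symbolDt_zero (l : ℝ) : symbolDt 0 l = 1 := by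
  rw [symbolDt, symbolD_zero, symbolC]
  split_ifs <;> simp

section DampedOscillator

variable {y z : ℝ → ℝ} {l : ℝ}

theorem oscillator_energy_le (hl : 0 ≤ l) (hy : ∀ t, HasDerivAt y (z t) t)
    (hz : ∀ t, HasDerivAt z (-z t - l * y t) t) (t : ℝ) :
    z t ^ 2 + (1 + l) * y t ^ 2 ≤ Real.exp (3 * |t|) * (z 0 ^ 2 + (1 + l) * y 0 ^ 2) := by
  have hderiv : ∀ t, HasDerivAt (fun t => z t ^ 2 + (1 + l) * y t ^ 2)
      (-2 * z t ^ 2 + 2 * y t * z t) t := fun t => by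
    refine (((hz t).pow 2).add (((hy t).pow 2).const_mul (1 + l))).congr_deriv ?_
    simp
    ring
  have henergy : ∀ t, ‖z t ^ 2 + (1 + l) * y t ^ 2‖ = z t ^ 2 + (1 + l) * y t ^ 2 :=
    fun t => Real.norm_of_nonneg (by positivity)
  have hgrowth : ∀ t, ‖-2 * z t ^ 2 + 2 * y t * z t‖ ≤ 3 * ‖z t ^ 2 + (1 + l) * y t ^ 2‖ :=
    fun t => by
      have hpotential : 0 ≤ l * y t ^ 2 := mul_nonneg hl (sq_nonneg _)
      rw [henergy, Real.norm_eq_abs, abs_le]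
      constructor <;>
        nlinarith [sq_nonneg (y t + z t), sq_nonneg (y t - z t), sq_nonneg (y t), sq_nonneg (z t)]
  simpa only [henergy] using norm_le_exp_mul_norm_of_norm_deriv_le hderiv hgrowth t

theorem oscillator_eq_zero (hl : 0 ≤ l) (hy : ∀ t, HasDerivAt y (z t) t)
    (hz : ∀ t, HasDerivAt z (-z t - l * y t) t) (hy₀ : y 0 = 0) (hz₀ : z 0 = 0) (t : ℝ) :
    y t = 0 ∧ z t = 0 := by
  have henergy := oscillator_energy_le hl hy hz t
  simp only [hy₀, hz₀, ne_eq, OfNat.ofNat_ne_zero, not_false_eq_true, zero_pow, mul_zero,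
    add_zero] at henergy
  have hpotential : 0 ≤ l * y t ^ 2 := mul_nonneg hl (sq_nonneg _)
  constructor <;> refine pow_eq_zero_iff two_ne_zero |>.1 ?_ <;>
    nlinarith [sq_nonneg (y t), sq_nonneg (z t)]

theorem symbol_energy_le (t : ℝ) (hl : 0 ≤ l) :
    symbolDt t l ^ 2 + (1 + l) * symbolD t l ^ 2 ≤ Real.exp (3 * |t|) := by
  simpa [symbolD_zero, symbolDt_zero] using oscillator_energy_le hl
    (fun t => hasDerivAt_symbolD t l) (fun t => hasDerivAt_symbolDt t l) t

theorem symbolD_add_and_symbolDt_add (t s : ℝ) (hl : 0 ≤ l) :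
    symbolD (t + s) l =
      (symbolD t l + symbolDt t l) * symbolD s l + symbolD t l * symbolDt s l ∧
    symbolDt (t + s) l = symbolDt t l * symbolDt s l - l * symbolD t l * symbolD s l := by
  have hdifference := oscillator_eq_zero (l := l)
    (y := fun t => symbolD (t + s) l -
      ((symbolD t l + symbolDt t l) * symbolD s l + symbolD t l * symbolDt s l))
    (z := fun t => symbolDt (t + s) l -
      (symbolDt t l * symbolDt s l - l * symbolD t l * symbolD s l)) hl
    (fun t => by
      refine ((hasDerivAt_symbolD (t + s) l).comp_add_const t s |>.sub
        ((((hasDerivAt_symbolD t l).add (hasDerivAt_symbolDt t l)).mul_const _).add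
          ((hasDerivAt_symbolD t l).mul_const _))).congr_deriv ?_
      ring)
    (fun t => by
      refine ((hasDerivAt_symbolDt (t + s) l).comp_add_const t s |>.sub
        (((hasDerivAt_symbolDt t l).mul_const _).sub
          (((hasDerivAt_symbolD t l).const_mul l).mul_const _))).congr_deriv ?_
      ring)
    (by simp [symbolD_zero, symbolDt_zero]) (by simp [symbolD_zero, symbolDt_zero]) t
  exact hdifference.imp sub_eq_zero.1 sub_eq_zero.1

theorem abs_le_exp_of_sq_le_exp {x a : ℝ} (ha : 0 ≤ a) (hx : x ^ 2 ≤ Real.exp a) :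
    |x| ≤ Real.exp a := by
  have hexp : 1 ≤ Real.exp a := Real.one_le_exp ha
  exact abs_le_of_sq_le_sq (hx.trans (le_self_pow₀ hexp two_ne_zero)) (Real.exp_pos _).le

theorem abs_symbolDt_le (t : ℝ) (hl : 0 ≤ l) : |symbolDt t l| ≤ Real.exp (3 * |t|) := by
  refine abs_le_exp_of_sq_le_exp (by positivity) (le_trans ?_ (symbol_energy_le t hl))
  exact le_add_of_nonneg_right (by positivity)

theorem abs_sobolevSymbol_mul_symbolD_le (t : ℝ) (hl : 0 ≤ l) :
    |sobolevSymbol l * symbolD t l| ≤ Real.exp (3 * |t|) := by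
  refine abs_le_exp_of_sq_le_exp (by positivity) (le_trans ?_ (symbol_energy_le t hl))
  rw [mul_pow, sobolevSymbol_sq hl]
  exact le_add_of_nonneg_left (sq_nonneg _)

theorem abs_symbolD_le (t : ℝ) (hl : 0 ≤ l) : |symbolD t l| ≤ Real.exp (3 * |t|) := by
  refine le_trans ?_ (abs_sobolevSymbol_mul_symbolD_le t hl)
  rw [abs_mul, abs_of_pos (sobolevSymbol_pos hl)]
  exact le_mul_of_one_le_left (abs_nonneg _) (one_le_sobolevSymbol hl)

theorem abs_mul_besselSymbol_mul_symbolD_le (t : ℝ) (hl : 0 ≤ l) :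
    |l * besselSymbol l * symbolD t l| ≤ Real.exp (3 * |t|) := by
  have hpos := sobolevSymbol_pos hl
  have hle : l * besselSymbol l ≤ sobolevSymbol l := by
    rw [besselSymbol_eq hl, mul_inv_le_iff₀ hpos, ← sq, sobolevSymbol_sq hl]
    linarith
  refine le_trans ?_ (abs_sobolevSymbol_mul_symbolD_le t hl)
  rw [abs_mul, abs_mul _ (symbolD t l), abs_of_nonneg (mul_nonneg hl (besselSymbol_nonneg hl)),
    abs_of_pos hpos]
  gcongr

end DampedOscillator

/-- The symbol of the propagator of the linear damped wave equation, written as a first-order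
system for `((I + A)^{1/2} u, ∂ₜu)`. -/
def waveSymbol (t l : ℝ) : Matrix (Fin 2) (Fin 2) ℝ :=
  !![symbolD t l + symbolDt t l, sobolevSymbol l * symbolD t l;
    -(l * besselSymbol l * symbolD t l), symbolDt t l]

theorem waveSymbol_zero (l : ℝ) : waveSymbol 0 l = 1 := by
  simp [waveSymbol, symbolD_zero, symbolDt_zero, Matrix.one_fin_two]

theorem waveSymbol_add (t s : ℝ) {l : ℝ} (hl : 0 ≤ l) :
    waveSymbol (t + s) l = waveSymbol t l * waveSymbol s l := by
  obtain ⟨hD, hDt⟩ := symbolD_add_and_symbolDt_add t s hl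
  have hinv := sobolevSymbol_mul_besselSymbol hl
  simp only [waveSymbol, Matrix.mul_fin_two, hD, hDt]
  ext i j
  fin_cases i <;> fin_cases j <;>
    simp only [Fin.zero_eta, Fin.mk_one, Matrix.of_apply, Matrix.cons_val', Matrix.cons_val_zero,
      Matrix.cons_val_one, Matrix.cons_val_fin_one]
  · linear_combination l * symbolD t l * symbolD s l * hinv
  · ring
  · ring
  · linear_combination l * symbolD t l * symbolD s l * hinv

theorem measurable_waveSymbol (t : ℝ) : ∀ i j, Measurable fun l => waveSymbol t l i j
  | 0, 0 => (measurable_symbolD t).add (measurable_symbolDt t)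
  | 0, 1 => measurable_sobolevSymbol.mul (measurable_symbolD t)
  | 1, 0 => ((measurable_id.mul measurable_besselSymbol).mul (measurable_symbolD t)).neg
  | 1, 1 => measurable_symbolDt t

theorem continuous_waveSymbol (l : ℝ) : ∀ i j, Continuous fun t => waveSymbol t l i j
  | 0, 0 => (continuous_symbolD l).add (continuous_symbolDt l)
  | 0, 1 => continuous_const.mul (continuous_symbolD l)
  | 1, 0 => (continuous_const.mul (continuous_symbolD l)).neg
  | 1, 1 => continuous_symbolDt l

theorem abs_waveSymbol_le (t : ℝ) {l : ℝ} (hl : 0 ≤ l) :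
    ∀ i j, |waveSymbol t l i j| ≤ 2 * Real.exp (3 * |t|)
  | 0, 0 => (abs_add_le _ _).trans
    ((add_le_add (abs_symbolD_le t hl) (abs_symbolDt_le t hl)).trans_eq (two_mul _).symm)
  | 0, 1 => (abs_sobolevSymbol_mul_symbolD_le t hl).trans
    (le_mul_of_one_le_left (Real.exp_pos _).le one_le_two)
  | 1, 0 => (abs_neg _).trans_le ((abs_mul_besselSymbol_mul_symbolD_le t hl).trans
    (le_mul_of_one_le_left (Real.exp_pos _).le one_le_two))
  | 1, 1 => (abs_symbolDt_le t hl).trans (le_mul_of_one_le_left (Real.exp_pos _).le one_le_two)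

end Symbols

namespace ResolutionOfIdentity

variable {H : Type*} [NormedAddCommGroup H] [InnerProductSpace ℝ H] [CompleteSpace H]
  {E : ResolutionOfIdentity H}

theorem Nonneg.bdd_symbolD (hE : E.Nonneg) (t : ℝ) : E.Bdd (symbolD t) :=
  hE.bdd (measurable_symbolD t) fun _ => abs_symbolD_le t

theorem Nonneg.bdd_symbolDt (hE : E.Nonneg) (t : ℝ) : E.Bdd (symbolDt t) :=
  hE.bdd (measurable_symbolDt t) fun _ => abs_symbolDt_le t

theorem Nonneg.bdd_waveSymbol (hE : E.Nonneg) (t : ℝ) (i j : Fin 2) :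
    E.Bdd fun l => waveSymbol t l i j :=
  hE.bdd (measurable_waveSymbol t i j) fun _ hl => abs_waveSymbol_le t hl i j

variable (E) in
/-- The propagator of the linear damped wave equation, acting on `((I + A)^{1/2} u, ∂ₜu)`. -/
def waveOp (t : ℝ) : H × H →L[ℝ] H × H :=
  ((E.op fun l => waveSymbol t l 0 0).coprod (E.op fun l => waveSymbol t l 0 1)).prod
    ((E.op fun l => waveSymbol t l 1 0).coprod (E.op fun l => waveSymbol t l 1 1))

theorem waveOp_apply (t : ℝ) (x : H × H) : E.waveOp t x =
    (E.op (fun l => waveSymbol t l 0 0) x.1 + E.op (fun l => waveSymbol t l 0 1) x.2,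
      E.op (fun l => waveSymbol t l 1 0) x.1 + E.op (fun l => waveSymbol t l 1 1) x.2) := rfl

theorem op_zero : E.op (fun _ => 0) = 0 :=
  (Bdd.const 0).op_eq fun f h => by simp [weakIntegral]

theorem waveOp_zero (x : H × H) : E.waveOp 0 x = x := by
  simp [waveOp_apply, waveSymbol_zero, op_zero, op_one]

theorem Nonneg.op_waveSymbol_add (hE : E.Nonneg) (t s : ℝ) (i j : Fin 2) (f : H) :
    E.op (fun l => waveSymbol (t + s) l i j) f =
      E.op (fun l => waveSymbol t l i 0) (E.op (fun l => waveSymbol s l 0 j) f) +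
        E.op (fun l => waveSymbol t l i 1) (E.op (fun l => waveSymbol s l 1 j) f) := by
  have hsymbol : ∀ l, 0 ≤ l → waveSymbol (t + s) l i j =
      waveSymbol t l i 0 * waveSymbol s l 0 j + waveSymbol t l i 1 * waveSymbol s l 1 j :=
    fun l hl => by rw [waveSymbol_add t s hl, Matrix.mul_apply, Fin.sum_univ_two]
  have hprod : ∀ k, E.Bdd fun l => waveSymbol t l i k * waveSymbol s l k j := fun k =>
    (hE.bdd_waveSymbol t i k).mul (hE.bdd_waveSymbol s k j)
  rw [(hE.bdd_waveSymbol t i 0).op_mul (hE.bdd_waveSymbol s 0 j),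
    (hE.bdd_waveSymbol t i 1).op_mul (hE.bdd_waveSymbol s 1 j), hE.op_congr hsymbol,
    (hprod 0).op_add (hprod 1), add_apply]

theorem Nonneg.waveOp_add (hE : E.Nonneg) (t s : ℝ) (x : H × H) :
    E.waveOp (t + s) x = E.waveOp t (E.waveOp s x) := by
  simp only [waveOp_apply, hE.op_waveSymbol_add, map_add]
  congr 1 <;> abel

theorem Nonneg.continuous_waveOp (hE : E.Nonneg) (x : H × H) :
    Continuous fun t => E.waveOp t x := by
  have hentry : ∀ (i j : Fin 2) (f : H), Continuous fun t => E.op (fun l => waveSymbol t l i j) f :=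
    fun i j => hE.continuous_op (fun t => measurable_waveSymbol t i j)
      (b := fun t => 2 * Real.exp (3 * |t|)) (by fun_prop)
      (fun t l hl => abs_waveSymbol_le t hl i j) (fun l _ => continuous_waveSymbol l i j)
  exact ((hentry 0 0 _).add (hentry 0 1 _)).prodMk ((hentry 1 0 _).add (hentry 1 1 _))

/-- The strongly continuous group of the linear damped wave equation on the energy space. -/
def Nonneg.waveGroup (hE : E.Nonneg) : StronglyContinuousGroup (H × H) where
  op := E.waveOp
  op_zero := waveOp_zero
  op_add := hE.waveOp_add
  continuous_op := hE.continuous_waveOp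

variable (E) in
/-- The displacement `u` of the state `((I + A)^{1/2} u, ∂ₜu)`. -/
def displacement : H × H →L[ℝ] H := E.bessel.comp (ContinuousLinearMap.fst ℝ H H)

theorem displacement_apply (x : H × H) : E.displacement x = E.bessel x.1 := rfl

theorem Nonneg.displacement_waveGroup_op (hE : E.Nonneg) (t : ℝ) (x : H × H) :
    E.displacement (hE.waveGroup.op t x) =
      E.op (fun l => besselSymbol l * (symbolD t l + symbolDt t l)) x.1 + E.op (symbolD t) x.2 := by
  change E.bessel (E.waveOp t x).1 = _
  rw [waveOp_apply, map_add, bessel, hE.bdd_besselSymbol.op_mul (hE.bdd_waveSymbol t 0 0),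
    hE.bdd_besselSymbol.op_mul (hE.bdd_waveSymbol t 0 1)]
  congr 2
  refine hE.op_congr fun l hl => ?_
  change besselSymbol l * (sobolevSymbol l * symbolD t l) = symbolD t l
  linear_combination symbolD t l * sobolevSymbol_mul_besselSymbol hl

theorem Nonneg.hasDerivAt_displacement (hE : E.Nonneg) (x : H × H) (t : ℝ) :
    HasDerivAt (fun t => E.displacement (hE.waveGroup.op t x)) (hE.waveGroup.op t x).2 t := by
  simp only [hE.displacement_waveGroup_op]
  have hbound : Continuous fun t : ℝ => 2 * Real.exp (3 * |t|) := by fun_prop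
  refine .add ?_ ?_
  · refine hE.hasDerivAt_op (φ := fun t l => besselSymbol l * (symbolD t l + symbolDt t l))
      (φ' := fun t l => waveSymbol t l 1 0)
      (fun t => hE.bdd_besselSymbol.mul ((hE.bdd_symbolD t).add (hE.bdd_symbolDt t)))
      (fun t => measurable_waveSymbol t 1 0) hbound
      (fun t l hl => abs_waveSymbol_le t hl 1 0) (fun t l => ?_) _ t
    refine (((hasDerivAt_symbolD t l).add (hasDerivAt_symbolDt t l)).const_mul _).congr_deriv ?_
    change _ = -(l * besselSymbol l * symbolD t l)
    ring
  · exact hE.hasDerivAt_op (φ := symbolD) (φ' := fun t l => waveSymbol t l 1 1) hE.bdd_symbolD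
      (fun t => measurable_waveSymbol t 1 1) hbound (fun t l hl => abs_waveSymbol_le t hl 1 1)
      (fun t l => hasDerivAt_symbolD t l) _ t

end ResolutionOfIdentity

/-! ### Mild solutions and the first-order system -/

section Correspondence

open ResolutionOfIdentity

section Linear

variable {H : Type*} [NormedAddCommGroup H] [InnerProductSpace ℝ H] [CompleteSpace H]
  {A : H →ₗ.[ℝ] H}

theorem propD_eq_op (hE : (spectralResolution A).Nonneg) (t : ℝ) (f : H) :
    propD A t f = (spectralResolution A).op (symbolD t) f :=
  opFun_eq_op (hE.bdd_symbolD t) f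

theorem propDtD_eq_op (hE : (spectralResolution A).Nonneg) (t : ℝ) (f : H) :
    propDtD A t f = (spectralResolution A).op (symbolDt t) f := by
  rw [propDtD, funext fun l => (hasDerivAt_symbolD t l).deriv]
  exact opFun_eq_op (hE.bdd_symbolDt t) f

theorem propD_eq_displacement (hE : (spectralResolution A).Nonneg) (t : ℝ) (f : H) :
    propD A t f = (spectralResolution A).displacement (hE.waveGroup.op t (0, f)) := by
  rw [hE.displacement_waveGroup_op, propD_eq_op hE, map_zero, zero_add]

theorem linearSolution_eq_displacement (hE : (spectralResolution A).Nonneg) (v₀ u₁ : H) (t : ℝ) :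
    linearSolution A ((spectralResolution A).bessel v₀) u₁ t =
      (spectralResolution A).displacement (hE.waveGroup.op t (v₀, u₁)) := by
  have hfst : (spectralResolution A).op
      (fun l => besselSymbol l * (symbolD t l + symbolDt t l)) v₀ =
      (spectralResolution A).op (symbolD t) ((spectralResolution A).bessel v₀) +
        (spectralResolution A).op (symbolDt t) ((spectralResolution A).bessel v₀) := by
    rw [bessel, ← add_apply, ← (hE.bdd_symbolD t).op_add (hE.bdd_symbolDt t),
      ((hE.bdd_symbolD t).add (hE.bdd_symbolDt t)).op_mul hE.bdd_besselSymbol]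
    simp only [mul_comm]
  rw [hE.displacement_waveGroup_op, linearSolution, propD_eq_op hE, propDtD_eq_op hE, map_add, hfst]
  abel

theorem InSolutionSpace.exists_continuous_bessel_eq (hE : (spectralResolution A).Nonneg)
    {T : ℝ} (hT : 0 ≤ T) {u : ℝ → H} (hu : InSolutionSpace A T u) :
    ∃ v : ℝ → H, Continuous v ∧ ∀ t ∈ Icc 0 T, (spectralResolution A).bessel (v t) = u t := by
  obtain ⟨hmem, hcont, -⟩ := hu
  choose v hv using fun t : Icc 0 T => (memSobolev_one_iff hE).1 (hmem t t.2)
  have hv_cont : Continuous v := by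
    refine continuous_iff_continuousAt.2 fun t => ?_
    rw [ContinuousAt, tendsto_iff_norm_sub_tendsto_zero]
    refine ((hcont t t.2).comp (tendsto_nhdsWithin_iff.2
      ⟨continuous_subtype_val.tendsto t, Eventually.of_forall fun s => s.2⟩)).congr fun s => ?_
    rw [Function.comp_apply, ← hv, ← hv, ← map_sub, sobolevNorm_one_bessel hE]
  exact ⟨IccExtend hT v, hv_cont.Icc_extend', fun t ht => by rw [IccExtend_of_mem hT v ht, hv]⟩

end Linear

variable {X : Type*} [MeasurableSpace X] {μ : Measure X} {A : Lp ℝ 2 μ →ₗ.[ℝ] Lp ℝ 2 μ}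
  {F : ℝ → ℝ} {T : ℝ} {v₀ u₁ : Lp ℝ 2 μ} {u : ℝ → Lp ℝ 2 μ} {W : ℝ → Lp ℝ 2 μ × Lp ℝ 2 μ}

variable (A F) in
/-- The nonlinearity of the first-order system for `((I + A)^{1/2} u, ∂ₜu)`. -/
def energyNonlinearity (x : Lp ℝ 2 μ × Lp ℝ 2 μ) : Lp ℝ 2 μ × Lp ℝ 2 μ :=
  (0, superposition F ((spectralResolution A).displacement x))

theorem lipschitzOnBalls_energyNonlinearity {p B : ℝ} (hp : 1 < p) (hF : IsNonlinearity F p)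
    (hB₀ : 0 ≤ B) (hB : ∀ f : Lp ℝ 2 μ, eLpNorm ((spectralResolution A).bessel f)
      (ENNReal.ofReal (2 * p)) μ ≤ ENNReal.ofReal (B * ‖f‖)) :
    LipschitzOnBalls (energyNonlinearity A F) := fun R => by
  have hdisplacement : ∀ x, eLpNorm ((spectralResolution A).displacement x)
      (ENNReal.ofReal (2 * p)) μ ≤ ENNReal.ofReal (B * ‖x‖) := fun x =>
    (hB x.1).trans (ENNReal.ofReal_le_ofReal (by gcongr; exact norm_fst_le x))
  obtain ⟨K, hK⟩ := lipschitzOnBalls_superposition_comp hp hF hB₀ hdisplacement R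
  exact ⟨max 0 K, (LipschitzWith.const 0).lipschitzOnWith.prodMk hK⟩

theorem hasDerivWithinAt_displacement (hE : (spectralResolution A).Nonneg)
    (hW : hE.waveGroup.IsSolution (energyNonlinearity A F) (v₀, u₁) T W) {t : ℝ}
    (ht : t ∈ Icc 0 T) :
    HasDerivWithinAt (fun t => (spectralResolution A).displacement (hE.waveGroup.op t (W t)))
      (hE.waveGroup.op t (W t)).2 (Icc 0 T) t := by
  have hforcing : (spectralResolution A).displacement (hE.waveGroup.op t
      (hE.waveGroup.field (energyNonlinearity A F) t (W t))) = 0 := by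
    rw [StronglyContinuousGroup.field, hE.waveGroup.op_op_neg, displacement_apply,
      energyNonlinearity, map_zero]
  simpa only [hforcing, add_zero] using hE.waveGroup.hasDerivWithinAt_comp_op_apply
    (spectralResolution A).displacement (hW.2 t ht)
    (hE.hasDerivAt_displacement (W t) t).hasDerivWithinAt

theorem inSolutionSpace_of_isSolution (hE : (spectralResolution A).Nonneg) (hT : 0 < T)
    (hW : hE.waveGroup.IsSolution (energyNonlinearity A F) (v₀, u₁) T W)
    (hu : EqOn u (fun t => (spectralResolution A).displacement (hE.waveGroup.op t (W t)))
      (Icc 0 T)) :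
    InSolutionSpace A T u := by
  have hstate : ContinuousOn (fun t => hE.waveGroup.op t (W t)) (Icc 0 T) :=
    hE.waveGroup.continuousOn_op_comp hW.continuousOn
  have hderiv : ∀ t ∈ Icc 0 T, HasDerivWithinAt u (hE.waveGroup.op t (W t)).2 (Icc 0 T) t :=
    fun t ht => (hasDerivWithinAt_displacement hE hW ht).congr hu (hu ht)
  refine ⟨fun t ht => (memSobolev_one_iff hE).2 ⟨_, (hu ht).symm⟩, fun t ht => ?_, ?_⟩
  · refine (tendsto_iff_norm_sub_tendsto_zero.1
      (continuous_fst.comp_continuousOn hstate t ht)).congr' ?_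
    filter_upwards [self_mem_nhdsWithin] with s hs
    rw [hu hs, hu ht, ← map_sub, displacement_apply, sobolevNorm_one_bessel hE]
    rfl
  · rw [contDiffOn_one_iff_derivWithin (uniqueDiffOn_Icc hT)]
    exact ⟨fun t ht => (hderiv t ht).differentiableWithinAt,
      (continuous_snd.comp_continuousOn hstate).congr fun t ht =>
        (hderiv t ht).derivWithin (uniqueDiffOn_Icc hT t ht)⟩

theorem isMildSolution_of_isSolution (hE : (spectralResolution A).Nonneg)
    (hΦ : Continuous (energyNonlinearity A F))
    (hmem : ∀ v : Lp ℝ 2 μ, MemLp (fun x => F ((spectralResolution A).bessel v x)) 2 μ)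
    (hT : 0 < T) (hW : hE.waveGroup.IsSolution (energyNonlinearity A F) (v₀, u₁) T W)
    (hu : EqOn u (fun t => (spectralResolution A).displacement (hE.waveGroup.op t (W t)))
      (Icc 0 T)) :
    IsMildSolution A F ((spectralResolution A).bessel v₀) u₁ T u := by
  refine ⟨inSolutionSpace_of_isSolution hE hT hW hu, fun τ hτ => ?_, fun t ht => ?_⟩
  · rw [hu hτ]
    exact hmem _
  obtain ⟨hcont, hduhamel⟩ := hW.duhamel hΦ ht
  have hintegrand : EqOn (fun τ => propD A (t - τ) (superposition F (u τ)))
      (fun τ => (spectralResolution A).displacement (hE.waveGroup.op (t - τ)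
        (energyNonlinearity A F (hE.waveGroup.op τ (W τ))))) (Icc 0 t) := fun τ hτ => by
    simp only [hu ⟨hτ.1, hτ.2.trans ht.2⟩, propD_eq_displacement hE, energyNonlinearity]
  refine ⟨(((spectralResolution A).displacement.continuous.comp_continuousOn hcont).congr
    hintegrand).intervalIntegrable_of_Icc ht.1, ?_⟩
  rw [intervalIntegral.integral_congr (by rwa [uIcc_of_le ht.1]),
    (spectralResolution A).displacement.intervalIntegral_comp_comm
      (hcont.intervalIntegrable_of_Icc ht.1),
    linearSolution_eq_displacement hE, ← map_add, ← hduhamel, hu ht]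

theorem exists_isSolution_of_isMildSolution (hE : (spectralResolution A).Nonneg)
    (hΦ : Continuous (energyNonlinearity A F)) (hT : 0 ≤ T)
    (hu : IsMildSolution A F ((spectralResolution A).bessel v₀) u₁ T u) :
    ∃ W, hE.waveGroup.IsSolution (energyNonlinearity A F) (v₀, u₁) T W ∧
      EqOn u (fun t => (spectralResolution A).displacement (hE.waveGroup.op t (W t)))
        (Icc 0 T) := by
  obtain ⟨hspace, -, hmild⟩ := hu
  obtain ⟨v, hv_cont, hv⟩ := hspace.exists_continuous_bessel_eq hE hT
  -- `energyNonlinearity` only sees the first component of a state, so `0` serves as the second.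
  let Ψ : ℝ → Lp ℝ 2 μ × Lp ℝ 2 μ := fun τ => energyNonlinearity A F (v τ, 0)
  have hΨ : Continuous Ψ := hΦ.comp (hv_cont.prodMk continuous_const)
  obtain ⟨W, hW₀, hW_deriv, hW_duhamel⟩ := hE.waveGroup.exists_duhamel hΨ (v₀, u₁)
  have hu_eq : EqOn u (fun t => (spectralResolution A).displacement (hE.waveGroup.op t (W t)))
      (Icc 0 T) := fun t ht => by
    obtain ⟨hcont, hduhamel⟩ := hW_duhamel t
    have hintegrand : EqOn (fun τ => propD A (t - τ) (superposition F (u τ)))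
        (fun τ => (spectralResolution A).displacement (hE.waveGroup.op (t - τ) (Ψ τ)))
        (uIcc 0 t) := fun τ hτ => by
      rw [uIcc_of_le ht.1] at hτ
      simp only [Ψ, propD_eq_displacement hE, energyNonlinearity, displacement_apply,
        hv τ ⟨hτ.1, hτ.2.trans ht.2⟩]
    simp only [hduhamel, map_add, (hmild t ht).2, linearSolution_eq_displacement hE,
      intervalIntegral.integral_congr hintegrand,
      (spectralResolution A).displacement.intervalIntegral_comp_comm
        (hcont.intervalIntegrable 0 t)]
  refine ⟨W, ⟨hW₀, fun t ht => ?_⟩, hu_eq⟩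
  have hforcing : energyNonlinearity A F (hE.waveGroup.op t (W t)) = Ψ t := by
    have hfst : (hE.waveGroup.op t (W t)).1 = v t :=
      hE.bessel_injective ((hu_eq ht).symm.trans (hv t ht).symm)
    simp only [Ψ, energyNonlinearity, displacement_apply, hfst]
  rw [StronglyContinuousGroup.field, hforcing]
  exact (hW_deriv t).hasDerivWithinAt

theorem existsUniqueMildSolution_iff (hE : (spectralResolution A).Nonneg)
    (hΦ : LipschitzOnBalls (energyNonlinearity A F))
    (hmem : ∀ v : Lp ℝ 2 μ, MemLp (fun x => F ((spectralResolution A).bessel v x)) 2 μ)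
    (hT : 0 < T) : ExistsUniqueMildSolution A F ((spectralResolution A).bessel v₀) u₁ T ↔
      ∃ W, hE.waveGroup.IsSolution (energyNonlinearity A F) (v₀, u₁) T W := by
  constructor
  · rintro ⟨u, hu, -⟩
    obtain ⟨W, hW, -⟩ := exists_isSolution_of_isMildSolution hE hΦ.continuous hT.le hu
    exact ⟨W, hW⟩
  · rintro ⟨W, hW⟩
    refine ⟨_, isMildSolution_of_isSolution hE hΦ.continuous hmem hT hW fun t _ => rfl,
      fun u hu t ht => ?_⟩
    obtain ⟨W', hW', hu'⟩ := exists_isSolution_of_isMildSolution hE hΦ.continuous hT.le hu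
    simp only [hu' ht, hW'.eqOn hΦ hW ht]

end Correspondence

/-! ### Existence time, maximal solutions and blow-up -/

section MaximalSolution

open ResolutionOfIdentity

variable {X : Type*} [MeasurableSpace X] {μ : Measure X} {A : Lp ℝ 2 μ →ₗ.[ℝ] Lp ℝ 2 μ}
  {F : ℝ → ℝ} {T : ℝ} {v₀ u₁ : Lp ℝ 2 μ} {u : ℝ → Lp ℝ 2 μ}

theorem exists_local_existence_time (hE : (spectralResolution A).Nonneg)
    (hΦ : LipschitzOnBalls (energyNonlinearity A F))
    (hmem : ∀ v : Lp ℝ 2 μ, MemLp (fun x => F ((spectralResolution A).bessel v x)) 2 μ) :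
    ∃ T : ℝ → ℝ → ℝ, (∀ a b, 0 < T a b) ∧ ∀ v₀ u₁ : Lp ℝ 2 μ,
      ExistsUniqueMildSolution A F ((spectralResolution A).bessel v₀) u₁ (T ‖v₀‖ ‖u₁‖) := by
  choose δ hδ hsol using fun a b : ℝ => hE.waveGroup.exists_local_solution hΦ 0 (max a b)
  refine ⟨δ, hδ, fun v₀ u₁ => ?_⟩
  obtain ⟨W, hW₀, hW⟩ := hsol ‖v₀‖ ‖u₁‖ 0 ⟨le_rfl, le_rfl⟩ (v₀, u₁) le_rfl
  rw [zero_add] at hW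
  exact (existsUniqueMildSolution_iff hE hΦ hmem (hδ _ _)).2 ⟨W, hW₀, hW⟩

theorem ofReal_le_maximalTime {u₀ : Lp ℝ 2 μ} (hT : 0 < T)
    (h : ExistsUniqueMildSolution A F u₀ u₁ T) : ENNReal.ofReal T ≤ maximalTime A F u₀ u₁ :=
  le_sSup ⟨T, hT, h, rfl⟩

theorem exists_isSolution_of_lt_maximalTime (hE : (spectralResolution A).Nonneg)
    (hΦ : Continuous (energyNonlinearity A F))
    (hT : ENNReal.ofReal T < maximalTime A F ((spectralResolution A).bessel v₀) u₁) :
    ∃ W, hE.waveGroup.IsSolution (energyNonlinearity A F) (v₀, u₁) T W := by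
  obtain ⟨-, ⟨T', hT'₀, ⟨u, hu, -⟩, rfl⟩, hlt⟩ := lt_sSup_iff.1 hT
  obtain ⟨W, hW, -⟩ := exists_isSolution_of_isMildSolution hE hΦ hT'₀.le hu
  exact ⟨W, hW.mono ((ENNReal.ofReal_lt_ofReal_iff hT'₀).1 hlt).le⟩

theorem exists_isMaximalSolution (hE : (spectralResolution A).Nonneg)
    (hΦ : LipschitzOnBalls (energyNonlinearity A F))
    (hmem : ∀ v : Lp ℝ 2 μ, MemLp (fun x => F ((spectralResolution A).bessel v x)) 2 μ)
    (v₀ u₁ : Lp ℝ 2 μ) :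
    ∃ u, IsMaximalSolution A F ((spectralResolution A).bessel v₀) u₁ u := by
  choose! W hW using fun (T : ℝ) (hT : ENNReal.ofReal T <
    maximalTime A F ((spectralResolution A).bessel v₀) u₁) =>
      exists_isSolution_of_lt_maximalTime hE hΦ.continuous hT
  refine ⟨fun t => (spectralResolution A).displacement (hE.waveGroup.op t (W t t)),
    fun T hT₀ hT => isMildSolution_of_isSolution hE hΦ.continuous hmem hT₀ (hW T hT)
      fun t ht => ?_⟩
  have ht_lt := (ENNReal.ofReal_le_ofReal ht.2).trans_lt hT
  simp only [(hW t ht_lt).eqOn hΦ ((hW T hT).mono ht.2) ⟨ht.1, le_rfl⟩]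

theorem norm_state_le (hE : (spectralResolution A).Nonneg) {W : ℝ → Lp ℝ 2 μ × Lp ℝ 2 μ}
    (hW : hE.waveGroup.IsSolution (energyNonlinearity A F) (v₀, u₁) T W)
    (hu : EqOn u (fun t => (spectralResolution A).displacement (hE.waveGroup.op t (W t)))
      (Icc 0 T)) {t : ℝ} (ht : t ∈ Ioo 0 T) :
    ‖hE.waveGroup.op t (W t)‖ ≤ sobolevNorm A 1 (u t) + ‖deriv u t‖ := by
  have ht' : t ∈ Icc 0 T := Ioo_subset_Icc_self ht
  have hderiv : deriv u t = (hE.waveGroup.op t (W t)).2 :=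
    (((hasDerivWithinAt_displacement hE hW ht').congr hu (hu ht')).hasDerivAt
      (Icc_mem_nhds ht.1 ht.2)).deriv
  rw [hderiv, hu ht']
  simp only [displacement_apply]
  rw [sobolevNorm_one_bessel hE, Prod.norm_def]
  exact max_le_add_of_nonneg (norm_nonneg _) (norm_nonneg _)

theorem IsMaximalSolution.blowUp (hE : (spectralResolution A).Nonneg)
    (hΦ : LipschitzOnBalls (energyNonlinearity A F))
    (hmem : ∀ v : Lp ℝ 2 μ, MemLp (fun x => F ((spectralResolution A).bessel v x)) 2 μ)
    (hu : IsMaximalSolution A F ((spectralResolution A).bessel v₀) u₁ u)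
    (hpos : 0 < maximalTime A F ((spectralResolution A).bessel v₀) u₁)
    (hfin : maximalTime A F ((spectralResolution A).bessel v₀) u₁ < ∞) :
    Tendsto (fun t => sobolevNorm A 1 (u t) + ‖deriv u t‖)
      (𝓝[<] (maximalTime A F ((spectralResolution A).bessel v₀) u₁).toReal) atTop := by
  obtain ⟨τ, hτ⟩ : ∃ τ : ℝ,
      maximalTime A F ((spectralResolution A).bessel v₀) u₁ = ENNReal.ofReal τ :=
    ⟨_, (ENNReal.ofReal_toReal hfin.ne).symm⟩
  have hτ₀ : 0 < τ := ENNReal.ofReal_pos.1 (hτ ▸ hpos)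
  rw [hτ, ENNReal.toReal_ofReal hτ₀.le]
  refine tendsto_atTop.2 fun b => ?_
  obtain ⟨δ, hδ, hextend⟩ := hE.waveGroup.exists_extension_time hΦ τ b
  filter_upwards [Ioo_mem_nhdsLT (max_lt hτ₀ (sub_lt_self τ hδ))] with t ⟨hmax, htτ⟩
  obtain ⟨ht₀, htδ⟩ := max_lt_iff.1 hmax
  by_contra! hbounded
  obtain ⟨T, htT, hTτ⟩ := exists_between htτ
  have hT₀ : 0 < T := ht₀.trans htT
  have hT_lt : ENNReal.ofReal T < maximalTime A F ((spectralResolution A).bessel v₀) u₁ :=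
    hτ ▸ (ENNReal.ofReal_lt_ofReal_iff hτ₀).2 hTτ
  obtain ⟨W, hW, huW⟩ :=
    exists_isSolution_of_isMildSolution hE hΦ.continuous hT₀.le (hu T hT₀ hT_lt)
  have hextension := hextend t ⟨ht₀.le, htτ.le⟩ _ W (hW.mono htT.le)
    ((norm_state_le hE hW huW ⟨ht₀, htT⟩).trans hbounded.le)
  have hle := ofReal_le_maximalTime (add_pos ht₀ hδ)
    ((existsUniqueMildSolution_iff hE hΦ hmem (add_pos ht₀ hδ)).2 hextension)
  rw [hτ, ENNReal.ofReal_le_ofReal_iff hτ₀.le] at hle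
  linarith

end MaximalSolution

end DampedWave

end

theorem mainTheorem3_general {X : Type*} [MeasurableSpace X] (μ : Measure X)
    (A : Lp ℝ 2 μ →ₗ.[ℝ] Lp ℝ 2 μ) (_hA : IsSelfAdjoint A) (hA₀ : DampedWave.IsNonneg A)
    (α : ℝ) (hα : 0 < α) (hdecay : DampedWave.HeatDecay A α)
    (hLq : DampedWave.HeatLqBounds A α)
    (p : ℝ) (hp : 1 < p) (hpα : 1 / 2 < α → p ≤ 2 * α / (2 * α - 1))
    (F : ℝ → ℝ) (hF : DampedWave.IsNonlinearity F p) :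
    (∃ T : ℝ → ℝ → ℝ, (∀ a b, 0 < T a b) ∧
      ∀ u₀ u₁ : Lp ℝ 2 μ, DampedWave.MemSobolev A 1 u₀ →
        DampedWave.ExistsUniqueMildSolution A F u₀ u₁
          (T (DampedWave.sobolevNorm A 1 u₀) ‖u₁‖)) ∧
    ∀ u₀ u₁ : Lp ℝ 2 μ, DampedWave.MemSobolev A 1 u₀ →
      (∃ u : ℝ → Lp ℝ 2 μ, DampedWave.IsMaximalSolution A F u₀ u₁ u) ∧
      ∀ u : ℝ → Lp ℝ 2 μ, DampedWave.IsMaximalSolution A F u₀ u₁ u →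
        DampedWave.maximalTime A F u₀ u₁ < ∞ →
        Tendsto (fun t => DampedWave.sobolevNorm A 1 (u t) + ‖deriv u t‖)
          (𝓝[<] (DampedWave.maximalTime A F u₀ u₁).toReal) atTop := by
  have hE := DampedWave.spectralResolution_nonneg hA₀
  obtain ⟨B, hB₀, hB⟩ := DampedWave.exists_eLpNorm_bessel_le hE hα hdecay hLq hp hpα
  have hΦ := DampedWave.lipschitzOnBalls_energyNonlinearity hp hF hB₀ hB
  have hmem := fun v => DampedWave.memLp_comp_of_eLpNorm_lt_top hp hF _
    ((hB v).trans_lt ENNReal.ofReal_lt_top)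
  obtain ⟨T, hT, hsol⟩ := DampedWave.exists_local_existence_time hE hΦ hmem
  refine ⟨⟨T, hT, fun u₀ u₁ hu₀ => ?_⟩, fun u₀ u₁ hu₀ => ?_⟩ <;>
    obtain ⟨v₀, rfl⟩ := (DampedWave.memSobolev_one_iff hE).1 hu₀
  · rw [DampedWave.sobolevNorm_one_bessel hE]
    exact hsol v₀ u₁
  · have hpos := (ENNReal.ofReal_pos.2 (hT _ _)).trans_le
      (DampedWave.ofReal_le_maximalTime (hT _ _) (hsol v₀ u₁))
    exact ⟨DampedWave.exists_isMaximalSolution hE hΦ hmem v₀ u₁,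
      fun u hu hfin => hu.blowUp hE hΦ hmem hpos hfin⟩

theorem mainTheorem3 {X : Type*} [MeasurableSpace X] (μ : Measure X) [SigmaFinite μ]
    (A : Lp ℝ 2 μ →ₗ.[ℝ] Lp ℝ 2 μ) (hA : IsSelfAdjoint A) (hA₀ : DampedWave.IsNonneg A)
    (α : ℝ) (hα : 0 < α) (hdecay : DampedWave.HeatDecay A α)
    (hLq : DampedWave.HeatLqBounds A α)
    (p : ℝ) (hp : 1 < p) (hpα : 1 / 2 < α → p ≤ 2 * α / (2 * α - 1))
    (F : ℝ → ℝ) (hF : DampedWave.IsNonlinearity F p) :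
    (∃ T : ℝ → ℝ → ℝ, (∀ a b, 0 < T a b) ∧
      ∀ u₀ u₁ : Lp ℝ 2 μ, DampedWave.MemSobolev A 1 u₀ →
        DampedWave.ExistsUniqueMildSolution A F u₀ u₁
          (T (DampedWave.sobolevNorm A 1 u₀) ‖u₁‖)) ∧
    ∀ u₀ u₁ : Lp ℝ 2 μ, DampedWave.MemSobolev A 1 u₀ →
      (∃ u : ℝ → Lp ℝ 2 μ, DampedWave.IsMaximalSolution A F u₀ u₁ u) ∧
      ∀ u : ℝ → Lp ℝ 2 μ, DampedWave.IsMaximalSolution A F u₀ u₁ u →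
        DampedWave.maximalTime A F u₀ u₁ < ∞ →
        Tendsto (fun t => DampedWave.sobolevNorm A 1 (u t) + ‖deriv u t‖)
          (𝓝[<] (DampedWave.maximalTime A F u₀ u₁).toReal) atTop :=
  mainTheorem3_general μ A hA hA₀ α hα hdecay hLq p hp hpα F hF
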